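/- **Setting.** Let $d\in\{2,3\}$, $T>0$, and let $a>0$, $\gamma>1$, $\alpha>0$, $\mu>0$, $\lambda\ge 0$. Put $p(\varrho)=a\varrho^\gamma$, $\mathcal H(\varrho)=\frac{a}{\gamma-1}\varrho^\gamma$ and $\mathbb S(\mathbb G)=\mu\bigl(\mathbb G+\mathbb G^T-\frac2d(\operatorname{tr}\mathbb G)\mathbb I\bigr)+\lambda(\operatorname{tr}\mathbb G)\mathbb I$. Either $\Omega\subset\mathbb R^d$ is a bounded open set with Lipschitz boundary and outward unit normal $\mathbf n$ (with the boundary conditions $\mathbf u=\mathbf 0$, $\mathbf B\times\mathbf n=\mathbf 0$ on $\partial\Omega$), or $\Omega=\overline\Omega$ is the flat torus $\mathbb R^d/\mathbb Z^d$ (then all boundary conditions are void). For $d=2$, cross products and curls are those of the planar fields regarded as fields in $\mathbb R^3$ that do not depend on $x_3$. The compressible isentropic MHD system is $$\partial_t\varrho+\operatorname{div}(\varrho\mathbf u)=0,\qquad \partial_t(\varrho\mathbf u)+\operatorname{div}(\varrho\mathbf u\otimes\mathbf u)+\nabla p(\varrho)=\operatorname{div}\mathbb S(\nabla\mathbf u)+\operatorname{Curl}\mathbf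 B\times\mathbf B,$$ $$\partial_t\mathbf B=\operatorname{Curl}(\mathbf u\times\mathbf B)-\alpha\operatorname{Curl}\operatorname{Curl}\mathbf B,\qquad \operatorname{div}\mathbf B=0 .$$ **Dissipative weak (DW) solution.** A triple $(\varrho,\mathbf u,\mathbf B)$ is a DW solution on $(0,T)\times\Omega$ with initial data $(\varrho_0,\mathbf m_0,\mathbf B_0)$ and defect measures $\mu_c\in L^\infty(0,T;\mathcal M(\overline\Omega;\mathbb R^{d\times d}_{sym}))$, $\mu_B\in L^2(0,T;\mathcal M(\overline\Omega;\mathbb R^d))$, $\mathfrak D\in L^\infty(0,T;\mathcal M^+(\overline\Omega))$, $\mathfrak C\in\mathcal M^+([0,T]\times\overline\Omega)$ (the time-dependent ones weakly-* measurable in $t$) if the following hold. 1. $\varrho\ge0$, $\varrho\in L^\infty(0,T;L^\gamma(\Omega))$, $\sqrt\varrho\,\mathbf u,\ \mathbf B\in L^\infty(0,T;L^2(\Omega;\mathbb R^d))$, $\mathbf u\in L^2(0,T;W_0^{1,2}(\Omega;\mathbb R^d))$, $\operatorname{Curl}\mathbf B\in L^2((0,T)\times\Omega)$, and $\mathbf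 B(t)\in H_0(\operatorname{Curl};\Omega)$ for a.e. $t$ (that is, $\mathbf B\times\mathbf n=\mathbf 0$ in the sense of traces). 2. For every $\varphi\in C^1([0,T]\times\overline\Omega)$ and a.e. $\tau\in(0,T)$, $$\int_0^\tau\!\!\int_\Omega(\varrho\,\partial_t\varphi+\varrho\mathbf u\cdot\nabla\varphi)\,dx\,dt=\int_\Omega\varrho(\tau)\varphi(\tau)\,dx-\int_\Omega\varrho_0\,\varphi(0)\,dx .$$ 3. For every $\boldsymbol\varphi\in C^1_c([0,T]\times\Omega;\mathbb R^d)$ and a.e. $\tau\in(0,T)$, $$\int_0^\tau\!\!\int_\Omega\bigl(\varrho\mathbf u\cdot\partial_t\boldsymbol\varphi+\varrho\mathbf u\otimes\mathbf u:\nabla\boldsymbol\varphi+p(\varrho)\operatorname{div}\boldsymbol\varphi-\mathbb S(\nabla\mathbf u):\nabla\boldsymbol\varphi+(\operatorname{Curl}\mathbf B\times\mathbf B)\cdot\boldsymbol\varphi\bigr)dx\,dt$$ $$+\int_0^\tau\!\!\int_{\overline\Omega}\nabla\boldsymbol\varphi:d\mu_c(t)\,dt+\int_0^\tau\!\!\int_{\overline\Omega}\boldsymbol\varphi\cdot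 d\mu_B(t)\,dt=\int_\Omega\varrho\mathbf u(\tau)\cdot\boldsymbol\varphi(\tau)\,dx-\int_\Omega\mathbf m_0\cdot\boldsymbol\varphi(0)\,dx .$$ 4. For every $\boldsymbol\varphi\in C^1([0,T]\times\overline\Omega;\mathbb R^d)$ with $\boldsymbol\varphi\times\mathbf n=\mathbf 0$ on $\partial\Omega$ and a.e. $\tau\in(0,T)$, $$\int_0^\tau\!\!\int_\Omega\bigl(\mathbf B\cdot\partial_t\boldsymbol\varphi+(\mathbf u\times\mathbf B)\cdot\operatorname{Curl}\boldsymbol\varphi-\alpha\operatorname{Curl}\mathbf B\cdot\operatorname{Curl}\boldsymbol\varphi\bigr)dx\,dt=\int_\Omega\mathbf B(\tau)\cdot\boldsymbol\varphi(\tau)\,dx-\int_\Omega\mathbf B_0\cdot\boldsymbol\varphi(0)\,dx .$$ 5. For every $\varphi\in C^1_c(\Omega)$, $\int_\Omega\mathbf B(t)\cdot\nabla\varphi\,dx=0$ for a.e. $t\in(0,T)$. 6. For a.e. $\tau\in(0,T)$, $$\int_\Omega\Bigl[\tfrac12\varrho|\mathbf u|^2+\tfrac12|\mathbf B|^2+\mathcal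 H(\varrho)\Bigr](\tau)\,dx+\int_0^\tau\!\!\int_\Omega\bigl(\mathbb S(\nabla\mathbf u):\nabla\mathbf u+\alpha|\operatorname{Curl}\mathbf B|^2\bigr)dx\,dt$$ $$+\mathfrak D(\tau)(\overline\Omega)+\mathfrak C([0,\tau]\times\overline\Omega)\le\int_\Omega\Bigl[\tfrac12\tfrac{|\mathbf m_0|^2}{\varrho_0}+\tfrac12|\mathbf B_0|^2+\mathcal H(\varrho_0)\Bigr]dx .$$ 7. There is a constant $C$ such that for all $\psi\in C([0,T])$, $\psi\ge0$, and all $\epsilon>0$, $$\int_0^T\psi\,|\mu_c(t)|(\overline\Omega)\,dt\le C\int_0^T\psi\,\mathfrak D(t)(\overline\Omega)\,dt,$$ $$\int_0^T\psi\,|\mu_B(t)|(\overline\Omega)\,dt\le C\Bigl(\frac1\epsilon\int_0^T\psi\,\mathfrak D(t)(\overline\Omega)\,dt+\epsilon\int_{[0,T]\times\overline\Omega}\psi(t)\,d\mathfrak C\Bigr).$$ **Theorem (weak–strong uniqueness).** Let $\varrho_0>0$ on $\overline\Omega$ and $\operatorname{div}\mathbf B_0=0$. Let $(\varrho,\mathbf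 u,\mathbf B)$ be a DW solution with initial data $(\varrho_0,\varrho_0\mathbf u_0,\mathbf B_0)$ and defect measures $\mu_c,\mu_B,\mathfrak D,\mathfrak C$. Let $(\tilde\varrho,\tilde{\mathbf u},\tilde{\mathbf B})$, with $\tilde\varrho\in C^1([0,T]\times\overline\Omega)$ and $\tilde{\mathbf u},\tilde{\mathbf B}\in C^2([0,T]\times\overline\Omega;\mathbb R^d)$, satisfy the MHD system pointwise in $(0,T)\times\Omega$, the boundary conditions $\tilde{\mathbf u}=\mathbf 0$, $\tilde{\mathbf B}\times\mathbf n=\mathbf 0$ on $[0,T]\times\partial\Omega$, and $(\tilde\varrho,\tilde\varrho\tilde{\mathbf u},\tilde{\mathbf B})|_{t=0}=(\varrho_0,\varrho_0\mathbf u_0,\mathbf B_0)$ on $\overline\Omega$. Then $$\mu_c(t)=\mathbf 0,\quad \mu_B(t)=\mathbf 0,\quad \mathfrak D(t)=0\quad\text{for a.e. }t\in(0,T),\qquad \mathfrak C=0\ \text{ on }[0,T)\times\overline\Omega,$$ and $$\varrho=\tilde\varrho,\qquad \mathbf u=\tilde{\mathbf u},\qquad \mathbf B=\tilde{\mathbf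 B}\qquad\text{a.e. in }(0,T)\times\Omega .$$ -/

import Mathlib

open MeasureTheory Set Filter Topology

namespace MHD

noncomputable section

/-! ### Vectors, matrices and differential operators -/

/-- Vectors of `ℝᵈ` with the Euclidean norm. -/
abbrev Vec (d : ℕ) := EuclideanSpace ℝ (Fin d)

/-- Real `d × d` matrices with the Frobenius norm; the inner product of `Mat d` is the
contraction `A : B = ∑ᵢⱼ Aᵢⱼ Bᵢⱼ`, and the entry `Aᵢⱼ` is `A (i, j)`. -/
abbrev Mat (d : ℕ) := EuclideanSpace ℝ (Fin d × Fin d)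

/-- The partial derivative `∂ⱼ f`. -/
def partialD {d : ℕ} (j : Fin d) (f : Vec d → ℝ) (x : Vec d) : ℝ :=
  fderiv ℝ f x (EuclideanSpace.single j 1)

/-- The gradient of a vector field, `(∇v)ᵢⱼ = ∂ⱼ vᵢ`. -/
def jacobian {d : ℕ} (v : Vec d → Vec d) (x : Vec d) : Mat d :=
  WithLp.toLp 2 fun p => partialD p.2 (fun y => v y p.1) x

/-- The divergence of a vector field. -/
def divergence {d : ℕ} (v : Vec d → Vec d) (x : Vec d) : ℝ :=
  ∑ i, partialD i (fun y => v y i) x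

/-- The row-wise divergence of a matrix field, `(div A)ᵢ = ∑ⱼ ∂ⱼ Aᵢⱼ`. -/
def matDivergence {d : ℕ} (A : Vec d → Mat d) (x : Vec d) : Vec d :=
  WithLp.toLp 2 fun i => ∑ j, partialD j (fun y => A y (i, j)) x

/-- The tensor product `u ⊗ v`. -/
def outer {d : ℕ} (u v : Vec d) : Mat d := WithLp.toLp 2 fun p => u p.1 * v p.2

/-- The identity matrix. -/
def idMat (d : ℕ) : Mat d := WithLp.toLp 2 fun p => if p.1 = p.2 then 1 else 0

/-- The transposed matrix. -/
def transp {d : ℕ} (A : Mat d) : Mat d := WithLp.toLp 2 fun p => A (p.2, p.1)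

/-- The trace of a matrix. -/
def tr {d : ℕ} (A : Mat d) : ℝ := ∑ i, A (i, i)

/-- The inclusion `ℝᵈ ⊆ ℝ³` (`d ≤ 3`) that fills up with zeros. For `d = 2` the cross product and
the curl of planar fields are those of the corresponding fields in space that do not depend on
the third variable. -/
def pad {d : ℕ} (v : Vec d) : Vec 3 :=
  WithLp.toLp 2 fun i => if h : i.1 < d then v ⟨i.1, h⟩ else 0

/-- The first `d` components of a vector of `ℝ³` (`d ≤ 3`). -/
def trunc {d : ℕ} (w : Vec 3) : Vec d :=
  WithLp.toLp 2 fun i => if h : i.1 < 3 then w ⟨i.1, h⟩ else 0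

/-- The cross product of `ℝ³`. -/
def cross (v w : Vec 3) : Vec 3 := WithLp.toLp 2 (crossProduct v.ofLp w.ofLp)

/-- The partial derivative `∂ⱼ` for `j = 1, 2, 3` of a function on `ℝᵈ` (`d ≤ 3`), regarded as a
function on `ℝ³` that does not depend on the remaining variables. -/
def partialD₃ {d : ℕ} (j : Fin 3) (f : Vec d → ℝ) (x : Vec d) : ℝ :=
  if h : j.1 < d then partialD ⟨j.1, h⟩ f x else 0

/-- The curl of an `ℝ³`-valued field on `ℝᵈ`. -/
def curl {d : ℕ} (F : Vec d → Vec 3) (x : Vec d) : Vec 3 :=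
  !₂[partialD₃ 1 (fun y => F y 2) x - partialD₃ 2 (fun y => F y 1) x,
     partialD₃ 2 (fun y => F y 0) x - partialD₃ 0 (fun y => F y 2) x,
     partialD₃ 0 (fun y => F y 1) x - partialD₃ 1 (fun y => F y 0) x]

/-! ### Constitutive relations -/

/-- The constants of the system: pressure coefficient `a`, adiabatic exponent `γ`, resistivity `α`,
shear viscosity `μ` and bulk viscosity `lam`. -/
structure Params where
  a : ℝ
  γ : ℝ
  α : ℝ
  μ : ℝ
  lam : ℝ

/-- The range of the constants. -/
structure Params.Valid (P : Params) : Prop where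
  a_pos : 0 < P.a
  one_lt_γ : 1 < P.γ
  α_pos : 0 < P.α
  μ_pos : 0 < P.μ
  lam_nonneg : 0 ≤ P.lam

/-- The Newtonian stress `𝕊(G) = μ (G + Gᵀ - (2/d) (tr G) 𝕀) + lam (tr G) 𝕀`. -/
def stress {d : ℕ} (P : Params) (G : Mat d) : Mat d :=
  P.μ • (G + transp G - (2 / (d : ℝ) * tr G) • idMat d) + (P.lam * tr G) • idMat d

/-- The pressure `p(r) = a r ^ γ`. -/
def pressure (P : Params) (r : ℝ) : ℝ := P.a * r ^ P.γ

/-- The pressure potential `H(r) = a / (γ - 1) r ^ γ`. -/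
def potential (P : Params) (r : ℝ) : ℝ := P.a / (P.γ - 1) * r ^ P.γ

/-! ### The spatial domain -/

/-- `ν` is the outward unit normal of `Ω` at `y`: up to an error `o(|x - y|)` the set `Ω`
coincides near `y` with the half space `(x - y) · ν < 0`. -/
def IsOutwardNormal {d : ℕ} (Ω : Set (Vec d)) (y ν : Vec d) : Prop :=
  ‖ν‖ = 1 ∧ ∀ ε > 0, ∃ δ > 0, ∀ x ∈ Metric.ball y δ,
    (inner ℝ (x - y) ν < -(ε * ‖x - y‖) → x ∈ Ω) ∧ (ε * ‖x - y‖ < inner ℝ (x - y) ν → x ∉ Ω)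

/-- `Ω` has a Lipschitz boundary: near every boundary point it is the set of points above the
graph of a Lipschitz function in some direction `e`. (The function `g` is defined on the whole
space, but does not depend on the coordinate in the direction `e`.) -/
def HasLipschitzBoundary {d : ℕ} (Ω : Set (Vec d)) : Prop :=
  ∀ y ∈ frontier Ω, ∃ (e : Vec d) (r : ℝ) (K : NNReal) (g : Vec d → ℝ),
    ‖e‖ = 1 ∧ 0 < r ∧ LipschitzWith K g ∧ (∀ (x : Vec d) (s : ℝ), g (x + s • e) = g x) ∧
      ∀ x ∈ Metric.ball y r, x ∈ Ω ↔ g x < inner ℝ e x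

/-- The two settings: a set `Ω ⊆ ℝᵈ` with the boundary conditions `u = 0`, `B × n = 0` on `∂Ω`, or
the flat torus `𝒯ᵈ = ℝᵈ / ℤᵈ`, where functions on the torus are `ℤᵈ`-periodic functions on `ℝᵈ`. -/
inductive Domain (d : ℕ) where
  | wall (Ω : Set (Vec d))
  | torus

namespace Domain

variable {d : ℕ}

/-- The set over which spatial integrals are taken: `Ω`, or the fundamental cell `[0,1)ᵈ` of the
torus. -/
def cell : Domain d → Set (Vec d)
  | wall Ω => Ω
  | torus => {x | ∀ i, x i ∈ Ico (0 : ℝ) 1}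

/-- The compact space that carries the defect measures: the closure of `Ω`, or the torus (whose
points are represented by those of `[0,1)ᵈ`, so that Borel measures on the torus are the Borel
measures on this cell). -/
def closedCell : Domain d → Set (Vec d)
  | wall Ω => closure Ω
  | torus => {x | ∀ i, x i ∈ Ico (0 : ℝ) 1}

/-- `Ω` is a bounded Lipschitz domain (nothing is required of the torus). -/
def Admissible : Domain d → Prop
  | wall Ω => IsOpen Ω ∧ Bornology.IsBounded Ω ∧ HasLipschitzBoundary Ω
  | torus => True

/-- Periodicity, in the case of the torus. -/
def Periodic {F : Type*} : Domain d → (Vec d → F) → Prop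
  | wall _, _ => True
  | torus, f => ∀ (x : Vec d) (i : Fin d), f (x + EuclideanSpace.single i 1) = f x

/-- `v = 0` on the boundary. -/
def ZeroOnBoundary : Domain d → (Vec d → Vec d) → Prop
  | wall Ω, v => ∀ y ∈ frontier Ω, v y = 0
  | torus, _ => True

/-- `v × n = 0` on the boundary, at all boundary points at which there is a normal. -/
def NoTangentialPart : Domain d → (Vec d → Vec d) → Prop
  | wall Ω, v => ∀ y ∈ frontier Ω, ∀ ν, IsOutwardNormal Ω y ν → cross (pad (v y)) (pad ν) = 0
  | torus, _ => True

/-- The function vanishes outside a compact subset of `Ω` (of the torus: no condition). -/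
def CompactlyInside {F : Type*} [Zero F] : Domain d → (Vec d → F) → Prop
  | wall Ω, f => ∃ K : Set (Vec d), IsCompact K ∧ K ⊆ Ω ∧ ∀ x ∉ K, f x = 0
  | torus, _ => True

/-- Lebesgue measure on the spatial domain. -/
def spaceMeasure (D : Domain d) : Measure (Vec d) := volume.restrict D.cell

/-- The smooth vector fields with compact support in the spatial domain. -/
def SmoothCompact (D : Domain d) (φ : Vec d → Vec d) : Prop :=
  ContDiff ℝ ((⊤ : ℕ∞) : WithTop ℕ∞) φ ∧ D.Periodic φ ∧ D.CompactlyInside φ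

/-- `v ∈ W₀^{1,2}(Ω; ℝᵈ)` (on the torus: `v ∈ W^{1,2}(𝒯ᵈ; ℝᵈ)`) and `∇v = G`. The space is the
closure of the smooth compactly supported fields in the norm of `W^{1,2}`. -/
def HasSobolevGradient (D : Domain d) (v : Vec d → Vec d) (G : Vec d → Mat d) : Prop :=
  ∃ φ : ℕ → Vec d → Vec d, (∀ n, D.SmoothCompact (φ n)) ∧
    Tendsto (fun n => eLpNorm (fun x => φ n x - v x) 2 D.spaceMeasure) atTop (𝓝 0) ∧
    Tendsto (fun n => eLpNorm (fun x => jacobian (φ n) x - G x) 2 D.spaceMeasure) atTop (𝓝 0)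

/-- `v ∈ H₀(Curl; Ω)`, i.e. `v, Curl v ∈ L²` and `v × n = 0` on `∂Ω` in the sense of traces (on the
torus: `v ∈ H(Curl; 𝒯ᵈ)`), and `Curl v = J`. The space is the closure of the smooth compactly
supported fields in the graph norm of `Curl`. -/
def HasSobolevCurl (D : Domain d) (v : Vec d → Vec d) (J : Vec d → Vec 3) : Prop :=
  ∃ φ : ℕ → Vec d → Vec d, (∀ n, D.SmoothCompact (φ n)) ∧
    Tendsto (fun n => eLpNorm (fun x => φ n x - v x) 2 D.spaceMeasure) atTop (𝓝 0) ∧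
    Tendsto (fun n => eLpNorm (fun x => curl (fun y => pad (φ n y)) x - J x) 2 D.spaceMeasure)
      atTop (𝓝 0)

end Domain

/-! ### Function spaces in time and space -/

/-- Lebesgue measure on `(0, T)`. -/
def timeMeasure (T : ℝ) : Measure ℝ := volume.restrict (Ioo 0 T)

variable {d : ℕ}

/-- Lebesgue measure on `(0, T) × Ω`. -/
def cylMeasure (D : Domain d) (T : ℝ) : Measure (ℝ × Vec d) :=
  (timeMeasure T).prod D.spaceMeasure

/-- `f ∈ L²(0, T; L²(Ω))`. -/
def MemL2L2 {F : Type*} [NormedAddCommGroup F] (D : Domain d) (T : ℝ) (f : ℝ → Vec d → F) : Prop :=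
  MemLp (fun z : ℝ × Vec d => f z.1 z.2) 2 (cylMeasure D T)

/-- `f ∈ L^∞(0, T; L^p(Ω))`. -/
def MemLinftyLp {F : Type*} [NormedAddCommGroup F] (D : Domain d) (T : ℝ) (p : ENNReal)
    (f : ℝ → Vec d → F) : Prop :=
  AEStronglyMeasurable (fun z : ℝ × Vec d => f z.1 z.2) (cylMeasure D T) ∧
    ∃ C : NNReal, ∀ᵐ t ∂timeMeasure T, eLpNorm (f t) p D.spaceMeasure ≤ C

/-- `μ ∈ L^p(0, T; M(closure Ω; F))`: the measures are carried by the closure of `Ω`, the map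
`t ↦ μ t` is weakly-* measurable, and the total variation norm is in `L^p(0, T)`. -/
structure MemLpMeasure {F : Type*} [NormedAddCommGroup F] [NormedSpace ℝ F] (D : Domain d) (T : ℝ)
    (p : ENNReal) (μ : ℝ → VectorMeasure (Vec d) F) : Prop where
  carried : ∀ᵐ t ∂timeMeasure T, (μ t).variation (D.closedCell)ᶜ = 0
  weakStar : ∀ f : Vec d → ℝ, Continuous f → D.Periodic f →
    AEStronglyMeasurable (fun t => VectorMeasure.integral (μ t) f (ContinuousLinearMap.lsmul ℝ ℝ))
      (timeMeasure T)
  finite : ∀ᵐ t ∂timeMeasure T, (μ t).variation D.closedCell < ⊤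
  norm_mem : MemLp (fun t => (μ t).variation.real D.closedCell) p (timeMeasure T)

/-- `D' ∈ L^∞(0, T; M⁺(closure Ω))`. -/
structure MemLinftyPosMeasure (D : Domain d) (T : ℝ) (D' : ℝ → Measure (Vec d)) : Prop where
  carried : ∀ᵐ t ∂timeMeasure T, D' t (D.closedCell)ᶜ = 0
  weakStar : ∀ f : Vec d → ℝ, Continuous f → D.Periodic f →
    AEStronglyMeasurable (fun t => ∫ x, f x ∂(D' t)) (timeMeasure T)
  bounded : ∃ C : NNReal, ∀ᵐ t ∂timeMeasure T, D' t D.closedCell ≤ C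

/-! Functions of class `C^k` on the closed cylinder `[0, T] × closure Ω` are restrictions to this set
of `C^k` functions on `ℝ × ℝᵈ`; for bounded Lipschitz domains these are the functions whose
derivatives up to order `k` extend continuously from `(0, T) × Ω` to the closed cylinder. -/

/-- Functions of class `C^k` on the closed cylinder. -/
def ClosedCk {F : Type*} [NormedAddCommGroup F] [NormedSpace ℝ F] (D : Domain d)
    (k : ℕ) (f : ℝ → Vec d → F) : Prop :=
  ContDiff ℝ k (fun z : ℝ × Vec d => f z.1 z.2) ∧ ∀ t, D.Periodic (f t)

/-- The time derivative `∂ₜ f (t, x)`. -/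
def timeD {F : Type*} [NormedAddCommGroup F] [NormedSpace ℝ F] (f : ℝ → Vec d → F) (t : ℝ)
    (x : Vec d) : F :=
  deriv (fun s => f s x) t

/-- Test functions `C¹_c([0, T] × Ω; ℝᵈ)` of the momentum equation. -/
def MomentumTest (D : Domain d) (T : ℝ) (φ : ℝ → Vec d → Vec d) : Prop :=
  ClosedCk D 1 φ ∧ match D with
    | .wall Ω => ∃ K : Set (Vec d), IsCompact K ∧ K ⊆ Ω ∧ ∀ t ∈ Icc 0 T, ∀ x ∉ K, φ t x = 0
    | .torus => True

/-- Test functions of the Maxwell equation: `C¹_c([0, T] × closure Ω; ℝᵈ)` with `φ × n = 0` on the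
boundary. -/
def MaxwellTest (D : Domain d) (T : ℝ) (φ : ℝ → Vec d → Vec d) : Prop :=
  ClosedCk D 1 φ ∧ ∀ t ∈ Icc 0 T, D.NoTangentialPart (φ t)

/-! ### Dissipative weak solutions -/

/-- The functions and defect measures that make up a dissipative weak solution. The fields `gradU`
and `curlB` are the weak gradient of `u` and the weak curl of `B`, which the definition of a solution
below ties to `u` and `B`. -/
structure DWFields (d : ℕ) where
  ρ : ℝ → Vec d → ℝ
  u : ℝ → Vec d → Vec d
  gradU : ℝ → Vec d → Mat d
  B : ℝ → Vec d → Vec d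
  curlB : ℝ → Vec d → Vec 3
  μc : ℝ → VectorMeasure (Vec d) (Mat d)
  μB : ℝ → VectorMeasure (Vec d) (Vec d)
  𝔇 : ℝ → Measure (Vec d)
  ℭ : Measure (ℝ × Vec d)

/-- The fields `S` form a dissipative weak solution of the compressible isentropic MHD system on
`(0, T)` with the initial data `(ρ₀, m₀, B₀)`. -/
structure IsDWSolution (P : Params) (D : Domain d) (T : ℝ) (ρ₀ : Vec d → ℝ) (m₀ B₀ : Vec d → Vec d)
    (S : DWFields d) : Prop where
  -- regularity and boundary conditions
  ρ_nonneg : ∀ᵐ z ∂cylMeasure D T, 0 ≤ S.ρ z.1 z.2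
  ρ_mem : MemLinftyLp D T (ENNReal.ofReal P.γ) S.ρ
  sqrtρ_u_mem : MemLinftyLp D T 2 (fun t x => √(S.ρ t x) • S.u t x)
  u_mem : MemL2L2 D T S.u
  gradU_mem : MemL2L2 D T S.gradU
  u_sobolev : ∀ᵐ t ∂timeMeasure T, D.HasSobolevGradient (S.u t) (S.gradU t)
  B_mem : MemLinftyLp D T 2 S.B
  curlB_mem : MemL2L2 D T S.curlB
  B_sobolev : ∀ᵐ t ∂timeMeasure T, D.HasSobolevCurl (S.B t) (S.curlB t)
  -- the defect measures
  μc_mem : MemLpMeasure D T ⊤ S.μc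
  μc_symm : ∀ᵐ t ∂timeMeasure T, ∀ A : Set (Vec d), transp (S.μc t A) = S.μc t A
  μB_mem : MemLpMeasure D T 2 S.μB
  𝔇_mem : MemLinftyPosMeasure D T S.𝔇
  ℭ_finite : IsFiniteMeasure S.ℭ
  ℭ_carried : S.ℭ (Icc 0 T ×ˢ D.closedCell)ᶜ = 0
  -- the continuity equation
  continuity : ∀ φ : ℝ → Vec d → ℝ, ClosedCk D 1 φ → ∀ᵐ τ ∂timeMeasure T,
    (∫ t in (0 : ℝ)..τ, ∫ x in D.cell,
        (S.ρ t x * timeD φ t x + inner ℝ (S.ρ t x • S.u t x) (gradient (φ t) x)))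
      = (∫ x in D.cell, S.ρ τ x * φ τ x) - ∫ x in D.cell, ρ₀ x * φ 0 x
  -- the momentum equation
  momentum : ∀ φ : ℝ → Vec d → Vec d, MomentumTest D T φ → ∀ᵐ τ ∂timeMeasure T,
    (∫ t in (0 : ℝ)..τ, ∫ x in D.cell,
        (inner ℝ (S.ρ t x • S.u t x) (timeD φ t x)
          + inner ℝ (S.ρ t x • outer (S.u t x) (S.u t x)) (jacobian (φ t) x)
          + pressure P (S.ρ t x) * divergence (φ t) x
          - inner ℝ (stress P (S.gradU t x)) (jacobian (φ t) x)
          + inner ℝ (cross (S.curlB t x) (pad (S.B t x))) (pad (φ t x))))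
      + (∫ t in (0 : ℝ)..τ, VectorMeasure.integral (S.μc t) (jacobian (φ t)) (innerSL ℝ))
      + (∫ t in (0 : ℝ)..τ, VectorMeasure.integral (S.μB t) (φ t) (innerSL ℝ))
      = (∫ x in D.cell, inner ℝ (S.ρ τ x • S.u τ x) (φ τ x)) - ∫ x in D.cell, inner ℝ (m₀ x) (φ 0 x)
  -- the Maxwell equation
  maxwell : ∀ φ : ℝ → Vec d → Vec d, MaxwellTest D T φ → ∀ᵐ τ ∂timeMeasure T,
    (∫ t in (0 : ℝ)..τ, ∫ x in D.cell,
        (inner ℝ (S.B t x) (timeD φ t x)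
          + inner ℝ (cross (pad (S.u t x)) (pad (S.B t x))) (curl (fun y => pad (φ t y)) x)
          - P.α * inner ℝ (S.curlB t x) (curl (fun y => pad (φ t y)) x)))
      = (∫ x in D.cell, inner ℝ (S.B τ x) (φ τ x)) - ∫ x in D.cell, inner ℝ (B₀ x) (φ 0 x)
  -- `div B = 0`, tested with compactly supported functions only: test functions that do not vanish
  -- on the boundary would impose `B · n = 0` on top of `B × n = 0`
  div_free : ∀ φ : Vec d → ℝ, ContDiff ℝ 1 φ → D.Periodic φ → D.CompactlyInside φ →
    ∀ᵐ t ∂timeMeasure T, ∫ x in D.cell, inner ℝ (S.B t x) (gradient φ x) = 0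
  -- the balance of total energy
  energy : ∀ᵐ τ ∂timeMeasure T,
    (∫ x in D.cell,
        (1 / 2 * S.ρ τ x * ‖S.u τ x‖ ^ 2 + 1 / 2 * ‖S.B τ x‖ ^ 2 + potential P (S.ρ τ x)))
      + (∫ t in (0 : ℝ)..τ, ∫ x in D.cell,
          (inner ℝ (stress P (S.gradU t x)) (S.gradU t x) + P.α * ‖S.curlB t x‖ ^ 2))
      + (S.𝔇 τ).real D.closedCell
      + S.ℭ.real (Icc 0 τ ×ˢ D.closedCell)
      ≤ ∫ x in D.cell,
          (1 / 2 * (‖m₀ x‖ ^ 2 / ρ₀ x) + 1 / 2 * ‖B₀ x‖ ^ 2 + potential P (ρ₀ x))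
  -- the compatibility conditions
  compat_c : ∃ C : ℝ, ∀ ψ : ℝ → ℝ, Continuous ψ → (∀ t ∈ Icc 0 T, 0 ≤ ψ t) →
    ∫ t in (0 : ℝ)..T, ψ t * (S.μc t).variation.real D.closedCell
      ≤ C * ∫ t in (0 : ℝ)..T, ψ t * (S.𝔇 t).real D.closedCell
  compat_B : ∃ C : ℝ, ∀ ε > 0, ∀ ψ : ℝ → ℝ, Continuous ψ → (∀ t ∈ Icc 0 T, 0 ≤ ψ t) →
    ∫ t in (0 : ℝ)..T, ψ t * (S.μB t).variation.real D.closedCell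
      ≤ C * (1 / ε * (∫ t in (0 : ℝ)..T, ψ t * (S.𝔇 t).real D.closedCell)
          + ε * ∫ z in Icc 0 T ×ˢ D.closedCell, ψ z.1 ∂S.ℭ)

/-! ### Classical solutions -/

/-- `(ρ, u, B)` is a classical solution of the compressible isentropic MHD system on `[0, T]` with
the initial data `(ρ₀, m₀, B₀)`, of class `C¹` in `ρ` and `C²` in `u` and `B` up to the boundary. -/
structure IsClassicalSolution (P : Params) (D : Domain d) (T : ℝ) (ρ₀ : Vec d → ℝ)
    (m₀ B₀ : Vec d → Vec d) (ρ : ℝ → Vec d → ℝ) (u B : ℝ → Vec d → Vec d) : Prop where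
  ρ_reg : ClosedCk D 1 ρ
  u_reg : ClosedCk D 2 u
  B_reg : ClosedCk D 2 B
  u_bc : ∀ t ∈ Icc 0 T, D.ZeroOnBoundary (u t)
  B_bc : ∀ t ∈ Icc 0 T, D.NoTangentialPart (B t)
  mass : ∀ t ∈ Ioo 0 T, ∀ x ∈ D.cell,
    timeD ρ t x + divergence (fun y => ρ t y • u t y) x = 0
  momentum : ∀ t ∈ Ioo 0 T, ∀ x ∈ D.cell,
    timeD (fun s y => ρ s y • u s y) t x + matDivergence (fun y => ρ t y • outer (u t y) (u t y)) x
        + gradient (fun y => pressure P (ρ t y)) x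
      = matDivergence (fun y => stress P (jacobian (u t) y)) x
        + trunc (cross (curl (fun y => pad (B t y)) x) (pad (B t x)))
  induction : ∀ t ∈ Ioo 0 T, ∀ x ∈ D.cell,
    pad (timeD B t x) = curl (fun y => cross (pad (u t y)) (pad (B t y))) x
      - P.α • curl (curl (fun y => pad (B t y))) x
  div_free : ∀ t ∈ Ioo 0 T, ∀ x ∈ D.cell, divergence (B t) x = 0
  initial_ρ : ∀ x ∈ D.closedCell, ρ 0 x = ρ₀ x
  initial_m : ∀ x ∈ D.closedCell, ρ 0 x • u 0 x = m₀ x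
  initial_B : ∀ x ∈ D.closedCell, B 0 x = B₀ x

end

end MHD

/-! Write (r, v, b) for the classical solution, H for the pressure potential, p for the pressure.
The distance between the two solutions is measured by the relative energy E(t) = ∫ ½ρ|u − v|² + ½|B
− b|² + H(ρ) − H'(r)(ρ − r) − H(r). Its density is nonnegative by convexity of H and, as r > 0,
vanishes only where the two states agree.

Expanding the squares (`relEnergyAt_eq`) leaves the total energy of the weak solution, three mixed
terms that are linear in ρu, ρ and B, and a term in the strong solution alone. The first is governed
by the energy inequality, the mixed ones by the momentum, continuity and Maxwell equations tested
with v, ½|v|² − H'(r) and b. The initial contributions cancel because the data agree. This gives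
E(τ) + 𝔇(τ) + ℭ([0,τ]) ≤ ∫ production + K ∫ (|μc| + |μB|), see `IsDWSolution.exists_relEnergy_le`.

Inserting the strong equations (`relative_energy_identity`) turns the production into −𝕊(∇u − ∇v) :
(∇u − ∇v), a remainder controlled by squares of differences, and terms that integrate to zero by
parts. The remainder contains −α|Curl(B − b)|², which absorbs the magnetic cross term. What is left
is at most C times the relative energy density, plus δ|u − v|², because u − v also occurs without
the weight ρ (`exists_remainder_bound`). The viscous dissipation absorbs this last term by Korn's
and Poincaré's inequalities. On the torus Poincaré's inequality must exclude constants; a truncation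
of ρ serves as weight there, since mass is conserved and the bound in L^γ prevents concentration.

The compatibility conditions bound ∫|μc| by ∫𝔇, and ∫|μB| by ε⁻¹∫𝔇 + εℭ([0,τ]). For small ε the last
part is absorbed on the left, and Grönwall's lemma for E + 𝔇 (`ae_nonpos_of_le_integral`) yields E =
𝔇 = 0, hence ℭ = 0 before T, and then μc = μB = 0.

Three points need analysis beyond this calculation. The field v vanishes on the boundary but not
near it, so it is approximated by compactly supported fields with bounded first derivatives that
converge almost everywhere (`exists_testApprox`). The boundary condition b × n = 0 is only known at
boundary points with a normal, so a divergence theorem for tangential fields on Lipschitz domains is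
needed (`integral_divergence_eq_zero_of_tangential`). Finally, r stays positive by a minimum
principle for the continuity equation (`IsClassicalSolution.exists_pos_lt`). -/

namespace MHD
noncomputable section

/-! ### Vector algebra -/

section Algebra

variable {d : ℕ}

/-- The matrix-vector product `G y`. -/
def mulV (G : Mat d) (y : Vec d) : Vec d := WithLp.toLp 2 fun i => ∑ j, G (i, j) * y j

lemma inner_vec (x y : Vec d) : inner ℝ x y = ∑ i, x i * y i := by
  simp [PiLp.inner_apply, mul_comm]

lemma inner_mat (A B : Mat d) : inner ℝ A B = ∑ i, ∑ j, A (i, j) * B (i, j) := by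
  simp [PiLp.inner_apply, mul_comm, Fintype.sum_prod_type]

lemma inner_outer (x y : Vec d) (G : Mat d) : inner ℝ (outer x y) G = inner ℝ x (mulV G y) := by
  simp only [inner_mat, inner_vec, outer, mulV, Finset.mul_sum]
  exact Finset.sum_congr rfl fun i _ => Finset.sum_congr rfl fun j _ => by ring

lemma mulV_sub (G : Mat d) (x y : Vec d) : mulV G (x - y) = mulV G x - mulV G y := by
  ext i; simp [mulV, mul_sub]

lemma norm_mulV_le (G : Mat d) (y : Vec d) : ‖mulV G y‖ ≤ ‖G‖ * ‖y‖ := by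
  have h : ‖mulV G y‖ ^ 2 ≤ (‖G‖ * ‖y‖) ^ 2 := by
    rw [mul_pow, EuclideanSpace.real_norm_sq_eq, EuclideanSpace.real_norm_sq_eq,
      EuclideanSpace.real_norm_sq_eq, Fintype.sum_prod_type, Finset.sum_mul]
    exact Finset.sum_le_sum fun i _ =>
      Finset.sum_mul_sq_le_sq_mul_sq Finset.univ (fun j => G (i, j)) (fun j => y j)
  exact le_of_sq_le_sq h (by positivity)

lemma inner_idMat (A : Mat d) : inner ℝ (idMat d) A = tr A := by
  simp [inner_mat, idMat, tr]

lemma tr_sub (A B : Mat d) : tr (A - B) = tr A - tr B := by simp [tr]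

lemma transp_sub (A B : Mat d) : transp (A - B) = transp A - transp B := by
  ext p; simp [transp]

lemma inner_stress (P : Params) (A B : Mat d) : inner ℝ (stress P A) B =
    P.μ * (inner ℝ A B + inner ℝ (transp A) B - 2 / (d : ℝ) * (tr A * tr B))
      + P.lam * (tr A * tr B) := by
  simp only [stress, inner_add_left, inner_sub_left, real_inner_smul_left, inner_idMat]
  ring

lemma inner_transp_comm (A B : Mat d) : inner ℝ (transp A) B = inner ℝ (transp B) A := by
  simp only [inner_mat, transp]
  rw [Finset.sum_comm]
  exact Finset.sum_congr rfl fun i _ => Finset.sum_congr rfl fun j _ => by ring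

lemma inner_stress_comm (P : Params) (A B : Mat d) :
    inner ℝ (stress P A) B = inner ℝ (stress P B) A := by
  rw [inner_stress, inner_stress, inner_transp_comm A B, real_inner_comm]
  ring

lemma stress_sub (P : Params) (A B : Mat d) : stress P (A - B) = stress P A - stress P B := by
  simp only [stress, tr_sub, transp_sub]
  module

lemma norm_transp (A : Mat d) : ‖transp A‖ = ‖A‖ := by
  have : ‖transp A‖ ^ 2 = ‖A‖ ^ 2 := by
    rw [EuclideanSpace.real_norm_sq_eq, EuclideanSpace.real_norm_sq_eq, Fintype.sum_prod_type,
      Fintype.sum_prod_type, Finset.sum_comm]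
    rfl
  exact (sq_eq_sq₀ (norm_nonneg _) (norm_nonneg _)).1 this

lemma abs_tr_le (A : Mat d) : |tr A| ≤ ‖idMat d‖ * ‖A‖ := by
  rw [← inner_idMat]; exact abs_real_inner_le_norm _ _

lemma norm_stress_le (P : Params) (A : Mat d) : ‖stress P A‖ ≤
    (|P.μ| * (2 + 2 / d * ‖idMat d‖ * ‖idMat d‖) + |P.lam| * ‖idMat d‖ * ‖idMat d‖) * ‖A‖ := by
  have h1 : ‖(2 / (d : ℝ) * tr A) • idMat d‖ ≤ 2 / d * ‖idMat d‖ * ‖idMat d‖ * ‖A‖ := by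
    rw [norm_smul, norm_mul, Real.norm_eq_abs, Real.norm_eq_abs,
      abs_of_nonneg (by positivity : (0 : ℝ) ≤ 2 / d)]
    nlinarith [mul_le_mul_of_nonneg_left (abs_tr_le A)
      (by positivity : 0 ≤ 2 / (d : ℝ) * ‖idMat d‖)]
  have h2 : ‖(P.lam * tr A) • idMat d‖ ≤ |P.lam| * ‖idMat d‖ * ‖idMat d‖ * ‖A‖ := by
    rw [norm_smul, norm_mul, Real.norm_eq_abs, Real.norm_eq_abs]
    nlinarith [mul_le_mul_of_nonneg_left (abs_tr_le A)
      (by positivity : 0 ≤ |P.lam| * ‖idMat d‖)]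
  have h3 : ‖A + transp A - (2 / (d : ℝ) * tr A) • idMat d‖ ≤
      (2 + 2 / d * ‖idMat d‖ * ‖idMat d‖) * ‖A‖ := by
    refine (norm_sub_le _ _).trans ?_
    have := norm_add_le A (transp A)
    rw [norm_transp] at this
    linarith
  calc ‖stress P A‖ ≤ ‖P.μ • (A + transp A - (2 / (d : ℝ) * tr A) • idMat d)‖ +
        ‖(P.lam * tr A) • idMat d‖ := norm_add_le _ _
    _ ≤ _ := by
      rw [norm_smul, Real.norm_eq_abs]
      nlinarith [mul_le_mul_of_nonneg_left h3 (abs_nonneg P.μ)]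

lemma cross_sub_left (a b c : Vec 3) : cross (a - b) c = cross a c - cross b c := by
  simp [cross]

lemma cross_sub_right (a b c : Vec 3) : cross a (b - c) = cross a b - cross a c := by
  simp [cross]

lemma cross_anticomm' (a b : Vec 3) : cross a b = -cross b a := by
  ext i
  fin_cases i <;> simp [cross, crossProduct] <;> ring

lemma inner_cross_rotate (a b c : Vec 3) :
    inner ℝ (cross a b) c = inner ℝ (cross b c) a := by
  simp [inner_vec, cross, crossProduct, Fin.sum_univ_three]
  ring

/-- Lagrange's identity |a × b|² + (a · b)² = |a|²|b|². -/
lemma norm_cross_le (a b : Vec 3) : ‖cross a b‖ ≤ ‖a‖ * ‖b‖ := by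
  have h : ‖cross a b‖ ^ 2 ≤ (‖a‖ * ‖b‖) ^ 2 := by
    have : ‖cross a b‖ ^ 2 + inner ℝ a b ^ 2 = (‖a‖ * ‖b‖) ^ 2 := by
      rw [mul_pow, EuclideanSpace.real_norm_sq_eq, EuclideanSpace.real_norm_sq_eq,
        EuclideanSpace.real_norm_sq_eq]
      simp [inner_vec, cross, crossProduct, Fin.sum_univ_three]
      ring
    nlinarith [sq_nonneg (inner ℝ a b)]
  exact le_of_sq_le_sq h (by positivity)

lemma pad_sub (x y : Vec d) : pad (x - y) = pad x - pad y := by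
  ext i; simp only [pad, PiLp.sub_apply]; split_ifs <;> simp

lemma inner_pad_pad (hd : d = 2 ∨ d = 3) (x y : Vec d) :
    inner ℝ (pad x) (pad y) = inner ℝ x y := by
  rcases hd with rfl | rfl <;>
    simp [inner_vec, pad, Fin.sum_univ_two, Fin.sum_univ_three]

lemma norm_pad (hd : d = 2 ∨ d = 3) (x : Vec d) : ‖pad x‖ = ‖x‖ := by
  rw [norm_eq_sqrt_real_inner, norm_eq_sqrt_real_inner, inner_pad_pad hd]

/-- Truncation is the adjoint of padding, so the truncated Lorentz force does the same work on a
velocity field as the spatial one. -/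
lemma inner_trunc (hd : d = 2 ∨ d = 3) (w : Vec 3) (x : Vec d) :
    inner ℝ (trunc w) x = inner ℝ w (pad x) := by
  rcases hd with rfl | rfl <;>
    simp [inner_vec, pad, trunc, Fin.sum_univ_two, Fin.sum_univ_three]

lemma inner_cross_swap (j b v : Vec 3) : inner ℝ (cross j b) v = -inner ℝ (cross v b) j := by
  rw [inner_cross_rotate, cross_anticomm' b v, inner_neg_left]

/-- The integrand of the relative energy inequality splits into the dissipation, terms that are
quadratic in the differences, and three expressions that integrate to zero. -/
lemma relative_energy_identity (hd : d = 2 ∨ d = 3) (P : Params) {ρ r pρ pr pp h rt : ℝ}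
    {u v B b a bt q dS : Vec d} {G g : Mat d} {J j F cF : Vec 3} (hr : r ≠ 0)
    (hh : h * r = pp) (hmass : rt + inner ℝ v q + r * tr g = 0)
    (hmom : r • (a + mulV g v) + pp • q = dS + trunc (cross j (pad b)))
    (hF : F = cross (pad v) (pad b) - P.α • j) (hind : pad bt = cF) :
    -(inner ℝ (stress P G) G + P.α * ‖J‖ ^ 2)
      - (inner ℝ (ρ • u) a + inner ℝ (ρ • outer u u) g + pρ * tr g - inner ℝ (stress P G) g
          + inner ℝ (cross J (pad B)) (pad v))
      + (ρ * (inner ℝ v a - h * rt) + ρ * (inner ℝ v (mulV g u) - h * inner ℝ u q))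
      - (inner ℝ B bt + inner ℝ (cross (pad u) (pad B)) j - P.α * inner ℝ J j)
      + inner ℝ b bt + pp * rt
    = -inner ℝ (stress P (G - g)) (G - g) - P.α * ‖J - j‖ ^ 2
      - ρ * inner ℝ (u - v) (mulV g (u - v)) - tr g * (pρ - pp * (ρ - r) - pr)
      + inner ℝ (J - j) (cross (pad v) (pad (B - b)))
      - inner ℝ j (cross (pad (u - v)) (pad (B - b)))
      + (ρ - r) / r * (inner ℝ j (cross (pad (u - v)) (pad b)) - inner ℝ (u - v) dS)
      - (inner ℝ (stress P g) (G - g) + inner ℝ dS (u - v))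
      - (pp * inner ℝ v q + pr * tr g)
      + (inner ℝ (pad (b - B)) cF - inner ℝ (j - J) F) := by
  -- The strong momentum equation paired with an arbitrary vector; it is used for x = u and for x =
  -- v.
  have e (x : Vec d) : r * (inner ℝ x a + inner ℝ x (mulV g v)) + pp * inner ℝ x q
      = inner ℝ x dS - inner ℝ (cross (pad x) (pad b)) j := by
    have := congrArg (inner ℝ x) hmom
    simp only [inner_add_right, real_inner_smul_right] at this
    rw [this, real_inner_comm (trunc _), inner_trunc hd, inner_cross_swap]
    ring
  have c (x y z : Vec 3) : inner ℝ z (cross x y) = inner ℝ (cross x y) z := real_inner_comm _ _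
  have e1 := e u
  have e2 := e v
  subst hF
  rw [← hind, inner_pad_pad hd, inner_cross_swap J]
  simp only [← real_inner_self_eq_norm_sq, pad_sub, mulV_sub, cross_sub_left, cross_sub_right,
    stress_sub, inner_sub_left, inner_sub_right, real_inner_smul_left, real_inner_smul_right,
    inner_outer, c]
  rw [inner_stress_comm P g G, real_inner_comm J j, real_inner_comm u dS, real_inner_comm v dS]
  subst hh
  obtain rfl : rt = -(inner ℝ v q + r * tr g) := by linarith
  field_simp
  -- What remains carries the factor ρ(u − v) against the acceleration a + (∇v)v. The strong
  -- momentum equation paired with u − v and weighted by ρ/r removes it; the denominator r has been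
  -- cleared before.
  linear_combination ρ * (e2 - e1)
end Algebra

end

end MHD

namespace MHD
noncomputable section

/-! ### Integration by parts on the spatial domain -/

namespace Domain

variable {d : ℕ}

lemma cell_torus_eq :
    (Domain.torus : Domain d).cell
      = ZSpan.fundamentalDomain (EuclideanSpace.basisFun (Fin d) ℝ).toBasis := by
  ext x; simp [cell, ZSpan.fundamentalDomain]

lemma isBounded_cell {D : Domain d} (hD : D.Admissible) : Bornology.IsBounded D.cell := by
  cases D with
  | wall Ω => exact hD.2.1
  | torus => rw [cell_torus_eq]; exact ZSpan.fundamentalDomain_isBounded _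

lemma measurableSet_cell {D : Domain d} (hD : D.Admissible) : MeasurableSet D.cell := by
  cases D with
  | wall Ω => exact hD.1.measurableSet
  | torus => rw [cell_torus_eq]; exact ZSpan.fundamentalDomain_measurableSet _

lemma isFiniteMeasure_spaceMeasure {D : Domain d} (hD : D.Admissible) :
    IsFiniteMeasure D.spaceMeasure :=
  ⟨by simpa [spaceMeasure] using (isBounded_cell hD).measure_lt_top⟩

lemma isCompact_closure_cell {D : Domain d} (hD : D.Admissible) : IsCompact (closure D.cell) :=
  (isBounded_cell hD).isCompact_closure

lemma closedCell_subset (D : Domain d) : D.closedCell ⊆ closure D.cell := by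
  cases D with
  | wall Ω => exact le_rfl
  | torus => exact subset_closure

lemma cell_subset_closedCell (D : Domain d) : D.cell ⊆ D.closedCell := by
  cases D with
  | wall Ω => exact subset_closure
  | torus => exact le_rfl

/-! ### Periodic functions and the fundamental cell -/

section Torus

variable {F : Type*} {f : Vec d → F}

lemma Periodic.add_lattice (hf : (Domain.torus : Domain d).Periodic f) {g : Vec d}
    (hg : g ∈ Submodule.span ℤ (range (EuclideanSpace.basisFun (Fin d) ℝ).toBasis)) (x : Vec d) :
    f (x + g) = f x := by
  induction hg using Submodule.span_induction generalizing x with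
  | mem g h =>
    obtain ⟨i, rfl⟩ := h
    simpa using hf x i
  | zero => simp
  | add a b _ _ ha hb => rw [← add_assoc, hb, ha]
  | smul n a _ ha =>
    induction n using Int.induction_on generalizing x with
    | zero => simp
    | succ n ih => rw [add_smul, one_smul, ← add_assoc, ha, ih]
    | pred n ih =>
      rw [sub_smul, one_smul, ← ha (x + _), add_assoc, sub_add_cancel, ih]

lemma exists_mem_cell_add (x : Vec d) :
    ∃ g ∈ Submodule.span ℤ (range (EuclideanSpace.basisFun (Fin d) ℝ).toBasis),
      x + g ∈ (Domain.torus : Domain d).cell := by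
  obtain ⟨v, hv, -⟩ := ZSpan.exist_unique_vadd_mem_fundamentalDomain
    (EuclideanSpace.basisFun (Fin d) ℝ).toBasis x
  refine ⟨v, v.2, ?_⟩
  rw [cell_torus_eq, add_comm]
  exact hv

open Pointwise in
/-- Integrals of periodic functions over the fundamental cell are invariant under translations. -/
lemma integral_cell_add [NormedAddCommGroup F] [NormedSpace ℝ F]
    (hf : (Domain.torus : Domain d).Periodic f) (z : Vec d) :
    ∫ x in (Domain.torus : Domain d).cell, f (x + z)
      = ∫ x in (Domain.torus : Domain d).cell, f x := by
  set b := (EuclideanSpace.basisFun (Fin d) ℝ).toBasis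
  have : VAddInvariantMeasure (Submodule.span ℤ (range b)) (Vec d) volume :=
    ⟨fun c s _ => measure_preimage_add volume (c : Vec d) s⟩
  have h1 := ZSpan.isAddFundamentalDomain b (volume : Measure (Vec d))
  -- The translated cell is again a fundamental domain of the lattice, and a periodic function has
  -- the same integral over any two of them.
  have h2 := h1.vadd_of_comm z
  have hinv : ∀ (g : Submodule.span ℤ (range b)) (x : Vec d), f (g +ᵥ x) = f x := fun g x => by
    rw [Submodule.vadd_def, vadd_eq_add, add_comm]; exact hf.add_lattice g.2 x
  have h3 := h1.setIntegral_eq h2 hinv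
  have h4 := (measurePreserving_add_right (volume : Measure (Vec d)) z).setIntegral_preimage_emb
    (measurableEmbedding_addRight z) f (z +ᵥ (ZSpan.fundamentalDomain b : Set (Vec d)) : Set (Vec d))
  rw [cell_torus_eq, h3, ← h4]
  congr 2
  ext x
  simp only [mem_preimage, mem_vadd_set_iff_neg_vadd_mem, vadd_eq_add]
  rw [neg_add_eq_sub, add_sub_cancel_right]

lemma exists_mem_cell_eq (x : Vec d) : ∃ y ∈ (Domain.torus : Domain d).cell,
    ∀ f : Vec d → F, (Domain.torus : Domain d).Periodic f → f y = f x :=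
  let ⟨g, hg, hx⟩ := exists_mem_cell_add x
  ⟨x + g, hx, fun _ hf => hf.add_lattice hg x⟩

lemma Periodic.exists_norm_le [NormedAddCommGroup F] (hf : (Domain.torus : Domain d).Periodic f)
    (hc : Continuous f) : ∃ C, ∀ x, ‖f x‖ ≤ C := by
  obtain ⟨C, hC⟩ := (isCompact_closure_cell (D := (.torus : Domain d)) trivial).exists_bound_of_continuousOn
    hc.continuousOn
  refine ⟨C, fun x => ?_⟩
  obtain ⟨y, hy, h⟩ := exists_mem_cell_eq (F := F) x
  rw [← h f hf]; exact hC y (subset_closure hy)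

end Torus

section Supported

variable {F G H : Type*} {D : Domain d}

lemma Periodic.comp₂ {f : Vec d → F} {g : Vec d → G} (hf : D.Periodic f) (hg : D.Periodic g)
    (k : F → G → H) : D.Periodic fun x => k (f x) (g x) := by
  cases D with
  | wall Ω => trivial
  | torus => intro x i; simp only [hf x i, hg x i]

lemma Periodic.comp {f : Vec d → F} (hf : D.Periodic f) (k : F → G) :
    D.Periodic fun x => k (f x) := hf.comp₂ hf fun a _ => k a

lemma Periodic.fderiv [NormedAddCommGroup F] [NormedSpace ℝ F] {f : Vec d → F}
    (hf : D.Periodic f) : D.Periodic (fderiv ℝ f) := by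
  cases D with
  | wall Ω => trivial
  | torus =>
    intro x i
    rw [← fderiv_comp_add_right]
    congr 1
    exact funext fun y => hf y i

/-- Periodic on the torus, supported in a compact subset of `Ω` otherwise. -/
structure Supported [Zero F] (D : Domain d) (f : Vec d → F) : Prop where
  periodic : D.Periodic f
  compactlyInside : D.CompactlyInside f

lemma Supported.comp₂ [Zero F] [Zero H] {f : Vec d → F} {g : Vec d → G} (hf : D.Supported f)
    (hg : D.Periodic g) (k : F → G → H) (hk : ∀ b, k 0 b = 0) :
    D.Supported fun x => k (f x) (g x) := by
  refine ⟨hf.1.comp₂ hg k, ?_⟩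
  cases D with
  | wall Ω =>
    obtain ⟨K, h1, h2, h3⟩ := hf.2
    exact ⟨K, h1, h2, fun x hx => by simp only [h3 x hx, hk]⟩
  | torus => trivial

lemma Supported.comp [Zero F] [Zero H] {f : Vec d → F} (hf : D.Supported f) (k : F → H)
    (hk : k 0 = 0) : D.Supported fun x => k (f x) := hf.comp₂ hf.1 (fun a _ => k a) fun _ => hk

end Supported

/-! ### Integration by parts for periodic or compactly supported functions -/

section IntegrationByParts

variable {D : Domain d}

lemma integrableOn_cell {F : Type*} [NormedAddCommGroup F] (hD : D.Admissible) {f : Vec d → F}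
    (hf : Continuous f) : IntegrableOn f D.cell :=
  (hf.continuousOn.integrableOn_compact (isCompact_closure_cell hD)).mono_set subset_closure

lemma continuous_partialD {f : Vec d → ℝ} (hf : ContDiff ℝ 1 f) (j : Fin d) :
    Continuous (partialD j f) :=
  (hf.continuous_fderiv one_ne_zero).clm_apply continuous_const

/-- The integral of f(x + s e) over the cell does not depend on s; differentiate it under the
integral sign at s = 0. -/
lemma integral_partialD_torus {f : Vec d → ℝ} (hf : ContDiff ℝ 1 f)
    (hp : (Domain.torus : Domain d).Periodic f) (j : Fin d) :
    ∫ x in (Domain.torus : Domain d).cell, partialD j f x = 0 := by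
  set e : Vec d := EuclideanSpace.single j 1
  obtain ⟨C, hC⟩ := (hp.fderiv.comp (fun L : Vec d →L[ℝ] ℝ => L e)).exists_norm_le
    ((hf.continuous_fderiv one_ne_zero).clm_apply continuous_const)
  have hD : (Domain.torus : Domain d).Admissible := trivial
  have := isFiniteMeasure_spaceMeasure hD
  have key : HasDerivAt (fun s : ℝ => ∫ x, f (x + s • e) ∂(Domain.torus : Domain d).spaceMeasure)
      (∫ x, fderiv ℝ f (x + (0 : ℝ) • e) e ∂(Domain.torus : Domain d).spaceMeasure) 0 := by
    refine (hasDerivAt_integral_of_dominated_loc_of_deriv_le (F := fun s x => f (x + s • e))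
      (F' := fun s x => fderiv ℝ f (x + s • e) e)
      (bound := fun _ => C) (s := univ) univ_mem ?_ ?_ ?_ ?_ ?_ ?_).2
    · exact .of_forall fun s => (hf.continuous.comp (by fun_prop)).aestronglyMeasurable
    · exact integrableOn_cell hD (hf.continuous.comp (by fun_prop))
    · exact (((hf.continuous_fderiv one_ne_zero).comp (by fun_prop)).clm_apply
        continuous_const).aestronglyMeasurable
    · exact .of_forall fun x s _ => hC _
    · exact integrable_const _
    · refine .of_forall fun x s _ => ?_
      have h1 := (hf.differentiable one_ne_zero (x + s • e)).hasFDerivAt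
      have h2 : HasDerivAt (fun s : ℝ => x + s • e) e s := by
        simpa using ((hasDerivAt_id s).smul_const e).const_add x
      exact h1.comp_hasDerivAt s h2
  have hconst : (fun s : ℝ => ∫ x, f (x + s • e) ∂(Domain.torus : Domain d).spaceMeasure)
      = fun _ => ∫ x, f x ∂(Domain.torus : Domain d).spaceMeasure :=
    funext fun s => integral_cell_add hp _
  rw [hconst] at key
  have := key.unique (hasDerivAt_const _ _)
  simpa [spaceMeasure, partialD] using this

lemma _root_.HasCompactSupport.integral_fderiv_apply_eq_zero {E : Type*} [NormedAddCommGroup E] [NormedSpace ℝ E]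
    [FiniteDimensional ℝ E] [MeasurableSpace E] [BorelSpace E] (μ : Measure E)
    [μ.IsAddHaarMeasure] {f : E → ℝ} (hc : HasCompactSupport f) (hf : ContDiff ℝ 1 f) (v : E) :
    ∫ x, fderiv ℝ f x v ∂μ = 0 := by
  have := integral_mul_fderiv_eq_neg_fderiv_mul_of_integrable (𝕜 := ℝ) (μ := μ) (f := fun _ => (1 : ℝ))
    (g := f) (v := v) (by simp)
    (by
      simp only [one_mul]
      exact (((hf.continuous_fderiv one_ne_zero).clm_apply
        continuous_const).integrable_of_hasCompactSupport (hc.fderiv_apply ℝ v)))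
    (by simpa using hf.continuous.integrable_of_hasCompactSupport hc)
    (by simp) (fun x _ => hf.differentiable one_ne_zero x)
  simpa using this

/-- The integral of a partial derivative of a `C¹` function that is periodic, or compactly
supported in `Ω`, vanishes. -/
theorem integral_partialD_eq_zero {f : Vec d → ℝ} (hf : ContDiff ℝ 1 f)
    (hs : D.Supported f) (j : Fin d) : ∫ x in D.cell, partialD j f x = 0 := by
  cases D with
  | torus => exact integral_partialD_torus hf hs.1 j
  | wall Ω =>
    obtain ⟨K, h1, h2, h3⟩ := hs.2
    have hc : HasCompactSupport f := HasCompactSupport.intro h1 h3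
    have hsub : tsupport f ⊆ Ω :=
      (closure_minimal (fun x (hx : f x ≠ 0) => by_contra fun h => hx (h3 x h)) h1.isClosed).trans h2
    change ∫ x in Ω, partialD j f x = 0
    rw [setIntegral_eq_integral_of_forall_compl_eq_zero]
    · exact hc.integral_fderiv_apply_eq_zero volume hf _
    · intro x hx
      have : fderiv ℝ f x = 0 :=
        image_eq_zero_of_notMem_tsupport fun h => hx (hsub (tsupport_fderiv_subset ℝ h))
      simp [partialD, this]

lemma partialD_mul {f g : Vec d → ℝ} {x : Vec d} (hf : DifferentiableAt ℝ f x)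
    (hg : DifferentiableAt ℝ g x) (j : Fin d) :
    partialD j (fun y => f y * g y) x = partialD j f x * g x + f x * partialD j g x := by
  have := fderiv_fun_mul hf hg
  simp only [partialD, this, _root_.add_apply, _root_.smul_apply,
    smul_eq_mul]
  ring

/-- Integration by parts against a `C¹` function that need not vanish on the boundary. -/
theorem integral_partialD_mul (hD : D.Admissible) {f g : Vec d → ℝ} (hf : ContDiff ℝ 1 f)
    (hs : D.Supported f) (hg : ContDiff ℝ 1 g) (hp : D.Periodic g) (j : Fin d) :
    ∫ x in D.cell, g x * partialD j f x = -∫ x in D.cell, partialD j g x * f x := by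
  have h := integral_partialD_eq_zero (hf.mul hg) (hs.comp₂ hp (fun a b => a * b) zero_mul) j
  have e : ∀ x, partialD j (fun y => f y * g y) x = g x * partialD j f x + partialD j g x * f x :=
    fun x => by
      rw [partialD_mul (hf.differentiable one_ne_zero x) (hg.differentiable one_ne_zero x)]; ring
  simp only [e] at h
  rw [integral_add] at h
  · linarith
  · exact integrableOn_cell hD (hg.continuous.mul (continuous_partialD hf j))
  · exact integrableOn_cell hD ((continuous_partialD hg j).mul hf.continuous)

end IntegrationByParts

end Domain

end

end MHD

namespace MHD
noncomputable section

/-! ### The spaces `W₀^{1,2}` and `H₀(Curl)` -/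

/-- Such an integral is the scalar product of two classes in L², which is jointly continuous. This
carries identities and inequalities from smooth fields over to their closures. -/
lemma tendsto_integral_inner {X F : Type*} [MeasurableSpace X] {μ : Measure X}
    [NormedAddCommGroup F] [InnerProductSpace ℝ F] {f g : X → F} {fn gn : ℕ → X → F}
    (hfn : ∀ n, MemLp (fn n) 2 μ) (hf : MemLp f 2 μ) (hgn : ∀ n, MemLp (gn n) 2 μ)
    (hg : MemLp g 2 μ) (h1 : Tendsto (fun n => eLpNorm (fun x => fn n x - f x) 2 μ) atTop (𝓝 0))
    (h2 : Tendsto (fun n => eLpNorm (fun x => gn n x - g x) 2 μ) atTop (𝓝 0)) :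
    Tendsto (fun n => ∫ x, inner ℝ (fn n x) (gn n x) ∂μ) atTop (𝓝 (∫ x, inner ℝ (f x) (g x) ∂μ)) := by
  have key : ∀ {a b : X → F} (ha : MemLp a 2 μ) (hb : MemLp b 2 μ),
      ∫ x, inner ℝ (a x) (b x) ∂μ = inner ℝ (ha.toLp a) (hb.toLp b) := fun ha hb => by
    rw [L2.inner_def]
    refine integral_congr_ae ?_
    filter_upwards [ha.coeFn_toLp, hb.coeFn_toLp] with x h1 h2
    rw [h1, h2]
  simp only [key (hfn _) (hgn _), key hf hg]
  exact ((Lp.tendsto_Lp_iff_tendsto_eLpNorm'' fn hfn f hf).2 h1).inner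
    ((Lp.tendsto_Lp_iff_tendsto_eLpNorm'' gn hgn g hg).2 h2)

variable {d : ℕ}

lemma jacobian_apply (v : Vec d → Vec d) (x : Vec d) (i j : Fin d) :
    jacobian v x (i, j) = partialD j (fun y => v y i) x := rfl

lemma tr_jacobian (v : Vec d → Vec d) (x : Vec d) : tr (jacobian v x) = divergence v x := rfl

lemma partialD_eq {F : Type*} [NormedAddCommGroup F] [NormedSpace ℝ F] (L : F →L[ℝ] ℝ)
    {v : Vec d → F} {x : Vec d} (hv : DifferentiableAt ℝ v x) (j : Fin d) :
    partialD j (fun y => L (v y)) x = L (fderiv ℝ v x (EuclideanSpace.single j 1)) := by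
  have : fderiv ℝ (fun y => L (v y)) x = L.comp (fderiv ℝ v x) := (L.hasFDerivAt.comp x hv.hasFDerivAt).fderiv
  simp [partialD, this]

lemma partialD_apply {ι : Type*} [Fintype ι] {v : Vec d → EuclideanSpace ℝ ι} {x : Vec d}
    (hv : DifferentiableAt ℝ v x) (i : ι) (j : Fin d) :
    partialD j (fun y => v y i) x = fderiv ℝ v x (EuclideanSpace.single j 1) i :=
  partialD_eq (EuclideanSpace.proj i) hv j

lemma contDiff_apply_coord {ι : Type*} [Fintype ι] {n : WithTop ℕ∞}
    {E : Type*} [NormedAddCommGroup E] [NormedSpace ℝ E] {v : E → EuclideanSpace ℝ ι}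
    (hv : ContDiff ℝ n v) (i : ι) : ContDiff ℝ n fun y => v y i :=
  contDiff_euclidean.1 hv i

lemma contDiff_partialD {n : ℕ} {f : Vec d → ℝ} (hf : ContDiff ℝ (n + 1 : ℕ) f) (j : Fin d) :
    ContDiff ℝ n (partialD j f) :=
  (hf.fderiv_right (by norm_cast)).clm_apply contDiff_const

lemma contDiff_jacobian {n : ℕ} {v : Vec d → Vec d} (hv : ContDiff ℝ (n + 1 : ℕ) v) :
    ContDiff ℝ n (jacobian v) :=
  contDiff_euclidean.2 fun p => contDiff_partialD (contDiff_apply_coord hv p.1) p.2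

lemma continuous_jacobian {v : Vec d → Vec d} (hv : ContDiff ℝ 1 v) : Continuous (jacobian v) :=
  (contDiff_jacobian (n := 0) (by exact_mod_cast hv)).continuous

lemma jacobian_sub {v w : Vec d → Vec d} {x : Vec d} (hv : DifferentiableAt ℝ v x)
    (hw : DifferentiableAt ℝ w x) :
    jacobian (fun y => v y - w y) x = jacobian v x - jacobian w x := by
  ext ⟨i, j⟩
  have h := partialD_apply (hv.sub hw) i j
  rw [fderiv_sub hv hw] at h
  simp only [jacobian_apply, PiLp.sub_apply, partialD_apply hv, partialD_apply hw]
  exact h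

lemma partialD_partialD_comm {f : Vec d → ℝ} (hf : ContDiff ℝ 2 f) (i j : Fin d) (x : Vec d) :
    partialD i (partialD j f) x = partialD j (partialD i f) x := by
  have hd : DifferentiableAt ℝ (fderiv ℝ f) x :=
    (hf.fderiv_right (m := 1) le_rfl).differentiable one_ne_zero x
  have h : ∀ a b : Fin d, partialD a (partialD b f) x
      = fderiv ℝ (fderiv ℝ f) x (EuclideanSpace.single a 1) (EuclideanSpace.single b 1) :=
    fun a b => partialD_eq (ContinuousLinearMap.apply ℝ ℝ (EuclideanSpace.single b 1)) hd a
  rw [h, h]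
  exact (hf.contDiffAt.isSymmSndFDerivAt (by simp)).eq _ _

namespace Domain

variable {D : Domain d}

lemma Periodic.partialD {f : Vec d → ℝ} (hf : D.Periodic f) (j : Fin d) :
    D.Periodic (MHD.partialD j f) := hf.fderiv.comp fun L => L (EuclideanSpace.single j 1)

lemma memLp_cell {F : Type*} [NormedAddCommGroup F] (hD : D.Admissible) {f : Vec d → F}
    (hf : Continuous f) (p : ENNReal) : MemLp f p D.spaceMeasure := by
  have := isFiniteMeasure_spaceMeasure hD
  obtain ⟨C, hC⟩ := (isCompact_closure_cell hD).exists_bound_of_continuousOn hf.continuousOn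
  exact MemLp.of_bound hf.aestronglyMeasurable C
    ((ae_restrict_iff' (measurableSet_cell hD)).2 (.of_forall fun x hx => hC x (subset_closure hx)))

/-- `v ∈ W₀^{1,2}` and `∇v = G`, with approximating fields of class `C²`. -/
structure W0 (D : Domain d) (v : Vec d → Vec d) (G : Vec d → Mat d) : Prop where
  memLp : MemLp v 2 D.spaceMeasure
  memLp_grad : MemLp G 2 D.spaceMeasure
  approx : ∃ φ : ℕ → Vec d → Vec d, (∀ n, ContDiff ℝ 2 (φ n) ∧ D.Supported (φ n)) ∧
    Tendsto (fun n => eLpNorm (fun x => φ n x - v x) 2 D.spaceMeasure) atTop (𝓝 0) ∧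
    Tendsto (fun n => eLpNorm (fun x => jacobian (φ n) x - G x) 2 D.spaceMeasure) atTop (𝓝 0)

/-- The strong velocity is approximated by fields of class C² only. Two derivatives are all that
Korn's inequality needs, so both velocities are treated as members of this larger class. -/
lemma HasSobolevGradient.w0 {v : Vec d → Vec d} {G : Vec d → Mat d}
    (h : D.HasSobolevGradient v G) (hv : MemLp v 2 D.spaceMeasure)
    (hG : MemLp G 2 D.spaceMeasure) : D.W0 v G :=
  let ⟨φ, h1, h2⟩ := h
  ⟨hv, hG, φ, fun n => ⟨(h1 n).1.of_le (WithTop.coe_le_coe.2 (le_top : (2 : ℕ∞) ≤ ⊤)), (h1 n).2.1, (h1 n).2.2⟩, h2⟩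

lemma tendsto_eLpNorm_sub_sub {X F : Type*} [MeasurableSpace X] {μ : Measure X}
    [NormedAddCommGroup F] {f g : X → F} {fn gn : ℕ → X → F}
    (hfn : ∀ n, AEStronglyMeasurable (fun x => fn n x - f x) μ)
    (hgn : ∀ n, AEStronglyMeasurable (fun x => gn n x - g x) μ)
    (h1 : Tendsto (fun n => eLpNorm (fun x => fn n x - f x) 2 μ) atTop (𝓝 0))
    (h2 : Tendsto (fun n => eLpNorm (fun x => gn n x - g x) 2 μ) atTop (𝓝 0)) :
    Tendsto (fun n => eLpNorm (fun x => (fn n x - gn n x) - (f x - g x)) 2 μ) atTop (𝓝 0) := by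
  refine tendsto_of_tendsto_of_tendsto_of_le_of_le tendsto_const_nhds
    (by simpa using h1.add h2) (fun _ => zero_le) fun n => ?_
  have : (fun x => (fn n x - gn n x) - (f x - g x))
      = (fun x => fn n x - f x) - (fun x => gn n x - g x) := by
    ext x; simp only [Pi.sub_apply]; abel
  rw [this]
  exact eLpNorm_sub_le (hfn n) (hgn n) (by norm_num)

lemma W0.sub (hD : D.Admissible) {v w : Vec d → Vec d} {G H : Vec d → Mat d} (hv : D.W0 v G)
    (hw : D.W0 w H) : D.W0 (fun x => v x - w x) (fun x => G x - H x) := by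
  obtain ⟨hv1, hv2, φ, hφ, h1, h2⟩ := hv
  obtain ⟨hw1, hw2, ψ, hψ, h3, h4⟩ := hw
  refine ⟨hv1.sub hw1, hv2.sub hw2, fun n x => φ n x - ψ n x, fun n => ⟨(hφ n).1.sub (hψ n).1, ?_⟩,
    ?_, ?_⟩
  · refine ⟨(hφ n).2.1.comp₂ (hψ n).2.1 fun a b => a - b, ?_⟩
    cases D with
    | torus => trivial
    | wall Ω =>
      obtain ⟨K, a1, a2, a3⟩ := (hφ n).2.2
      obtain ⟨L, b1, b2, b3⟩ := (hψ n).2.2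
      refine ⟨K ∪ L, a1.union b1, union_subset a2 b2, fun x hx => ?_⟩
      rw [mem_union, not_or] at hx
      simp [a3 x hx.1, b3 x hx.2]
  · exact tendsto_eLpNorm_sub_sub
      (fun n => (hφ n).1.continuous.aestronglyMeasurable.sub hv1.1)
      (fun n => (hψ n).1.continuous.aestronglyMeasurable.sub hw1.1) h1 h3
  · have e : ∀ n x, jacobian (fun y => φ n y - ψ n y) x = jacobian (φ n) x - jacobian (ψ n) x :=
      fun n x => jacobian_sub ((hφ n).1.differentiable two_ne_zero x)
        ((hψ n).1.differentiable two_ne_zero x)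
    simp only [e]
    exact tendsto_eLpNorm_sub_sub
      (fun n => (continuous_jacobian ((hφ n).1.of_le one_le_two)).aestronglyMeasurable.sub hv2.1)
      (fun n => (continuous_jacobian ((hψ n).1.of_le one_le_two)).aestronglyMeasurable.sub hw2.1)
      h2 h4

lemma tendsto_eLpNorm_const_sub {X F : Type*} [MeasurableSpace X] {μ : Measure X}
    [NormedAddCommGroup F] (f : X → F) :
    Tendsto (fun _ : ℕ => eLpNorm (fun x => f x - f x) 2 μ) atTop (𝓝 0) := by
  simp

lemma integral_inner_jacobian (hD : D.Admissible) {φ : Vec d → Vec d} (hφ : ContDiff ℝ 1 φ)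
    (hs : D.Supported φ) {A : Vec d → Mat d} (hA : ContDiff ℝ 1 A) (hp : D.Periodic A) :
    ∫ x in D.cell, inner ℝ (A x) (jacobian φ x)
      = -∫ x in D.cell, inner ℝ (matDivergence A x) (φ x) := by
  simp only [inner_mat, inner_vec, jacobian_apply, matDivergence, Finset.sum_mul]
  have c1 : ∀ i j, IntegrableOn (fun x => A x (i, j) * partialD j (fun y => φ y i) x) D.cell :=
    fun i j => integrableOn_cell hD ((contDiff_apply_coord hA _).continuous.mul
      (continuous_partialD (contDiff_apply_coord hφ i) j))
  have c2 : ∀ i j, IntegrableOn (fun x => partialD j (fun y => A y (i, j)) x * φ x i) D.cell :=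
    fun i j => integrableOn_cell hD ((continuous_partialD (contDiff_apply_coord hA _) j).mul
      (contDiff_apply_coord hφ i).continuous)
  rw [integral_finsetSum _ fun i _ => integrable_finsetSum _ fun j _ => c1 i j,
    integral_finsetSum _ fun i _ => integrable_finsetSum _ fun j _ => c2 i j,
    ← Finset.sum_neg_distrib]
  refine Finset.sum_congr rfl fun i _ => ?_
  rw [integral_finsetSum _ fun j _ => c1 i j, integral_finsetSum _ fun j _ => c2 i j,
    ← Finset.sum_neg_distrib]
  exact Finset.sum_congr rfl fun j _ => integral_partialD_mul hD (contDiff_apply_coord hφ i)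
    (hs.comp (fun v => v i) rfl) (contDiff_apply_coord hA _) (hp.comp fun B => B (i, j)) j

lemma continuous_matDivergence {A : Vec d → Mat d} (hA : ContDiff ℝ 1 A) :
    Continuous (matDivergence A) :=
  (PiLp.continuous_toLp 2 _).comp (continuous_pi fun i => continuous_finsetSum _ fun j _ =>
    continuous_partialD (contDiff_apply_coord hA (i, j)) j)

/-- Integration by parts for a field in `W₀^{1,2}` against a matrix field of class `C¹`. -/
theorem W0.integral_inner (hD : D.Admissible) {v : Vec d → Vec d} {G : Vec d → Mat d}
    (hv : D.W0 v G) {A : Vec d → Mat d} (hA : ContDiff ℝ 1 A) (hp : D.Periodic A) :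
    ∫ x in D.cell, inner ℝ (A x) (G x) = -∫ x in D.cell, inner ℝ (matDivergence A x) (v x) := by
  obtain ⟨hv1, hv2, φ, hφ, h1, h2⟩ := hv
  have c1 : ∀ n, ContDiff ℝ 1 (φ n) := fun n => (hφ n).1.of_le one_le_two
  have t1 := tendsto_integral_inner (fun _ => memLp_cell hD hA.continuous 2)
    (memLp_cell hD hA.continuous 2) (fun n => memLp_cell hD (continuous_jacobian (c1 n)) 2) hv2
    (tendsto_eLpNorm_const_sub A) h2
  have t2 := (tendsto_integral_inner (fun _ => memLp_cell hD (continuous_matDivergence hA) 2)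
    (memLp_cell hD (continuous_matDivergence hA) 2) (fun n => memLp_cell hD (c1 n).continuous 2) hv1
    (tendsto_eLpNorm_const_sub (matDivergence A)) h1).neg
  refine tendsto_nhds_unique t1 (t2.congr fun n => ?_)
  exact (integral_inner_jacobian hD (c1 n) (hφ n).2 hA hp).symm

/-! #### Korn's inequality -/

/-- Moving the derivative off g turns the two sides into −∫ (∂ⱼ∂ᵢf) g and −∫ (∂ᵢ∂ⱼf) g. -/
lemma integral_partialD_mul_partialD (hD : D.Admissible) {f g : Vec d → ℝ} (hf : ContDiff ℝ 2 f)
    (hg : ContDiff ℝ 2 g) (hsf : D.Supported f) (hs : D.Supported g) (i j : Fin d) :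
    ∫ x in D.cell, partialD i f x * partialD j g x
      = ∫ x in D.cell, partialD j f x * partialD i g x := by
  have hg1 := hg.of_le one_le_two
  rw [integral_partialD_mul hD hg1 hs (contDiff_partialD (n := 1) hf i) (hsf.1.partialD i),
    integral_partialD_mul hD hg1 hs (contDiff_partialD (n := 1) hf j) (hsf.1.partialD j)]
  simp only [partialD_partialD_comm hf i j]

/-- The integrands are the sums of ∂ᵢφⱼ ∂ⱼφᵢ and of ∂ᵢφᵢ ∂ⱼφⱼ, which differ by an exchange of the
two derivatives. This is the core of Korn's inequality for fields without boundary values. -/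
lemma integral_inner_transp (hD : D.Admissible) {φ : Vec d → Vec d} (hφ : ContDiff ℝ 2 φ)
    (hs : D.Supported φ) :
    ∫ x in D.cell, inner ℝ (transp (jacobian φ x)) (jacobian φ x)
      = ∫ x in D.cell, tr (jacobian φ x) * tr (jacobian φ x) := by
  simp only [inner_mat, transp, tr, jacobian_apply, Finset.sum_mul_sum]
  have c : ∀ i j k l, IntegrableOn
      (fun x => partialD i (fun y => φ y j) x * partialD k (fun y => φ y l) x) D.cell :=
    fun i j k l => integrableOn_cell hD
      ((continuous_partialD (contDiff_apply_coord (hφ.of_le one_le_two) _) _).mul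
      (continuous_partialD (contDiff_apply_coord (hφ.of_le one_le_two) _) _))
  rw [integral_finsetSum _ fun i _ => integrable_finsetSum _ fun j _ => c _ _ _ _,
    integral_finsetSum _ fun i _ => integrable_finsetSum _ fun j _ => c _ _ _ _]
  refine Finset.sum_congr rfl fun i _ => ?_
  rw [integral_finsetSum _ fun j _ => c _ _ _ _, integral_finsetSum _ fun j _ => c _ _ _ _]
  refine Finset.sum_congr rfl fun j _ => ?_
  rw [integral_partialD_mul_partialD hD (contDiff_apply_coord hφ _) (contDiff_apply_coord hφ _)
    (hs.comp (fun v => v j) rfl) (hs.comp (fun v => v i) rfl)]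
  simp only [mul_comm]

lemma continuous_stress (P : Params) : Continuous (stress P : Mat d → Mat d) := by
  have ht : Continuous (transp : Mat d → Mat d) :=
    (PiLp.continuous_toLp 2 _).comp (by fun_prop)
  have htr : Continuous (tr : Mat d → ℝ) := by unfold tr; fun_prop
  unfold stress; fun_prop

/-- After the transposed term is replaced by the squared divergence, the left-over is (μ + λ − 2μ/d)
∫ (div φ)², whose coefficient is nonnegative for d ≥ 2 and λ ≥ 0. -/
lemma stress_smooth_coercive (hd : 2 ≤ d) (hD : D.Admissible) {P : Params} (hP : P.Valid)
    {φ : Vec d → Vec d} (hφ : ContDiff ℝ 2 φ) (hs : D.Supported φ) :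
    P.μ * ∫ x in D.cell, inner ℝ (jacobian φ x) (jacobian φ x)
      ≤ ∫ x in D.cell, inner ℝ (stress P (jacobian φ x)) (jacobian φ x) := by
  have hJ := continuous_jacobian (hφ.of_le one_le_two)
  have ht : Continuous (transp : Mat d → Mat d) :=
    (PiLp.continuous_toLp 2 _).comp (by fun_prop)
  have htr : Continuous (tr : Mat d → ℝ) := by unfold tr; fun_prop
  have i1 : IntegrableOn (fun x => inner ℝ (jacobian φ x) (jacobian φ x)) D.cell :=
    integrableOn_cell hD (hJ.inner hJ)
  have i2 : IntegrableOn (fun x => inner ℝ (transp (jacobian φ x)) (jacobian φ x)) D.cell :=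
    integrableOn_cell hD ((ht.comp hJ).inner hJ)
  have i3 : IntegrableOn (fun x => tr (jacobian φ x) * tr (jacobian φ x)) D.cell :=
    integrableOn_cell hD ((htr.comp hJ).mul (htr.comp hJ))
  have e : ∀ x, inner ℝ (stress P (jacobian φ x)) (jacobian φ x)
      = P.μ * inner ℝ (jacobian φ x) (jacobian φ x)
        + P.μ * inner ℝ (transp (jacobian φ x)) (jacobian φ x)
        + (P.lam - P.μ * (2 / d)) * (tr (jacobian φ x) * tr (jacobian φ x)) := fun x => by
    rw [inner_stress]; ring
  simp only [e]
  rw [integral_add, integral_add, integral_const_mul, integral_const_mul, integral_const_mul,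
    integral_inner_transp hD hφ hs]
  · have h0 : 0 ≤ ∫ x in D.cell, tr (jacobian φ x) * tr (jacobian φ x) :=
      integral_nonneg fun x => mul_self_nonneg _
    have h1 : (2 : ℝ) / d ≤ 1 := by
      rw [div_le_one (by positivity)]; exact_mod_cast hd
    have h2 : P.μ * (2 / d) ≤ P.μ := by nlinarith [hP.μ_pos]
    nlinarith [hP.lam_nonneg, hP.μ_pos]
  · exact i1.const_mul _
  · exact i2.const_mul _
  · exact (i1.const_mul _).add (i2.const_mul _)
  · exact i3.const_mul _

lemma tendsto_eLpNorm_map {X F G : Type*} [MeasurableSpace X] {μ : Measure X}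
    [NormedAddCommGroup F] [NormedAddCommGroup G] {fn : ℕ → X → F} {f : X → F}
    {gn : ℕ → X → G} {g : X → G} (C : ℝ)
    (hle : ∀ n x, ‖gn n x - g x‖ ≤ C * ‖fn n x - f x‖)
    (h : Tendsto (fun n => eLpNorm (fun x => fn n x - f x) 2 μ) atTop (𝓝 0)) :
    Tendsto (fun n => eLpNorm (fun x => gn n x - g x) 2 μ) atTop (𝓝 0) := by
  refine tendsto_of_tendsto_of_tendsto_of_le_of_le tendsto_const_nhds
    (by simpa using ENNReal.Tendsto.const_mul (a := ENNReal.ofReal C) h (.inr ENNReal.ofReal_ne_top))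
    (fun _ => zero_le) fun n => ?_
  exact eLpNorm_le_mul_eLpNorm_of_ae_le_mul (.of_forall (hle n)) 2

/-- Korn's inequality on `W₀^{1,2}`. -/
theorem W0.korn (hd : 2 ≤ d) (hD : D.Admissible) {P : Params} (hP : P.Valid)
    {v : Vec d → Vec d} {G : Vec d → Mat d} (hv : D.W0 v G) :
    P.μ * ∫ x in D.cell, inner ℝ (G x) (G x) ≤ ∫ x in D.cell, inner ℝ (stress P (G x)) (G x) := by
  obtain ⟨hv1, hv2, φ, hφ, h1, h2⟩ := hv
  have c1 : ∀ n, Continuous (jacobian (φ n)) := fun n =>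
    continuous_jacobian ((hφ n).1.of_le one_le_two)
  have t1 := (tendsto_integral_inner (fun n => memLp_cell hD (c1 n) 2) hv2
    (fun n => memLp_cell hD (c1 n) 2) hv2 h2 h2).const_mul P.μ
  have hS : MemLp (fun x => stress P (G x)) 2 D.spaceMeasure :=
    MemLp.of_le_mul hv2 ((continuous_stress P).comp_aestronglyMeasurable hv2.1)
      (.of_forall fun x => norm_stress_le P (G x))
  have t2 := tendsto_integral_inner
    (fun n => memLp_cell hD ((continuous_stress P).comp (c1 n)) 2) hS
    (fun n => memLp_cell hD (c1 n) 2) hv2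
    (tendsto_eLpNorm_map _ (fun n x => by
      simp only [Function.comp]; rw [← stress_sub]; exact norm_stress_le P _) h2) h2
  exact le_of_tendsto_of_tendsto' t1 t2 fun n => stress_smooth_coercive hd hD hP (hφ n).1 (hφ n).2

end Domain

end

end MHD

namespace MHD
noncomputable section

/-! ### Poincaré's inequality -/

variable {d : ℕ}

lemma fderiv_eq_mulV {v : Vec d → Vec d} {x : Vec d} (hv : DifferentiableAt ℝ v x) (z : Vec d) :
    fderiv ℝ v x z = mulV (jacobian v x) z := by
  have hz : z = ∑ j, z j • EuclideanSpace.single j (1 : ℝ) := by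
    ext i; simp [Finset.sum_apply, Pi.single_apply]
  ext i
  conv_lhs => rw [hz]
  simp only [map_sum, map_smul, mulV, jacobian_apply, partialD_apply hv]
  simp [mul_comm]

/-- With c = ψ(1) − ψ(0), integrate 2⟨c, ψ'⟩ − |c|² ≤ |ψ'|²; the left side integrates to |c|². -/
lemma norm_sub_sq_le_integral {E : Type*} [NormedAddCommGroup E] [InnerProductSpace ℝ E]
    {ψ ψ' : ℝ → E} (h : ∀ s, HasDerivAt ψ (ψ' s) s) (hc : Continuous ψ') :
    ‖ψ 1 - ψ 0‖ ^ 2 ≤ ∫ s in (0 : ℝ)..1, ‖ψ' s‖ ^ 2 := by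
  set c := ψ 1 - ψ 0
  have h1 : ∫ s in (0 : ℝ)..1, inner ℝ c (ψ' s) = inner ℝ c (ψ 1) - inner ℝ c (ψ 0) :=
    intervalIntegral.integral_eq_sub_of_hasDerivAt
      (fun s _ => ((innerSL ℝ c).hasFDerivAt.comp_hasDerivAt s (h s)))
      (((continuous_const.inner hc)).intervalIntegrable _ _)
  have h2 : ∫ s in (0 : ℝ)..1, (2 * inner ℝ c (ψ' s) - ‖c‖ ^ 2) = ‖c‖ ^ 2 := by
    rw [intervalIntegral.integral_sub
      ((continuous_const.mul (continuous_const.inner hc)).intervalIntegrable _ _)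
      (continuous_const.intervalIntegrable _ _), intervalIntegral.integral_const_mul, h1,
      ← inner_sub_right, real_inner_self_eq_norm_sq]
    simp; ring
  rw [← h2]
  refine intervalIntegral.integral_mono_on zero_le_one
    (((continuous_const.mul (continuous_const.inner hc)).sub
      continuous_const).intervalIntegrable _ _)
    ((hc.norm.pow 2).intervalIntegrable _ _) fun s _ => ?_
  have := norm_sub_sq_real (ψ' s) c
  rw [real_inner_comm] at this
  nlinarith [sq_nonneg ‖ψ' s - c‖]

namespace Domain

variable {D : Domain d}

/-- Since ∂ₖxₖ = 1, integration by parts gives ∫ φᵢ² = −2 ∫ xₖ φᵢ ∂ₖφᵢ. On a domain in the ball of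
radius R, Young's inequality bounds this by ½ ∫ φᵢ² + 2R² ∫ (∂ₖφᵢ)²; absorbing the first half
produces the constant 4R². -/
lemma poincare_wall_smooth (hd : 2 ≤ d) {Ω : Set (Vec d)} (hD : (wall Ω).Admissible) :
    ∃ C : ℝ, 0 ≤ C ∧ ∀ φ : Vec d → Vec d, ContDiff ℝ 1 φ → (wall Ω).Supported φ →
      ∫ x in (wall Ω).cell, ‖φ x‖ ^ 2 ≤ C * ∫ x in (wall Ω).cell, ‖jacobian φ x‖ ^ 2 := by
  obtain ⟨R, hR⟩ := (isCompact_closure_cell hD).exists_bound_of_continuousOn continuousOn_id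
  refine ⟨4 * R ^ 2, by positivity, fun φ hφ hs => ?_⟩
  let k : Fin d := ⟨0, by omega⟩
  have hφi : ∀ i, ContDiff ℝ 1 fun x => φ x i := fun i => contDiff_apply_coord hφ i
  have hcoord : ContDiff ℝ 1 fun x : Vec d => x k := contDiff_apply_coord contDiff_id k
  have hpk : ∀ x, partialD k (fun x : Vec d => x k) x = 1 := fun x => by
    have := partialD_apply (v := fun x : Vec d => x) (x := x) differentiableAt_id k k
    rw [this]; simp
  have hi : ∀ i, ∫ x in (wall Ω).cell, φ x i ^ 2
      ≤ 4 * R ^ 2 * ∫ x in (wall Ω).cell, partialD k (fun y => φ y i) x ^ 2 := fun i => by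
    have h := integral_partialD_mul hD ((hφi i).mul (hφi i))
      (hs.comp (fun v => v i * v i) (by simp)) hcoord trivial k
    simp only [hpk, one_mul, partialD_mul ((hφi i).differentiable one_ne_zero _)
      ((hφi i).differentiable one_ne_zero _)] at h
    have c1 : IntegrableOn (fun x => φ x i * φ x i) (wall Ω).cell :=
      integrableOn_cell hD ((hφi i).continuous.mul (hφi i).continuous)
    have cp := continuous_partialD (hφi i) k
    have c2 : IntegrableOn (fun x => partialD k (fun y => φ y i) x ^ 2) (wall Ω).cell :=
      integrableOn_cell hD (cp.pow 2)
    have h3 : -∫ x in (wall Ω).cell, x k * (partialD k (fun y => φ y i) x * φ x i +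
        φ x i * partialD k (fun y => φ y i) x)
        ≤ ∫ x in (wall Ω).cell, (1 / 2 * (φ x i * φ x i)
          + 2 * R ^ 2 * partialD k (fun y => φ y i) x ^ 2) := by
      rw [← integral_neg]
      refine setIntegral_mono_on (integrableOn_cell hD ?_)
        ((c1.const_mul _).add (c2.const_mul _)) (measurableSet_cell hD) fun x hx => ?_
      · exact (hcoord.continuous.mul ((cp.mul (hφi i).continuous).add
          ((hφi i).continuous.mul cp))).neg
      · have hx1 : |x k| ≤ R := (PiLp.norm_apply_le x k).trans (hR x (subset_closure hx))
        have hx2 : x k ^ 2 ≤ R ^ 2 := sq_le_sq' (by linarith [abs_le.1 hx1]) (abs_le.1 hx1).2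
        set p := partialD k (fun y => φ y i) x
        nlinarith [sq_nonneg (φ x i + 2 * x k * p), mul_le_mul_of_nonneg_right hx2 (sq_nonneg p)]
    rw [integral_add (c1.const_mul _) (c2.const_mul _), integral_const_mul,
      integral_const_mul] at h3
    simp only [pow_two] at h3 ⊢
    linarith
  simp only [EuclideanSpace.real_norm_sq_eq]
  have c3 : ∀ i, IntegrableOn (fun x => φ x i ^ 2) (wall Ω).cell :=
    fun i => integrableOn_cell hD ((hφi i).continuous.pow 2)
  have c4 : ∀ p, IntegrableOn (fun x => jacobian φ x p ^ 2) (wall Ω).cell :=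
    fun p => integrableOn_cell hD
      ((contDiff_apply_coord (contDiff_jacobian (n := 0) hφ) p).continuous.pow 2)
  rw [integral_finsetSum _ fun i _ => c3 i, integral_finsetSum _ fun p _ => c4 p,
    Fintype.sum_prod_type, Finset.mul_sum]
  refine Finset.sum_le_sum fun i _ => (hi i).trans ?_
  gcongr
  exact Finset.single_le_sum
    (f := fun j => ∫ x in (wall Ω).cell, jacobian φ x (i, j) ^ 2)
    (fun j _ => integral_nonneg fun x => sq_nonneg _) (Finset.mem_univ k)

lemma norm_sq_le_of_mem_cell {z : Vec d} (hz : z ∈ (Domain.torus : Domain d).cell) :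
    ‖z‖ ^ 2 ≤ d := by
  rw [EuclideanSpace.real_norm_sq_eq]
  calc ∑ i, z i ^ 2 ≤ ∑ _i : Fin d, (1 : ℝ) :=
        Finset.sum_le_sum fun i _ => by nlinarith [(hz i).1, (hz i).2]
    _ = d := by simp

/-- The increment is the integral of (∇φ)z along the segment from x to x + z. After Fubini, every
translate of |∇φ|² has the same integral over the cell, and |z|² ≤ d. -/
lemma integral_translate_sub_sq_le {φ : Vec d → Vec d} (hφ : ContDiff ℝ 1 φ)
    (hp : (Domain.torus : Domain d).Periodic φ) {z : Vec d}
    (hz : z ∈ (Domain.torus : Domain d).cell) :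
    ∫ x in (Domain.torus : Domain d).cell, ‖φ (x + z) - φ x‖ ^ 2
      ≤ d * ∫ x in (Domain.torus : Domain d).cell, ‖jacobian φ x‖ ^ 2 := by
  have hD : (Domain.torus : Domain d).Admissible := trivial
  have hfin := isFiniteMeasure_spaceMeasure hD
  have hJc := continuous_jacobian hφ
  have hJp : (Domain.torus : Domain d).Periodic fun x => ‖jacobian φ x‖ ^ 2 := by
    have h1 : jacobian φ = fun x => WithLp.toLp 2 fun p : Fin d × Fin d =>
        fderiv ℝ φ x (EuclideanSpace.single p.2 1) p.1 := by
      ext x p; exact partialD_apply (hφ.differentiable one_ne_zero x) p.1 p.2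
    rw [h1]
    exact (hp.fderiv.comp fun L : Vec d →L[ℝ] Vec d => ‖WithLp.toLp 2 fun p : Fin d × Fin d =>
        L (EuclideanSpace.single p.2 1) p.1‖ ^ 2)
  obtain ⟨C, hC⟩ := hJp.exists_norm_le (hJc.norm.pow 2)
  have h1 : ∀ x, ‖φ (x + z) - φ x‖ ^ 2 ≤ ∫ s in (0 : ℝ)..1, d * ‖jacobian φ (x + s • z)‖ ^ 2 :=
    fun x => by
    have hd : ∀ s : ℝ, HasDerivAt (fun s : ℝ => φ (x + s • z))
        (mulV (jacobian φ (x + s • z)) z) s := fun s => by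
      rw [← fderiv_eq_mulV (hφ.differentiable one_ne_zero _)]
      have h2 : HasDerivAt (fun s : ℝ => x + s • z) z s := by
        simpa using ((hasDerivAt_id s).smul_const z).const_add x
      exact (hφ.differentiable one_ne_zero (x + s • z)).hasFDerivAt.comp_hasDerivAt s h2
    have hcont : Continuous fun s : ℝ => mulV (jacobian φ (x + s • z)) z := by
      simp only [← fderiv_eq_mulV (hφ.differentiable one_ne_zero _)]
      exact ((hφ.continuous_fderiv one_ne_zero).comp (by fun_prop)).clm_apply continuous_const
    have := norm_sub_sq_le_integral hd hcont
    simp only [one_smul, zero_smul, add_zero] at this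
    refine this.trans (intervalIntegral.integral_mono_on zero_le_one
      ((hcont.norm.pow 2).intervalIntegrable _ _)
      ((continuous_const.mul ((hJc.comp (by fun_prop)).norm.pow 2)).intervalIntegrable _ _)
      fun s _ => ?_)
    calc _ ≤ (‖jacobian φ (x + s • z)‖ * ‖z‖) ^ 2 := by
            gcongr; exact norm_mulV_le _ _
      _ = ‖z‖ ^ 2 * ‖jacobian φ (x + s • z)‖ ^ 2 := by ring
      _ ≤ _ := by gcongr; exact norm_sq_le_of_mem_cell hz
  have hint : Integrable (Function.uncurry fun (x : Vec d) (s : ℝ) =>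
      d * ‖jacobian φ (x + s • z)‖ ^ 2)
      ((Domain.torus : Domain d).spaceMeasure.prod (volume.restrict (Ioc (0 : ℝ) 1))) := by
    refine Integrable.of_bound (C := d * C) ?_ (.of_forall fun y => ?_)
    · exact (continuous_const.mul ((hJc.comp (by fun_prop)).norm.pow 2)).aestronglyMeasurable
    · simp only [Function.uncurry, norm_mul, Real.norm_natCast]
      gcongr
      exact hC _
  calc _ ≤ ∫ x in (Domain.torus : Domain d).cell,
        ∫ s in Ioc (0 : ℝ) 1, d * ‖jacobian φ (x + s • z)‖ ^ 2 := by
        refine integral_mono (integrableOn_cell hD ?_) hint.integral_prod_left fun x => ?_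
        · exact ((hφ.continuous.comp (by fun_prop)).sub hφ.continuous).norm.pow 2
        · simpa only [intervalIntegral.integral_of_le zero_le_one] using h1 x
    _ = ∫ s in Ioc (0 : ℝ) 1, ∫ x in (Domain.torus : Domain d).cell,
          d * ‖jacobian φ (x + s • z)‖ ^ 2 := integral_integral_swap hint
    _ = _ := by
        simp only [integral_const_mul, integral_cell_add hJp]
        simp

/-- Constants have no gradient, so the weight w has to control them. For each y, ∫ |φ(y + z)|² dz is
the full squared norm by periodicity, and w(y)|φ(y + z)|² ≤ 2w(y)|φ(y)|² + 2N|φ(y + z) − φ(y)|².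
Integrate in z and then in y; with V the volume of the cell, the increments contribute at most 2N V
d ∫|∇φ|². -/
lemma poincare_torus_smooth {m N : ℝ} (hm : 0 < m) (hN : 0 ≤ N) :
    ∃ C : ℝ, 0 ≤ C ∧ ∀ w : Vec d → ℝ,
      AEStronglyMeasurable w (Domain.torus : Domain d).spaceMeasure →
      (∀ x, w x ∈ Icc 0 N) → m ≤ ∫ x in (Domain.torus : Domain d).cell, w x →
      ∀ φ : Vec d → Vec d, ContDiff ℝ 1 φ → (Domain.torus : Domain d).Supported φ →
      ∫ x in (Domain.torus : Domain d).cell, ‖φ x‖ ^ 2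
        ≤ C * ((∫ x in (Domain.torus : Domain d).cell, ‖jacobian φ x‖ ^ 2)
          + ∫ x in (Domain.torus : Domain d).cell, w x * ‖φ x‖ ^ 2) := by
  have hD : (Domain.torus : Domain d).Admissible := trivial
  have hfin := isFiniteMeasure_spaceMeasure hD
  set μ := (Domain.torus : Domain d).spaceMeasure
  set V := μ.real univ
  have hV : 0 ≤ V := measureReal_nonneg
  refine ⟨(2 * V + 2 * N * V * d) / m, by positivity, fun w hw hwN hwm φ hφ hs => ?_⟩
  have hφc := hφ.continuous
  have hwi : Integrable w μ := Integrable.of_bound hw N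
    (.of_forall fun x => by rw [Real.norm_of_nonneg (hwN x).1]; exact (hwN x).2)
  obtain ⟨C, hC⟩ := hs.1.exists_norm_le hφc
  have hC2 : ∀ x, ‖φ x‖ ^ 2 ≤ C ^ 2 := fun x => pow_le_pow_left₀ (norm_nonneg _) (hC x) 2
  have hwφ : Integrable (fun x => w x * ‖φ x‖ ^ 2) μ :=
    hwi.mul_bdd (c := C ^ 2) ((hφc.norm.pow 2).aestronglyMeasurable) (.of_forall fun x => by
      rw [Real.norm_of_nonneg (by positivity)]; exact hC2 x)
  set A := ∫ x, ‖φ x‖ ^ 2 ∂μ with hA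
  set J := ∫ x, ‖jacobian φ x‖ ^ 2 ∂μ with hJ
  set W := ∫ x, w x * ‖φ x‖ ^ 2 ∂μ with hW
  have hA0 : 0 ≤ A := integral_nonneg fun x => by positivity
  have hJ0 : 0 ≤ J := integral_nonneg fun x => by positivity
  have hW0 : 0 ≤ W := integral_nonneg fun x => mul_nonneg (hwN x).1 (by positivity)
  have hint : Integrable (Function.uncurry fun (y z : Vec d) => ‖φ (y + z) - φ y‖ ^ 2)
      (μ.prod μ) := by
    refine Integrable.of_bound (C := (2 * C) ^ 2) ?_ (.of_forall fun p => ?_)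
    · exact (((hφc.comp (by fun_prop)).sub (hφc.comp (by fun_prop))).norm.pow
        2).aestronglyMeasurable
    · simp only [Function.uncurry]
      rw [Real.norm_of_nonneg (by positivity)]
      gcongr
      exact (norm_sub_le _ _).trans (by linarith [hC (p.1 + p.2), hC p.1])
  have h1 : ∀ y, w y * A ≤ 2 * V * (w y * ‖φ y‖ ^ 2)
      + 2 * N * ∫ z, ‖φ (y + z) - φ y‖ ^ 2 ∂μ := fun y => by
    have e1 : A = ∫ z, ‖φ (y + z)‖ ^ 2 ∂μ := by
      have := integral_cell_add (hs.1.comp fun v => ‖v‖ ^ 2) y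
      simp only [add_comm _ y] at this
      exact this.symm
    have i1 : Integrable (fun z => ‖φ (y + z)‖ ^ 2) μ :=
      integrableOn_cell hD ((hφc.comp (by fun_prop)).norm.pow 2)
    have i2 : Integrable (fun z => ‖φ (y + z) - φ y‖ ^ 2) μ :=
      integrableOn_cell hD (((hφc.comp (by fun_prop)).sub continuous_const).norm.pow 2)
    calc w y * A = ∫ z, w y * ‖φ (y + z)‖ ^ 2 ∂μ := by rw [e1, integral_const_mul]
      _ ≤ ∫ z, (2 * (w y * ‖φ y‖ ^ 2) + 2 * N * ‖φ (y + z) - φ y‖ ^ 2) ∂μ := by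
        refine integral_mono (i1.const_mul _) ((integrable_const _).add (i2.const_mul _))
          fun z => ?_
        have h3 : ‖φ (y + z)‖ ^ 2 ≤ 2 * ‖φ y‖ ^ 2 + 2 * ‖φ (y + z) - φ y‖ ^ 2 := by
          have : ‖φ (y + z)‖ ≤ ‖φ y‖ + ‖φ (y + z) - φ y‖ := by
            simpa using norm_add_le (φ y) (φ (y + z) - φ y)
          nlinarith [sq_nonneg (‖φ y‖ - ‖φ (y + z) - φ y‖), norm_nonneg (φ (y + z))]
        have h4 := mul_le_mul_of_nonneg_left h3 (hwN y).1
        have h5 := mul_le_mul_of_nonneg_right (hwN y).2 (sq_nonneg ‖φ (y + z) - φ y‖)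
        change w y * ‖φ (y + z)‖ ^ 2 ≤ _
        nlinarith
      _ = _ := by
        rw [integral_add (integrable_const _) (i2.const_mul _)]
        simp only [integral_const, integral_const_mul, smul_eq_mul, V]
        ring
  have h2 : (∫ y, w y ∂μ) * A ≤ 2 * V * W
      + 2 * N * ∫ y, ∫ z, ‖φ (y + z) - φ y‖ ^ 2 ∂μ ∂μ := by
    have i3 : Integrable (fun y => ∫ z, ‖φ (y + z) - φ y‖ ^ 2 ∂μ) μ := hint.integral_prod_left
    rw [← integral_mul_const, hW, ← integral_const_mul, ← integral_const_mul,
      ← integral_add (hwφ.const_mul _) (i3.const_mul _)]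
    exact integral_mono (hwi.mul_const _) ((hwφ.const_mul _).add (i3.const_mul _)) h1
  have h3 : ∫ y, ∫ z, ‖φ (y + z) - φ y‖ ^ 2 ∂μ ∂μ ≤ V * (d * J) := by
    rw [integral_integral_swap hint]
    calc _ ≤ ∫ _z, d * J ∂μ := by
          refine integral_mono_ae hint.integral_prod_right (integrable_const _) ?_
          exact (ae_restrict_iff' (measurableSet_cell hD)).2 (.of_forall fun z hz =>
            integral_translate_sub_sq_le hφ hs.1 hz)
      _ = _ := by simp [V]
  have h4 : m * A ≤ (2 * V + 2 * N * V * d) * (J + W) := by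
    have h5 : m * A ≤ 2 * V * W + 2 * N * (V * (d * J)) :=
      (mul_le_mul_of_nonneg_right hwm hA0).trans (h2.trans (by gcongr))
    have h6 : 0 ≤ V * J := by positivity
    have h7 : 0 ≤ N * V * d * W := by positivity
    nlinarith
  change A ≤ _ * (J + W)
  rw [div_mul_eq_mul_div, le_div_iff₀ hm]
  linarith

/-- A Poincaré inequality: on `W₀^{1,2}` the `L²` norm is controlled by the gradient and, on the
torus, a weighted `L²` norm. -/
theorem W0.poincare (hd : 2 ≤ d) (hD : D.Admissible) {m N : ℝ} (hm : 0 < m) (hN : 0 ≤ N) :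
    ∃ C : ℝ, 0 ≤ C ∧ ∀ w : Vec d → ℝ, AEStronglyMeasurable w D.spaceMeasure →
      (∀ x, w x ∈ Icc 0 N) → m ≤ ∫ x in D.cell, w x → ∀ v G, D.W0 v G →
      ∫ x in D.cell, ‖v x‖ ^ 2
        ≤ C * ((∫ x in D.cell, ‖G x‖ ^ 2) + ∫ x in D.cell, w x * ‖v x‖ ^ 2) := by
  have smooth : ∃ C : ℝ, 0 ≤ C ∧ ∀ w : Vec d → ℝ, AEStronglyMeasurable w D.spaceMeasure →
      (∀ x, w x ∈ Icc 0 N) → m ≤ ∫ x in D.cell, w x →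
      ∀ φ : Vec d → Vec d, ContDiff ℝ 1 φ → D.Supported φ → ∫ x in D.cell, ‖φ x‖ ^ 2
        ≤ C * ((∫ x in D.cell, ‖jacobian φ x‖ ^ 2) + ∫ x in D.cell, w x * ‖φ x‖ ^ 2) := by
    cases D with
    | torus => exact poincare_torus_smooth hm hN
    | wall Ω =>
      obtain ⟨C, h0, hC⟩ := poincare_wall_smooth hd hD
      -- With walls the gradient alone suffices, and the weighted term is a nonnegative addition.
      refine ⟨C, h0, fun w _ hw _ φ hφ hs => (hC φ hφ hs).trans ?_⟩
      gcongr
      exact le_add_of_nonneg_right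
        (integral_nonneg fun x => mul_nonneg (hw x).1 (by positivity))
  obtain ⟨C, h0, hC⟩ := smooth
  refine ⟨C, h0, fun w hw hwN hwm v G ⟨hv1, hv2, φ, hφ, h1, h2⟩ => ?_⟩
  have c1 : ∀ n, ContDiff ℝ 1 (φ n) := fun n => (hφ n).1.of_le one_le_two
  have m1 := fun n => memLp_cell hD (c1 n).continuous 2
  have m2 := fun n => memLp_cell hD (continuous_jacobian (c1 n)) 2
  have hw' : ∀ {f : Vec d → Vec d}, MemLp f 2 D.spaceMeasure →
      MemLp (fun x => w x • f x) 2 D.spaceMeasure := fun hf =>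
    MemLp.of_le_mul (c := N) hf (hw.smul hf.1) (.of_forall fun x => by
      rw [norm_smul, Real.norm_of_nonneg (hwN x).1]; gcongr; exact (hwN x).2)
  have t1 := tendsto_integral_inner m1 hv1 m1 hv1 h1 h1
  have t2 := tendsto_integral_inner m2 hv2 m2 hv2 h2 h2
  have t3 := tendsto_integral_inner (fun n => hw' (m1 n)) (hw' hv1) m1 hv1
    (tendsto_eLpNorm_map N (fun n x => by
      rw [← smul_sub, norm_smul, Real.norm_of_nonneg (hwN x).1]; gcongr; exact (hwN x).2) h1) h1
  simp only [real_inner_smul_left, real_inner_self_eq_norm_sq] at t1 t2 t3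
  exact le_of_tendsto_of_tendsto' t1 ((t2.add t3).const_mul C) fun n =>
    hC w hw hwN hwm (φ n) (c1 n) (hφ n).2

end Domain

end

end MHD

namespace MHD
noncomputable section

/-! ### The divergence theorem on Lipschitz domains for tangential fields -/

variable {d : ℕ}

lemma continuous_divergence {f : Vec d → Vec d} (hf : ContDiff ℝ 1 f) : Continuous (divergence f) :=
  continuous_finsetSum _ fun i _ => continuous_partialD' hf i
where
  continuous_partialD' {f : Vec d → Vec d} (hf : ContDiff ℝ 1 f) (i : Fin d) :
      Continuous (partialD i fun y => f y i) :=
    Domain.continuous_partialD (contDiff_apply_coord hf i) i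

lemma divergence_eq_zero_of_notMem_tsupport {f : Vec d → Vec d} {x : Vec d}
    (hx : x ∉ tsupport f) : divergence f x = 0 := by
  refine Finset.sum_eq_zero fun i _ => ?_
  have h : (fun y => f y i) =ᶠ[𝓝 x] fun _ => 0 := by
    filter_upwards [(isClosed_tsupport f).isOpen_compl.mem_nhds hx] with y hy
    simp [image_eq_zero_of_notMem_tsupport hy]
  simp [partialD, h.fderiv_eq]

/-! ### The divergence theorem near a boundary point -/

section Graph

variable {Ω : Set (Vec d)} {y e : Vec d} {r : ℝ} {h : Vec d → ℝ}

/-- At a boundary point where the defining function `h` of the domain is differentiable, the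
outward normal is `-∇h / |∇h|`. -/
lemma isOutwardNormal_of_hasFDerivAt {z n : Vec d} (hΩ : ∀ᶠ x in 𝓝 z, x ∈ Ω ↔ 0 < h x)
    (hz : h z = 0) (hd : HasFDerivAt h (innerSL ℝ n) z) (hn : n ≠ 0) :
    IsOutwardNormal Ω z (-(‖n‖⁻¹ • n)) := by
  have hn' : 0 < ‖n‖ := norm_pos_iff.2 hn
  refine ⟨by rw [norm_neg, norm_smul, norm_inv, norm_norm, inv_mul_cancel₀ hn'.ne'],
    fun ε hε => ?_⟩
  have h1 := (hasFDerivAt_iff_isLittleO_nhds_zero.1 hd).def (mul_pos hε hn')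
  have h2 : ∀ᶠ x in 𝓝 z, |h x - inner ℝ n (x - z)| ≤ ε * ‖n‖ * ‖x - z‖ := by
    have ht : Tendsto (fun x => x - z) (𝓝 z) (𝓝 0) := by
      have : Continuous fun x : Vec d => x - z := by fun_prop
      simpa using this.tendsto z
    filter_upwards [ht.eventually h1] with x hx
    simpa [hz] using hx
  obtain ⟨δ, hδ, hball⟩ := Metric.eventually_nhds_iff_ball.1 (hΩ.and h2)
  refine ⟨δ, hδ, fun x hx => ?_⟩
  obtain ⟨hx1, hx2⟩ := hball x hx
  rw [hx1, inner_neg_right, real_inner_smul_right, real_inner_comm]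
  have hx3 := abs_le.1 hx2
  have key : inner ℝ n (x - z) = ‖n‖ * (‖n‖⁻¹ * inner ℝ n (x - z)) := by
    rw [← mul_assoc, mul_inv_cancel₀ hn'.ne', one_mul]
  set a := ‖n‖⁻¹ * inner ℝ n (x - z)
  constructor
  · intro hlt
    have : ‖n‖ * (ε * ‖x - z‖) < ‖n‖ * a := mul_lt_mul_of_pos_left (by linarith) hn'
    nlinarith
  · intro hlt
    have : ‖n‖ * a < ‖n‖ * -(ε * ‖x - z‖) := mul_lt_mul_of_pos_left (by linarith) hn'
    rw [not_lt]
    nlinarith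

/-- Sliding x by −h(x) along e reaches the zero set of h at z = x − h(x)e. The derivative of h is
the same at x and z, since h is affine with slope 1 along e. If z lies in the chart it is therefore
a boundary point with normal parallel to ∇h(x), and f(z) is orthogonal to it; otherwise f(z) = 0. -/
lemma fderiv_defining_apply (hΩ : IsOpen Ω) (hshift : ∀ x (s : ℝ), h (x + s • e) = h x + s)
    (hloc : ∀ x ∈ Metric.ball y r, x ∈ Ω ↔ 0 < h x) {f : Vec d → Vec d}
    (hs : tsupport f ⊆ Metric.ball y r)
    (hn : ∀ z ∈ frontier Ω, ∀ ν, IsOutwardNormal Ω z ν → inner ℝ (f z) ν = 0) {x : Vec d}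
    (hx : DifferentiableAt ℝ h x) : fderiv ℝ h x (f (x - h x • e)) = 0 := by
  set z := x - h x • e with hz
  by_cases hzb : z ∈ Metric.ball y r
  swap
  · rw [image_eq_zero_of_notMem_tsupport fun hh => hzb (hs hh), map_zero]
  obtain ⟨n, hnx⟩ := (InnerProductSpace.toDual ℝ (Vec d)).surjective (fderiv ℝ h x)
  have hnx' : innerSL ℝ n = fderiv ℝ h x := hnx
  have hz0 : h z = 0 := by
    have := hshift x (-h x)
    rw [neg_smul, ← sub_eq_add_neg] at this
    rw [this]; ring
  have hdz : HasFDerivAt h (innerSL ℝ n) z := by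
    have h1 : HasFDerivAt (fun w => h (w + h x • e)) (fderiv ℝ h x) z := by
      rw [hasFDerivAt_comp_add_right]
      simpa [hz] using hx.hasFDerivAt
    rw [hnx']
    refine (h1.sub_const (h x)).congr_of_eventuallyEq (.of_forall fun w => ?_)
    simp [hshift]
  have hne : inner ℝ n e = 1 := by
    have h1 : HasDerivAt (fun s : ℝ => h (z + s • e)) (innerSL ℝ n e) 0 := by
      have h2 : HasDerivAt (fun s : ℝ => z + s • e) e 0 := by
        simpa using ((hasDerivAt_id (0 : ℝ)).smul_const e).const_add z
      have h3 : HasFDerivAt h (innerSL ℝ n) (z + (0 : ℝ) • e) := by simpa using hdz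
      exact h3.comp_hasDerivAt 0 h2
    have h4 : HasDerivAt (fun s : ℝ => h (z + s • e)) 1 0 := by
      simp only [hshift]
      exact (hasDerivAt_id (0 : ℝ)).const_add _
    exact h1.unique h4
  have hn0 : n ≠ 0 := fun h0 => by simp [h0] at hne
  -- The points z + s e with small s > 0 lie in Ω because h equals s there, while h(z) = 0 keeps z
  -- outside.
  have hfr : z ∈ frontier Ω := by
    rw [hΩ.frontier_eq]
    refine ⟨?_, fun hzΩ => ?_⟩
    · rw [mem_closure_iff_frequently]
      have ht : Tendsto (fun s : ℝ => z + s • e) (𝓝[>] 0) (𝓝 z) := by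
        have : Continuous fun s : ℝ => z + s • e := by fun_prop
        have h2 := this.tendsto 0
        rw [zero_smul, add_zero] at h2
        exact h2.mono_left nhdsWithin_le_nhds
      refine ht.frequently (Eventually.frequently ?_)
      filter_upwards [ht.eventually (Metric.isOpen_ball.mem_nhds hzb), self_mem_nhdsWithin]
        with s hs1 hs2
      rw [hloc _ hs1, hshift, hz0, zero_add]
      exact hs2
    · have := (hloc z hzb).1 hzΩ
      linarith
  have hnorm := hn z hfr _ (isOutwardNormal_of_hasFDerivAt
    (by filter_upwards [Metric.isOpen_ball.mem_nhds hzb] with w hw using hloc w hw) hz0 hdz hn0)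
  rw [← hnx', innerSL_apply_apply]
  rw [inner_neg_right, real_inner_smul_right, neg_eq_zero, mul_eq_zero] at hnorm
  rw [real_inner_comm]
  exact hnorm.resolve_left (inv_ne_zero (norm_ne_zero_iff.2 hn0))

lemma sum_mul_lineDeriv_single {f : Vec d → Vec d} {χ : Vec d → ℝ} {x : Vec d}
    (hχ : DifferentiableAt ℝ χ x) :
    ∑ i, lineDeriv ℝ χ x (EuclideanSpace.single i 1) * f x i = fderiv ℝ χ x (f x) := by
  have hz : f x = ∑ j, f x j • EuclideanSpace.single j (1 : ℝ) := by
    ext i; simp [Finset.sum_apply, Pi.single_apply]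
  conv_rhs => rw [hz]
  simp only [map_sum, map_smul, smul_eq_mul, hχ.lineDeriv_eq_fderiv, mul_comm]

lemma integral_sum_lineDeriv_mul {f : Vec d → Vec d} (hf : ContDiff ℝ 1 f)
    (hc : HasCompactSupport f) {χ : Vec d → ℝ} {L : NNReal} (hχ : LipschitzWith L χ) :
    ∫ x, ∑ i, lineDeriv ℝ χ x (EuclideanSpace.single i 1) * f x i
      = -∫ x, χ x * divergence f x := by
  have hfi : ∀ i, ContDiff ℝ 1 fun x => f x i := fun i => contDiff_apply_coord hf i
  have hci : ∀ i, HasCompactSupport fun x => f x i := fun i =>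
    hc.comp_left (g := fun v : Vec d => v i) rfl
  have i1 : ∀ i, Integrable fun x => lineDeriv ℝ χ x (EuclideanSpace.single i 1) * f x i :=
    fun i => ((hfi i).continuous.integrable_of_hasCompactSupport (hci i)).bdd_mul
      (c := L * ‖(EuclideanSpace.single i 1 : Vec d)‖)
      (aestronglyMeasurable_lineDeriv hχ.continuous _)
      (.of_forall fun x => norm_lineDeriv_le_of_lipschitz ℝ hχ)
  have i2 : ∀ i, Integrable fun x => χ x * partialD i (fun y => f y i) x := fun i =>
    (hχ.continuous.mul (Domain.continuous_partialD (hfi i) i)).integrable_of_hasCompactSupport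
      (((hci i).fderiv_apply ℝ _).mul_left)
  rw [integral_finsetSum _ fun i _ => i1 i]
  simp only [divergence, Finset.mul_sum]
  rw [integral_finsetSum _ fun i _ => i2 i, ← Finset.sum_neg_distrib]
  refine Finset.sum_congr rfl fun i _ => ?_
  obtain ⟨C, hC⟩ := (hfi i).lipschitzWith_of_hasCompactSupport (hci i) one_ne_zero
  rw [hχ.integral_lineDeriv_mul_eq hC (hci i), ← integral_neg]
  refine integral_congr_ae (.of_forall fun x => ?_)
  simp only
  rw [((hfi i).differentiable one_ne_zero x).lineDeriv_eq_fderiv, map_neg, partialD]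
  ring

/-- Let χₙ be (n + 1)h clamped to [0, 1], so that ∫ χₙ div f = −∫ ∇χₙ · f tends to the integral of
div f over Ω. The gradient of χₙ has size n + 1, but it lives in the layer 0 < h < 1/(n + 1). There
∇h(x) · f(x) = ∇h(x) · (f(x) − f(x − h(x)e)) is at most L M h(x), by tangency at the foot point.
Hence ∇χₙ · f is bounded by L M and, each point leaving the layer eventually, tends to zero almost
everywhere. -/
lemma integral_divergence_local (hΩ : IsOpen Ω) {L : NNReal} (hL : LipschitzWith L h) (he : ‖e‖ = 1)
    (hshift : ∀ x (s : ℝ), h (x + s • e) = h x + s)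
    (hloc : ∀ x ∈ Metric.ball y r, x ∈ Ω ↔ 0 < h x) {f : Vec d → Vec d} (hf : ContDiff ℝ 1 f)
    (hs : tsupport f ⊆ Metric.ball y r)
    (hn : ∀ z ∈ frontier Ω, ∀ ν, IsOutwardNormal Ω z ν → inner ℝ (f z) ν = 0) :
    ∫ x in Ω, divergence f x = 0 := by
  have hc : HasCompactSupport f :=
    Metric.isCompact_of_isClosed_isBounded (isClosed_tsupport f) (Metric.isBounded_ball.subset hs)
  obtain ⟨M, hM⟩ := hf.lipschitzWith_of_hasCompactSupport hc one_ne_zero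
  have hdc := continuous_divergence hf
  have hdcs : HasCompactSupport (divergence f) :=
    hc.mono' fun x hx => by_contra fun h' => hx (divergence_eq_zero_of_notMem_tsupport h')
  have hdi := hdc.integrable_of_hasCompactSupport (μ := volume) hdcs
  set χ : ℕ → Vec d → ℝ := fun n x => max 0 (min 1 ((n + 1) * h x)) with hχdef
  have hχ0 : ∀ n x, 0 ≤ χ n x := fun n x => le_max_left _ _
  have hχ1 : ∀ n x, χ n x ≤ 1 := fun n x => max_le zero_le_one (min_le_left _ _)
  have hχL : ∀ n : ℕ, ∃ C, LipschitzWith C (χ n) := fun n =>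
    ⟨_, ((((lipschitzWith_smul (n + 1 : ℝ)).comp hL).const_min 1).const_max 0)⟩
  choose C hC using hχL
  have hcχ : ∀ n, Continuous (χ n) := fun n => (hC n).continuous
  have hbig : ∀ {x : Vec d} {N n : ℕ}, 0 < h x → 1 / h x < N → N ≤ n → 1 ≤ (n + 1) * h x :=
    fun {x N n} hpos hN hn => by
      rw [div_lt_iff₀ hpos] at hN
      have : (N : ℝ) * h x ≤ n * h x := by gcongr
      linarith
  have lim1 : Tendsto (fun n => ∫ x, χ n x * divergence f x) atTop
      (𝓝 (∫ x, Ω.indicator (divergence f) x)) := by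
    refine tendsto_integral_of_dominated_convergence (fun x => ‖divergence f x‖)
      (fun n => ((hcχ n).mul hdc).aestronglyMeasurable) hdi.norm (fun n => .of_forall fun x => ?_)
      (.of_forall fun x => ?_)
    · rw [norm_mul, Real.norm_of_nonneg (hχ0 n x)]
      exact mul_le_of_le_one_left (norm_nonneg _) (hχ1 n x)
    · by_cases hx : x ∈ Metric.ball y r
      · by_cases hxΩ : x ∈ Ω
        · have hpos := (hloc x hx).1 hxΩ
          rw [indicator_of_mem hxΩ]
          refine tendsto_const_nhds.congr' ?_
          obtain ⟨N, hN⟩ := exists_nat_gt (1 / h x)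
          filter_upwards [eventually_ge_atTop N] with n hn
          have h1 := hbig hpos hN hn
          simp [hχdef, min_eq_left h1]
        · have hneg : h x ≤ 0 := not_lt.1 fun h' => hxΩ ((hloc x hx).2 h')
          rw [indicator_of_notMem hxΩ]
          refine tendsto_const_nhds.congr fun n => ?_
          have h1 : ((n : ℝ) + 1) * h x ≤ 0 := mul_nonpos_of_nonneg_of_nonpos (by positivity) hneg
          simp [hχdef, min_eq_right (h1.trans zero_le_one), max_eq_left h1]
      · have h0 : divergence f x = 0 :=
          divergence_eq_zero_of_notMem_tsupport fun h' => hx (hs h')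
        by_cases hxΩ : x ∈ Ω <;> simp [h0, hxΩ]
  have bound : ∀ n : ℕ, ∀ᵐ x : Vec d,
      ‖∑ i, lineDeriv ℝ (χ n) x (EuclideanSpace.single i 1) * f x i‖
        ≤ ({x | 0 < h x ∧ (n + 1) * h x < 1} ∩ tsupport f).indicator (fun _ => (L * M : ℝ)) x := by
    intro n
    filter_upwards [(hC n).ae_differentiableAt, hL.ae_differentiableAt] with x hx1 hx2
    rw [sum_mul_lineDeriv_single hx1]
    by_cases hxs : x ∈ tsupport f
    swap
    · rw [image_eq_zero_of_notMem_tsupport hxs, map_zero, norm_zero]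
      exact indicator_nonneg (fun _ _ => by positivity) _
    by_cases hxh : 0 < h x ∧ (n + 1) * h x < 1
    · rw [indicator_of_mem (show x ∈ {x | 0 < h x ∧ (n + 1) * h x < 1} ∩ tsupport f from ⟨hxh, hxs⟩)]
      have hev : χ n =ᶠ[𝓝 x] fun x => (n + 1 : ℝ) • h x := by
        filter_upwards [hL.continuous.continuousAt.eventually (lt_mem_nhds hxh.1),
          (hL.continuous.const_mul (n + 1 : ℝ)).continuousAt.eventually (gt_mem_nhds hxh.2)]
          with z hz1 hz2
        have : 0 ≤ ((n : ℝ) + 1) * h z := by positivity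
        simp [hχdef, min_eq_right hz2.le, max_eq_right this]
      rw [hev.fderiv_eq, fderiv_fun_const_smul hx2, _root_.smul_apply]
      have h0 := fderiv_defining_apply hΩ hshift hloc hs hn hx2
      have h1 : ‖fderiv ℝ h x (f x)‖ ≤ L * (M * h x) := by
        calc ‖fderiv ℝ h x (f x)‖ = ‖fderiv ℝ h x (f x - f (x - h x • e))‖ := by
              rw [map_sub, h0, sub_zero]
          _ ≤ ‖fderiv ℝ h x‖ * ‖f x - f (x - h x • e)‖ := ContinuousLinearMap.le_opNorm _ _
          _ ≤ L * (M * h x) := by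
            refine mul_le_mul (norm_fderiv_le_of_lipschitz ℝ hL) ?_ (norm_nonneg _) L.2
            have := hM.dist_le_mul x (x - h x • e)
            rw [dist_eq_norm, dist_eq_norm, sub_sub_cancel, norm_smul, he, mul_one,
              Real.norm_of_nonneg hxh.1.le] at this
            exact this
      rw [norm_smul, Real.norm_of_nonneg (by positivity : (0 : ℝ) ≤ n + 1)]
      calc ((n : ℝ) + 1) * ‖fderiv ℝ h x (f x)‖ ≤ (n + 1) * (L * (M * h x)) := by gcongr
        _ = L * M * ((n + 1) * h x) := by ring
        _ ≤ L * M := mul_le_of_le_one_right (by positivity) hxh.2.le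
    · rw [indicator_of_notMem fun h' => hxh h'.1]
      -- Outside the layer χₙ attains its minimum 0 or its maximum 1, so its derivative vanishes
      -- there, on the edges of the layer too.
      have : fderiv ℝ (χ n) x = 0 := by
        rcases not_and_or.1 hxh with hx | hx
        · refine IsLocalMin.fderiv_eq_zero (.of_forall fun z => ?_)
          have h1 : ((n : ℝ) + 1) * h x ≤ 0 :=
            mul_nonpos_of_nonneg_of_nonpos (by positivity) (not_lt.1 hx)
          have h2 : χ n x = 0 := by
            simp [hχdef, min_eq_right (h1.trans zero_le_one), max_eq_left h1]
          rw [h2]; exact hχ0 n z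
        · refine IsLocalMax.fderiv_eq_zero (.of_forall fun z => ?_)
          have h2 : χ n x = 1 := by simp [hχdef, min_eq_left (not_lt.1 hx)]
          rw [h2]; exact hχ1 n z
      simp [this]
  have lim2 : Tendsto (fun n => ∫ x, ∑ i, lineDeriv ℝ (χ n) x (EuclideanSpace.single i 1) * f x i)
      atTop (𝓝 (∫ _x : Vec d, (0 : ℝ))) := by
    refine tendsto_integral_of_dominated_convergence
      ((tsupport f).indicator fun _ => (L * M : ℝ)) (fun n => ?_) ?_ (fun n => ?_) ?_
    · exact Finset.aestronglyMeasurable_fun_sum _ fun i _ =>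
        (aestronglyMeasurable_lineDeriv (hcχ n) _).mul
          (contDiff_apply_coord hf i).continuous.aestronglyMeasurable
    · exact (integrable_indicator_iff (isClosed_tsupport f).measurableSet).2
        (integrableOn_const hc.isCompact.measure_lt_top.ne)
    · filter_upwards [bound n] with x hx
      exact hx.trans (indicator_le_indicator_of_subset inter_subset_right
        (fun _ => by positivity) x)
    · filter_upwards [ae_all_iff.2 bound] with x hx
      have hev : ∀ᶠ n : ℕ in atTop, ¬(0 < h x ∧ (n + 1) * h x < 1) := by
        by_cases hpos : 0 < h x
        · obtain ⟨N, hN⟩ := exists_nat_gt (1 / h x)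
          filter_upwards [eventually_ge_atTop N] with n hn
          exact fun h' => (hbig hpos hN hn).not_gt h'.2
        · exact .of_forall fun n h' => hpos h'.1
      refine tendsto_const_nhds.congr' ?_
      filter_upwards [hev] with n hn'
      have := hx n
      rw [indicator_of_notMem fun h' => hn' h'.1] at this
      exact (norm_le_zero_iff.1 this).symm
  simp only [integral_sum_lineDeriv_mul hf hc (hC _), integral_zero] at lim2
  have := tendsto_nhds_unique lim1.neg lim2
  rw [← integral_indicator hΩ.measurableSet]
  linarith

end Graph

/-- The divergence theorem on a bounded Lipschitz domain, for a field without normal component. -/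
theorem integral_divergence_eq_zero_of_tangential {Ω : Set (Vec d)} (hΩ : IsOpen Ω)
    (hb : Bornology.IsBounded Ω) (hL : HasLipschitzBoundary Ω) {w : Vec d → Vec d}
    (hw : ContDiff ℝ 1 w)
    (hn : ∀ z ∈ frontier Ω, ∀ ν, IsOutwardNormal Ω z ν → inner ℝ (w z) ν = 0) :
    ∫ x in Ω, divergence w x = 0 := by
  classical
  choose! e r K g he hr hg hinv hloc using hL
  -- A boundary point gets the ball of its chart; every other point of the closure lies in the open
  -- set Ω and gets Ω itself.
  let U : Vec d → Set (Vec d) := fun y => if y ∈ frontier Ω then Metric.ball y (r y) else Ω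
  have hUo : ∀ y, IsOpen (U y) := fun y => by
    by_cases h : y ∈ frontier Ω
    · simp [U, h, Metric.isOpen_ball]
    · simp [U, h, hΩ]
  have hU : ∀ y ∈ closure Ω, U y ∈ 𝓝 y := fun y hy => by
    refine (hUo y).mem_nhds ?_
    by_cases h : y ∈ frontier Ω
    · simp [U, h, hr y h]
    · simp only [U, h, if_false]
      by_contra hyΩ
      exact h (by rw [hΩ.frontier_eq]; exact ⟨hy, hyΩ⟩)
  obtain ⟨t, -, ht⟩ := hb.isCompact_closure.elim_nhds_subcover U hU
  obtain ⟨ρ, hρ⟩ := SmoothPartitionOfUnity.exists_isSubordinate (modelWithCornersSelf ℝ (Vec d))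
    (isClosed_closure (s := Ω)) (fun i : t => U i) (fun i => hUo i)
    (by rw [iUnion_subtype]; exact ht)
  have hρs : ∀ i, ContDiff ℝ 1 (ρ i) := fun i =>
    ((ρ i).contMDiff.contDiff).of_le (by exact_mod_cast le_top)
  have hsum : ∀ x ∈ closure Ω, ∑ i, ρ i x = 1 := fun x hx => by
    have := ρ.sum_eq_one hx
    rwa [finsum_eq_sum_of_fintype] at this
  have hfi : ∀ i, ContDiff ℝ 1 fun x => ρ i x • w x := fun i => (hρs i).smul hw
  have hts : ∀ i, tsupport (fun x => ρ i x • w x) ⊆ U i := fun i =>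
    (closure_mono (Function.support_smul_subset_left _ _)).trans (hρ i)
  have hpiece : ∀ i, ∫ x in Ω, divergence (fun x => ρ i x • w x) x = 0 := by
    intro i
    have hni : ∀ z ∈ frontier Ω, ∀ ν, IsOutwardNormal Ω z ν → inner ℝ (ρ i z • w z) ν = 0 :=
      fun z hz ν hν => by rw [real_inner_smul_left, hn z hz ν hν, mul_zero]
    by_cases h : (i : Vec d) ∈ frontier Ω
    · have hti := hts i
      simp only [U, h, if_true] at hti
      -- The defining function is ⟨e, x⟩ − g(x): as g ignores the direction e and |e| = 1, it grows
      -- with slope 1 along e.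
      refine integral_divergence_local (h := fun x => inner ℝ (e i) x - g i x) (e := e i)
        (L := 1 + K i) hΩ ?_ (he _ h) (fun x s => ?_) (fun x hx => ?_) (hfi i) hti hni
      · refine LipschitzWith.sub ?_ (hg _ h)
        refine LipschitzWith.of_dist_le_mul fun a b => ?_
        rw [Real.dist_eq, ← inner_sub_right, dist_eq_norm]
        have := abs_real_inner_le_norm (e i) (a - b)
        rw [he _ h] at this
        simpa using this
      · rw [hinv _ h, inner_add_right, real_inner_smul_right, real_inner_self_eq_norm_sq, he _ h]
        ring
      · rw [hloc _ h x hx, sub_pos]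
    · have hti := hts i
      simp only [U, h, if_false] at hti
      -- An interior piece has its closed support in the bounded set Ω, so it is compactly supported
      -- and needs no boundary condition.
      have hc : IsCompact (tsupport fun x => ρ i x • w x) :=
        Metric.isCompact_of_isClosed_isBounded (isClosed_tsupport _) (hb.subset hti)
      have hsup : ∀ k, (Domain.wall Ω).Supported fun x => (ρ i x • w x) k := fun k =>
        ⟨trivial, _, hc, hti, fun x hx => by
          have := image_eq_zero_of_notMem_tsupport hx
          simpa using congrArg (fun v : Vec d => v k) this⟩
      simp only [divergence]
      rw [integral_finsetSum]
      · exact Finset.sum_eq_zero fun k _ =>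
          Domain.integral_partialD_eq_zero (contDiff_apply_coord (hfi i) k) (hsup k) k
      · intro k _
        exact ((Domain.continuous_partialD (contDiff_apply_coord (hfi i) k) k).continuousOn.integrableOn_compact
          hb.isCompact_closure).mono_set subset_closure
  have hdecomp : ∀ x ∈ Ω, divergence w x = ∑ i, divergence (fun x => ρ i x • w x) x := by
    intro x hx
    have hpd : ∀ k, partialD k (fun y => w y k) x
        = ∑ i, partialD k (fun y => (ρ i y • w y) k) x := fun k => by
      have hev : (fun y => w y k) =ᶠ[𝓝 x] fun y => ∑ i, (ρ i y • w y) k := by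
        filter_upwards [hΩ.mem_nhds hx] with y hy
        simp only [PiLp.smul_apply, smul_eq_mul]
        rw [← Finset.sum_mul, hsum y (subset_closure hy), one_mul]
      simp only [partialD]
      rw [hev.fderiv_eq, fderiv_fun_sum fun i _ =>
        ((contDiff_apply_coord (hfi i) k).differentiable one_ne_zero x)]
      simp
    simp only [divergence, hpd]
    exact Finset.sum_comm
  rw [setIntegral_congr_fun hΩ.measurableSet hdecomp, integral_finsetSum]
  · exact Finset.sum_eq_zero fun i _ => hpiece i
  · intro i _
    exact ((continuous_divergence (hfi i)).continuousOn.integrableOn_compact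
      hb.isCompact_closure).mono_set subset_closure

end

end MHD

namespace MHD
noncomputable section

/-! ### Integration by parts for the curl -/

variable {d : ℕ}

lemma contDiff_pad {n : WithTop ℕ∞} {E : Type*} [NormedAddCommGroup E] [NormedSpace ℝ E]
    {v : E → Vec d} (hv : ContDiff ℝ n v) : ContDiff ℝ n fun y => pad (v y) := by
  refine contDiff_euclidean.2 fun i => ?_
  simp only [pad]
  split_ifs with h
  · exact contDiff_apply_coord hv _
  · exact contDiff_const

lemma contDiff_trunc {n : WithTop ℕ∞} {E : Type*} [NormedAddCommGroup E] [NormedSpace ℝ E]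
    {w : E → Vec 3} (hw : ContDiff ℝ n w) : ContDiff ℝ n fun y => (trunc (w y) : Vec d) := by
  refine contDiff_euclidean.2 fun i => ?_
  simp only [trunc]
  split_ifs with h
  · exact contDiff_apply_coord hw _
  · exact contDiff_const

lemma cross_apply_zero (a b : Vec 3) : cross a b 0 = a 1 * b 2 - a 2 * b 1 := by
  simp [cross, crossProduct]

lemma cross_apply_one (a b : Vec 3) : cross a b 1 = a 2 * b 0 - a 0 * b 2 := by
  simp [cross, crossProduct]

lemma cross_apply_two (a b : Vec 3) : cross a b 2 = a 0 * b 1 - a 1 * b 0 := by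
  simp [cross, crossProduct]

lemma contDiff_cross {n : WithTop ℕ∞} {E : Type*} [NormedAddCommGroup E] [NormedSpace ℝ E]
    {v w : E → Vec 3} (hv : ContDiff ℝ n v) (hw : ContDiff ℝ n w) :
    ContDiff ℝ n fun y => cross (v y) (w y) := by
  have h1 := contDiff_apply_coord hv
  have h2 := contDiff_apply_coord hw
  refine contDiff_euclidean.2 fun i => ?_
  fin_cases i
  · simp only [Fin.zero_eta, cross_apply_zero]
    exact ((h1 1).mul (h2 2)).sub ((h1 2).mul (h2 1))
  · simp only [Fin.mk_one, cross_apply_one]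
    exact ((h1 2).mul (h2 0)).sub ((h1 0).mul (h2 2))
  · simp only [Fin.reduceFinMk, cross_apply_two]
    exact ((h1 0).mul (h2 1)).sub ((h1 1).mul (h2 0))

lemma contDiff_partialD₃ {n : ℕ} {f : Vec d → ℝ} (hf : ContDiff ℝ (n + 1 : ℕ) f) (j : Fin 3) :
    ContDiff ℝ n (partialD₃ j f) := by
  unfold partialD₃
  split_ifs
  · exact contDiff_partialD hf _
  · exact contDiff_const

lemma contDiff_curl {n : ℕ} {F : Vec d → Vec 3} (hF : ContDiff ℝ (n + 1 : ℕ) F) :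
    ContDiff ℝ n (curl F) := by
  have h := fun i j => contDiff_partialD₃ (contDiff_apply_coord hF i) j
  refine contDiff_euclidean.2 fun i => ?_
  fin_cases i
  · exact (h 2 1).sub (h 1 2)
  · exact (h 0 2).sub (h 2 0)
  · exact (h 1 0).sub (h 0 1)

lemma continuous_curl {F : Vec d → Vec 3} (hF : ContDiff ℝ 1 F) : Continuous (curl F) :=
  (contDiff_curl (n := 0) (by exact_mod_cast hF)).continuous

lemma partialD₃_mul_sub_mul {a b c e : Vec d → ℝ} {x : Vec d} (ha : DifferentiableAt ℝ a x)
    (hb : DifferentiableAt ℝ b x) (hc : DifferentiableAt ℝ c x) (he : DifferentiableAt ℝ e x)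
    (j : Fin 3) : partialD₃ j (fun y => a y * b y - c y * e y) x
      = partialD₃ j a x * b x + a x * partialD₃ j b x
        - (partialD₃ j c x * e x + c x * partialD₃ j e x) := by
  unfold partialD₃
  split_ifs with h
  · rw [← Domain.partialD_mul ha hb, ← Domain.partialD_mul hc he]
    simp only [partialD]
    rw [fderiv_fun_sub (ha.fun_mul hb) (hc.fun_mul he)]
    rfl
  · ring

lemma inner_curl_sub (Φ F : Vec d → Vec 3) (x : Vec d) (hΦ : DifferentiableAt ℝ Φ x)
    (hF : DifferentiableAt ℝ F x) :
    inner ℝ (curl Φ x) (F x) - inner ℝ (Φ x) (curl F x)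
      = ∑ j, partialD₃ j (fun y => cross (Φ y) (F y) j) x := by
  have h1 := fun i => (differentiableAt_euclidean.1 hΦ) i
  have h2 := fun i => (differentiableAt_euclidean.1 hF) i
  simp only [Fin.sum_univ_three, cross_apply_zero, cross_apply_one, cross_apply_two,
    partialD₃_mul_sub_mul (h1 _) (h2 _) (h1 _) (h2 _), inner_vec, curl]
  simp
  ring

/-- For planar fields the derivative in the third direction is zero, so the third component of w
does not contribute. -/
lemma sum_partialD₃ (hd : d = 2 ∨ d = 3) (w : Vec d → Vec 3) (x : Vec d) :
    ∑ j, partialD₃ j (fun y => w y j) x = divergence (fun y => (trunc (w y) : Vec d)) x := by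
  rcases hd with rfl | rfl <;>
    simp [divergence, trunc, partialD₃, Fin.sum_univ_three, Fin.sum_univ_two]

namespace Domain

variable {D : Domain d}

lemma integral_divergence_of_supported (hD : D.Admissible) {w : Vec d → Vec d}
    (hw : ContDiff ℝ 1 w) (hs : D.Supported w) : ∫ x in D.cell, divergence w x = 0 := by
  simp only [divergence]
  rw [integral_finsetSum _ fun i _ => integrableOn_cell hD
    (continuous_partialD (contDiff_apply_coord hw i) i)]
  exact Finset.sum_eq_zero fun i _ =>
    integral_partialD_eq_zero (contDiff_apply_coord hw i) (hs.comp (fun v => v i) rfl) i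

lemma integral_inner_curl (hd : d = 2 ∨ d = 3) (hD : D.Admissible) {b : Vec d → Vec d}
    (hb : ContDiff ℝ 1 b) {F : Vec d → Vec 3} (hF : ContDiff ℝ 1 F)
    (h : ∫ x in D.cell, divergence (fun y => trunc (cross (pad (b y)) (F y))) x = 0) :
    ∫ x in D.cell, inner ℝ (curl (fun y => pad (b y)) x) (F x)
      = ∫ x in D.cell, inner ℝ (pad (b x)) (curl F x) := by
  have hp := contDiff_pad hb
  rw [← sub_eq_zero, ← integral_sub, ← h]
  · refine integral_congr_ae (.of_forall fun x => ?_)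
    simp only
    rw [inner_curl_sub _ _ _ (hp.differentiable one_ne_zero x) (hF.differentiable one_ne_zero x),
      sum_partialD₃ hd]
  · exact integrableOn_cell hD ((continuous_curl hp).inner hF.continuous)
  · exact integrableOn_cell hD (hp.continuous.inner (continuous_curl hF))

lemma cross_zero_left (a : Vec 3) : cross 0 a = 0 := by simp [cross]

lemma pad_zero : pad (0 : Vec d) = 0 := by
  ext i; simp only [pad]; split_ifs <;> rfl

lemma trunc_zero : (trunc 0 : Vec d) = 0 := by
  ext i; simp only [trunc]; split_ifs <;> rfl

/-- Integration by parts for the curl of a classical field with `b × n = 0` on the boundary. -/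
theorem integral_inner_curl_of_noTangentialPart (hd : d = 2 ∨ d = 3) (hD : D.Admissible)
    {b : Vec d → Vec d} (hb : ContDiff ℝ 1 b) (hbp : D.Periodic b) (hbn : D.NoTangentialPart b)
    {F : Vec d → Vec 3} (hF : ContDiff ℝ 1 F) (hFp : D.Periodic F) :
    ∫ x in D.cell, inner ℝ (curl (fun y => pad (b y)) x) (F x)
      = ∫ x in D.cell, inner ℝ (pad (b x)) (curl F x) := by
  refine integral_inner_curl hd hD hb hF ?_
  have hw : ContDiff ℝ 1 fun y => (trunc (cross (pad (b y)) (F y)) : Vec d) :=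
    contDiff_trunc (contDiff_cross (contDiff_pad hb) hF)
  cases D with
  | torus =>
    exact integral_divergence_of_supported hD hw
      ⟨hbp.comp₂ hFp fun v w => trunc (cross (pad v) w), trivial⟩
  | wall Ω =>
    refine integral_divergence_eq_zero_of_tangential hD.1 hD.2.1 hD.2.2 hw fun z hz ν hν => ?_
    -- The normal component of b × F is the triple product (ν × b) · F, which vanishes because b × ν
    -- = 0.
    rw [inner_trunc hd, inner_cross_rotate, inner_cross_rotate, cross_anticomm', hbn z hz ν hν]
    simp

/-- Integration by parts for fields in `H₀(Curl)`. -/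
theorem HasSobolevCurl.integral_inner (hd : d = 2 ∨ d = 3) (hD : D.Admissible)
    {v : Vec d → Vec d} {J : Vec d → Vec 3} (h : D.HasSobolevCurl v J)
    (hv : MemLp v 2 D.spaceMeasure) (hJ : MemLp J 2 D.spaceMeasure)
    {F : Vec d → Vec 3} (hF : ContDiff ℝ 1 F) (hFp : D.Periodic F) :
    ∫ x in D.cell, inner ℝ (J x) (F x) = ∫ x in D.cell, inner ℝ (pad (v x)) (curl F x) := by
  obtain ⟨φ, hφ, h1, h2⟩ := h
  have c1 : ∀ n, ContDiff ℝ 1 (φ n) := fun n =>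
    (hφ n).1.of_le (WithTop.coe_le_coe.2 (le_top : (1 : ℕ∞) ≤ ⊤))
  have t1 := tendsto_integral_inner
    (fun n => memLp_cell hD (continuous_curl (contDiff_pad (c1 n))) 2) hJ
    (fun _ => memLp_cell hD hF.continuous 2) (memLp_cell hD hF.continuous 2)
    h2 (tendsto_eLpNorm_const_sub F)
  have hpad : Continuous (pad : Vec d → Vec 3) :=
    (contDiff_pad (n := 0) contDiff_id).continuous
  have hpv : MemLp (fun x => pad (v x)) 2 D.spaceMeasure :=
    MemLp.of_le hv (hpad.comp_aestronglyMeasurable hv.1)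
      (.of_forall fun x => (norm_pad hd _).le)
  have t2 := tendsto_integral_inner
    (fun n => memLp_cell hD (contDiff_pad (c1 n)).continuous 2) hpv
    (fun _ => memLp_cell hD (continuous_curl hF) 2) (memLp_cell hD (continuous_curl hF) 2)
    (tendsto_eLpNorm_map 1 (fun n x => by
      rw [← pad_sub, norm_pad hd, one_mul]) h1) (tendsto_eLpNorm_const_sub (curl F))
  refine tendsto_nhds_unique t1 (t2.congr fun n => ?_)
  refine (integral_inner_curl hd hD (c1 n) hF ?_).symm
  refine integral_divergence_of_supported hD
    (contDiff_trunc (contDiff_cross (contDiff_pad (c1 n)) hF)) ?_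
  exact (Supported.mk (hφ n).2.1 (hφ n).2.2).comp₂ hFp (fun v w => trunc (cross (pad v) w))
    fun w => by rw [pad_zero, cross_zero_left, trunc_zero]

end Domain

end

end MHD

namespace MHD
noncomputable section

/-! ### The relative pressure potential -/

/-- Chain t^p ≥ 1 + p log t, log t ≥ 1 − 1/t and, on [1, 2], 1 − 1/t ≥ (t − 1)/2. The constant is
chosen to serve on both sides of t = 1. -/
lemma rpow_sub_one_ge {p t : ℝ} (hp : 0 < p) (h1 : 1 ≤ t) (h2 : t ≤ 2) :
    min 1 p / 2 * (t - 1) ≤ t ^ p - 1 := by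
  have ht : 0 < t := by linarith
  have e1 : p * Real.log t + 1 ≤ t ^ p := by
    rw [Real.rpow_def_of_pos ht, mul_comm]; exact Real.add_one_le_exp _
  have e2 : 1 - t⁻¹ ≤ Real.log t := Real.one_sub_inv_le_log_of_pos ht
  have e3 : (t - 1) / 2 ≤ 1 - t⁻¹ := by
    have : 1 - t⁻¹ = (t - 1) / t := by field_simp
    rw [this]
    exact div_le_div_of_nonneg_left (by linarith) ht h2
  have e4 : min 1 p * (t - 1) ≤ p * (t - 1) :=
    mul_le_mul_of_nonneg_right (min_le_right _ _) (by linarith)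
  nlinarith [mul_le_mul_of_nonneg_left (e3.trans e2) hp.le]

/-- For p ≥ 1 one has t^p ≤ t; for p ≤ 1 Bernoulli's inequality for concave powers applies. Halving
the constant only weakens the bound, since t − 1 ≤ 0. -/
lemma rpow_sub_one_le {p t : ℝ} (hp : 0 < p) (h0 : 0 ≤ t) (h1 : t ≤ 1) :
    t ^ p - 1 ≤ min 1 p / 2 * (t - 1) := by
  have key : t ^ p - 1 ≤ min 1 p * (t - 1) := by
    rcases le_total 1 p with h | h
    · rw [min_eq_left h, one_mul]
      have := Real.rpow_le_rpow_of_exponent_ge' h0 h1 zero_le_one h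
      rw [Real.rpow_one] at this
      linarith
    · rw [min_eq_right h]
      have := rpow_one_add_le_one_add_mul_self (s := t - 1) (by linarith) hp.le h
      rw [add_sub_cancel] at this
      linarith
  have h3 : 0 < min 1 p := lt_min one_pos hp
  nlinarith

/-- A quantitative form of Bernoulli's inequality. -/
lemma exists_quantitative_bernoulli {γ : ℝ} (hγ : 1 < γ) : ∃ κ > 0,
    (∀ t ∈ Icc (0 : ℝ) 2, κ * (t - 1) ^ 2 ≤ t ^ γ - 1 - γ * (t - 1)) ∧
      ∀ t : ℝ, 2 ≤ t → κ * t ≤ t ^ γ - 1 - γ * (t - 1) := by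
  have hp : 0 < γ - 1 := by linarith
  set m := min 1 (γ - 1) / 2 with hm
  have hm0 : 0 < m := half_pos (lt_min one_pos hp)
  -- The surplus over a quadratic lower bound. By the two preceding lemmas its derivative has the
  -- sign of t − 1 on [0, 2], so its minimum there is g(1) = 0.
  set g : ℝ → ℝ := fun t => t ^ γ - 1 - γ * (t - 1) - γ * m / 2 * (t - 1) ^ 2 with hg
  have hgd : ∀ t, HasDerivAt g (γ * (t ^ (γ - 1) - 1 - m * (t - 1))) t := fun t => by
    have h1 : HasDerivAt (fun t : ℝ => t ^ γ) (γ * t ^ (γ - 1)) t :=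
      Real.hasDerivAt_rpow_const (.inr hγ.le)
    have h2 : HasDerivAt (fun t : ℝ => t - 1) 1 t := (hasDerivAt_id t).sub_const 1
    refine (((h1.sub_const 1).fun_sub (h2.const_mul γ)).fun_sub
      ((h2.fun_pow 2).const_mul (γ * m / 2))).congr_deriv ?_
    norm_num
    ring
  have hgc : Continuous g := continuous_iff_continuousAt.2 fun t => (hgd t).continuousAt
  have hg1 : g 1 = 0 := by simp [hg]
  have quad : ∀ t ∈ Icc (0 : ℝ) 2, 0 ≤ g t := by
    intro t ht
    rcases le_total t 1 with h | h
    · have anti : AntitoneOn g (Icc 0 1) := by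
        refine antitoneOn_of_deriv_nonpos (convex_Icc 0 1) hgc.continuousOn
          (fun x _ => (hgd x).differentiableAt.differentiableWithinAt) fun x hx => ?_
        rw [interior_Icc] at hx
        rw [(hgd x).deriv]
        have := rpow_sub_one_le hp hx.1.le hx.2.le
        rw [← hm] at this
        exact mul_nonpos_of_nonneg_of_nonpos (by linarith) (by linarith)
      rw [← hg1]
      exact anti ⟨ht.1, h⟩ (right_mem_Icc.2 zero_le_one) h
    · have mono : MonotoneOn g (Icc 1 2) := by
        refine monotoneOn_of_deriv_nonneg (convex_Icc 1 2) hgc.continuousOn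
          (fun x _ => (hgd x).differentiableAt.differentiableWithinAt) fun x hx => ?_
        rw [interior_Icc] at hx
        rw [(hgd x).deriv]
        have := rpow_sub_one_ge hp hx.1.le hx.2.le
        rw [← hm] at this
        exact mul_nonneg (by linarith) (by linarith)
      rw [← hg1]
      exact mono (left_mem_Icc.2 one_le_two) ⟨h, ht.2⟩ h
  have hγm : 0 < γ * m := by positivity
  refine ⟨γ * m / 4, by positivity, fun t ht => ?_, fun t ht => ?_⟩
  · have := quad t ht
    simp only [hg] at this
    nlinarith [sq_nonneg (t - 1)]
  -- Beyond 2, Bernoulli's inequality for t/2 puts t^γ above its tangent at 2, and γ(2^(γ−1) − 1) ≥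
  -- γm. So the left-over is at least γm/2 + γm(t − 2), which exceeds γmt/4 with equality at t = 2;
  -- this explains the constant γm/4.
  · have h2 := quad 2 ⟨zero_le_two, le_rfl⟩
    simp only [hg] at h2
    have h3 := rpow_sub_one_ge hp one_le_two le_rfl
    rw [Real.rpow_sub_one two_ne_zero] at h3
    have h4 := one_add_mul_self_le_rpow_one_add (s := t / 2 - 1) (by linarith) hγ.le
    rw [add_sub_cancel, Real.div_rpow (by linarith) zero_le_two] at h4
    have h5 : (0 : ℝ) < 2 ^ γ := by positivity
    rw [le_div_iff₀ h5] at h4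
    have h6 := mul_le_mul_of_nonneg_left h3
      (by nlinarith : (0 : ℝ) ≤ γ * (t - 2))
    rw [← hm] at h6
    nlinarith

/-- The derivative of the pressure potential. -/
def dPotential (P : Params) (r : ℝ) : ℝ := P.a * P.γ / (P.γ - 1) * r ^ (P.γ - 1)

/-- The derivative of the pressure. -/
def dPressure (P : Params) (r : ℝ) : ℝ := P.a * P.γ * r ^ (P.γ - 1)

/-- The second derivative of the pressure potential. -/
def ddPotential (P : Params) (r : ℝ) : ℝ := P.a * P.γ * r ^ (P.γ - 2)

/-- The Bregman distance of the pressure potential. -/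
def relPotential (P : Params) (ρ r : ℝ) : ℝ :=
  potential P ρ - dPotential P r * (ρ - r) - potential P r

section Potential

variable {P : Params}

/-- Since p = (γ − 1)H, the second-order error of the pressure is a multiple of the relative
potential and is thus part of the relative energy. -/
lemma pressure_sub (hP : P.Valid) (ρ r : ℝ) :
    pressure P ρ - dPressure P r * (ρ - r) - pressure P r = (P.γ - 1) * relPotential P ρ r := by
  have : P.γ - 1 ≠ 0 := by linarith [hP.one_lt_γ]
  simp only [pressure, dPressure, relPotential, potential, dPotential]
  field_simp

lemma pressure_eq (hP : P.Valid) {r : ℝ} (hr : 0 < r) :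
    pressure P r = dPotential P r * r - potential P r := by
  have h1 : P.γ - 1 ≠ 0 := by linarith [hP.one_lt_γ]
  have : r ^ (P.γ - 1) = r ^ P.γ / r := Real.rpow_sub_one hr.ne' _
  simp only [pressure, potential, dPotential, this]
  field_simp

/-- Homogeneity of the power reduces the two-variable estimate to a one-variable one in ρ/r. -/
lemma relPotential_eq (hP : P.Valid) {ρ r : ℝ} (hρ : 0 ≤ ρ) (hr : 0 < r) : relPotential P ρ r
    = P.a / (P.γ - 1) * r ^ P.γ * ((ρ / r) ^ P.γ - 1 - P.γ * (ρ / r - 1)) := by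
  have h1 : P.γ - 1 ≠ 0 := by linarith [hP.one_lt_γ]
  have h2 : r ^ (P.γ - 1) = r ^ P.γ / r := Real.rpow_sub_one hr.ne' _
  have h3 : r ^ P.γ ≠ 0 := (Real.rpow_pos_of_pos hr _).ne'
  simp only [relPotential, potential, dPotential, h2, Real.div_rpow hρ hr.le]
  field_simp
  ring

/-- The relative potential controls the square of ρ − r only for moderate densities; for large ρ,
where ρ^γ may grow slower than ρ², it is used to control ρ itself. -/
lemma exists_relPotential_bound (hP : P.Valid) {c R : ℝ} (hc : 0 < c) : ∃ C > 0, ∀ r ∈ Icc c R, ∀ ρ, 0 ≤ ρ →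
    (ρ ≤ 2 * r → (ρ - r) ^ 2 ≤ C * relPotential P ρ r) ∧
      (2 * r ≤ ρ → ρ ≤ C * relPotential P ρ r) := by
  obtain ⟨κ, hκ, h1, h2⟩ := exists_quantitative_bernoulli hP.one_lt_γ
  have hγ : 0 < P.γ - 1 := by linarith [hP.one_lt_γ]
  set A := P.a / (P.γ - 1) * c ^ P.γ
  have hA : 0 < A := mul_pos (div_pos hP.a_pos hγ) (Real.rpow_pos_of_pos hc _)
  -- A bounds the prefactor of the relative potential from below. The terms R² and |R| undo the
  -- scaling in (ρ − r)² = r²(t − 1)² and ρ = r t; no sign of R is assumed yet, as the interval may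
  -- be empty.
  refine ⟨(R ^ 2 + |R| + 1) / (A * κ), by positivity, fun r hr ρ hρ => ?_⟩
  have hr0 : 0 < r := hc.trans_le hr.1
  have hR : 0 < R := hr0.trans_le hr.2
  rw [relPotential_eq hP hρ hr0, abs_of_pos hR]
  set t := ρ / r
  have hρt : ρ = r * t := by simp only [t]; field_simp
  set f := t ^ P.γ - 1 - P.γ * (t - 1)
  have hAr : A ≤ P.a / (P.γ - 1) * r ^ P.γ :=
    mul_le_mul_of_nonneg_left (Real.rpow_le_rpow hc.le hr.1 (by linarith [hP.one_lt_γ]))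
      (div_pos hP.a_pos hγ).le
  have ht0 : 0 ≤ t := by positivity
  have main : ∀ X s, 0 ≤ X → κ * s ≤ f → X ≤ (R ^ 2 + R + 1) * s →
      0 ≤ s → X ≤ (R ^ 2 + R + 1) / (A * κ) * (P.a / (P.γ - 1) * r ^ P.γ * f) := by
    intro X s hX hs hXs hs0
    rw [div_mul_eq_mul_div, le_div_iff₀ (by positivity)]
    have hf : 0 ≤ f := (by positivity : 0 ≤ κ * s).trans hs
    calc X * (A * κ) ≤ (R ^ 2 + R + 1) * s * (A * κ) := by gcongr
      _ = (R ^ 2 + R + 1) * (A * (κ * s)) := by ring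
      _ ≤ (R ^ 2 + R + 1) * (P.a / (P.γ - 1) * r ^ P.γ * f) :=
        mul_le_mul_of_nonneg_left (mul_le_mul hAr hs (by positivity) (hA.le.trans hAr))
          (by positivity)
  constructor
  · intro h
    have ht2 : t ≤ 2 := by rw [hρt] at h; nlinarith
    refine main _ ((t - 1) ^ 2) (by positivity) (h1 t ⟨ht0, ht2⟩) ?_ (by positivity)
    have : (ρ - r) ^ 2 = r ^ 2 * (t - 1) ^ 2 := by rw [hρt]; ring
    rw [this]
    have : r ^ 2 ≤ R ^ 2 := pow_le_pow_left₀ hr0.le hr.2 2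
    gcongr
    linarith
  · intro h
    have ht2 : 2 ≤ t := by rw [hρt] at h; nlinarith
    refine main _ t hρ (h2 t ht2) ?_ ht0
    rw [hρt]
    gcongr
    nlinarith [hr.2]

lemma relPotential_nonneg (hP : P.Valid) {ρ r : ℝ} (hρ : 0 ≤ ρ) (hr : 0 < r) : 0 ≤ relPotential P ρ r := by
  obtain ⟨C, hC, h⟩ := exists_relPotential_bound hP (c := r) (R := r) hr
  obtain ⟨h1, h2⟩ := h r ⟨le_rfl, le_rfl⟩ ρ hρ
  rcases le_total ρ (2 * r) with hh | hh
  · exact nonneg_of_mul_nonneg_right ((sq_nonneg _).trans (h1 hh)) hC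
  · exact nonneg_of_mul_nonneg_right (hρ.trans (h2 hh)) hC

lemma eq_of_relPotential_eq_zero (hP : P.Valid) {ρ r : ℝ} (hρ : 0 ≤ ρ) (hr : 0 < r)
    (h0 : relPotential P ρ r = 0) : ρ = r := by
  obtain ⟨C, hC, h⟩ := exists_relPotential_bound hP (c := r) (R := r) hr
  obtain ⟨h1, h2⟩ := h r ⟨le_rfl, le_rfl⟩ ρ hρ
  rw [h0, mul_zero] at h1 h2
  rcases le_total ρ (2 * r) with hh | hh
  · exact sub_eq_zero.1 (pow_eq_zero_iff two_ne_zero |>.1 (le_antisymm (h1 hh) (sq_nonneg _)))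
  · linarith [h2 hh]

end Potential

/-- The density of the relative energy. -/
def relEnergy {d : ℕ} (P : Params) (ρ r : ℝ) (u v B b : Vec d) : ℝ :=
  1 / 2 * (ρ * ‖u - v‖ ^ 2) + 1 / 2 * ‖B - b‖ ^ 2 + relPotential P ρ r

lemma relEnergy_nonneg {d : ℕ} {P : Params} (hP : P.Valid) {ρ r : ℝ} (hρ : 0 ≤ ρ) (hr : 0 < r)
    (u v B b : Vec d) : 0 ≤ relEnergy P ρ r u v B b := by
  have := relPotential_nonneg hP hρ hr
  unfold relEnergy; positivity

lemma relEnergy_eq_zero {d : ℕ} {P : Params} (hP : P.Valid) {ρ r : ℝ} (hρ : 0 ≤ ρ) (hr : 0 < r)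
    {u v B b : Vec d} (h : relEnergy P ρ r u v B b = 0) : ρ = r ∧ u = v ∧ B = b := by
  have h1 := relPotential_nonneg hP hρ hr
  have h2 : 0 ≤ ρ * ‖u - v‖ ^ 2 := by positivity
  have h3 : 0 ≤ ‖B - b‖ ^ 2 := by positivity
  unfold relEnergy at h
  have h4 : ρ = r := eq_of_relPotential_eq_zero hP hρ hr (by linarith)
  have h5 : ρ * ‖u - v‖ ^ 2 = 0 := by linarith
  have h6 : ‖B - b‖ ^ 2 = 0 := by linarith
  refine ⟨h4, ?_, ?_⟩
  · have : ‖u - v‖ ^ 2 = 0 := (mul_eq_zero.1 h5).resolve_left (by rw [h4]; exact hr.ne')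
    exact sub_eq_zero.1 (norm_eq_zero.1 (pow_eq_zero_iff two_ne_zero |>.1 this))
  · exact sub_eq_zero.1 (norm_eq_zero.1 (pow_eq_zero_iff two_ne_zero |>.1 h6))

lemma mul_le_half_add {δ : ℝ} (hδ : 0 < δ) (a b : ℝ) :
    a * b ≤ δ / 2 * a ^ 2 + b ^ 2 / (2 * δ) := by
  have h : δ / 2 * a ^ 2 + b ^ 2 / (2 * δ) - a * b = δ / 2 * (a - b / δ) ^ 2 := by
    field_simp; ring
  have : 0 ≤ δ / 2 * (a - b / δ) ^ 2 := by positivity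
  linarith

/-- The remainder in the relative energy inequality is controlled by the relative energy, up to a
small multiple of `|u - v|²`. -/
lemma exists_remainder_bound {d : ℕ} (hd : d = 2 ∨ d = 3) {P : Params} (hP : P.Valid)
    {c R K δ : ℝ} (hc : 0 < c) (hK : 0 ≤ K) (hδ : 0 < δ) : ∃ C, 0 ≤ C ∧
    ∀ (ρ r : ℝ) (u v B b dS : Vec d) (g : Mat d) (J j : Vec 3), 0 ≤ ρ → r ∈ Icc c R →
      ‖v‖ ≤ K → ‖b‖ ≤ K → ‖dS‖ ≤ K → ‖g‖ ≤ K → |tr g| ≤ K → ‖j‖ ≤ K →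
      - P.α * ‖J - j‖ ^ 2 - ρ * inner ℝ (u - v) (mulV g (u - v))
        - tr g * (pressure P ρ - dPressure P r * (ρ - r) - pressure P r)
        + inner ℝ (J - j) (cross (pad v) (pad (B - b)))
        - inner ℝ j (cross (pad (u - v)) (pad (B - b)))
        + (ρ - r) / r * (inner ℝ j (cross (pad (u - v)) (pad b)) - inner ℝ (u - v) dS)
      ≤ C * relEnergy P ρ r u v B b + δ * ‖u - v‖ ^ 2 := by
  obtain ⟨CH, hCH, hbd⟩ := exists_relPotential_bound hP (c := c) (R := R) hc
  have hα := hP.α_pos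
  have hγ : 0 < P.γ - 1 := by linarith [hP.one_lt_γ]
  set Q := (K * K + K) / c with hQ
  have hQ0 : 0 ≤ Q := by positivity
  -- The summands are the contributions of `T1` to `T5` below, in this order. The allowance δ is
  -- split evenly between `T4` and `T5`.
  refine ⟨2 * K + K * (P.γ - 1) + K ^ 2 / (2 * P.α) + K ^ 2 / δ + Q ^ 2 / (2 * δ) * CH
    + Q * CH + Q, by positivity, ?_⟩
  intro ρ r u v B b dS g J j hρ hr hv hb hdS hg htr hj
  have hr0 : 0 < r := hc.trans_le hr.1
  have hH := relPotential_nonneg hP hρ hr0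
  set w := u - v
  set β := B - b
  set H := relPotential P ρ r
  have hw0 := norm_nonneg w
  have hβ0 := norm_nonneg β
  have hJ0 := norm_nonneg (J - j)
  set E := relEnergy P ρ r u v B b with hE
  have hEe : E = 1 / 2 * (ρ * ‖w‖ ^ 2) + 1 / 2 * ‖β‖ ^ 2 + H := rfl
  have p1 : 0 ≤ ρ * ‖w‖ ^ 2 := by positivity
  have p2 : 0 ≤ ‖β‖ ^ 2 := by positivity
  have E1 : ρ * ‖w‖ ^ 2 ≤ 2 * E := by linarith
  have E2 : ‖β‖ ^ 2 ≤ 2 * E := by linarith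
  have E3 : H ≤ E := by linarith
  have hE0 : 0 ≤ E := by linarith
  have T1 : -(ρ * inner ℝ w (mulV g w)) ≤ 2 * K * E := by
    have h1 := (abs_le.1 (abs_real_inner_le_norm w (mulV g w))).1
    have h2 : ‖w‖ * ‖mulV g w‖ ≤ K * ‖w‖ ^ 2 := by
      have := norm_mulV_le g w
      nlinarith [mul_le_mul_of_nonneg_right hg hw0]
    nlinarith [mul_le_mul_of_nonneg_left (h2) hρ, mul_le_mul_of_nonneg_left h1 hρ,
      mul_le_mul_of_nonneg_left E1 hK]
  have T2 : -(tr g * (pressure P ρ - dPressure P r * (ρ - r) - pressure P r))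
      ≤ K * (P.γ - 1) * E := by
    rw [pressure_sub hP]
    have h1 := (abs_le.1 htr).1
    have h2 : 0 ≤ (P.γ - 1) * H := by positivity
    have h3 : (P.γ - 1) * H ≤ (P.γ - 1) * E := by gcongr
    nlinarith [mul_le_mul_of_nonneg_right h1 h2, mul_le_mul_of_nonneg_left h3 hK]
  -- Young's inequality with parameter 2α, so that the |J − j|² part is exactly what the magnetic
  -- dissipation offers.
  have T3 : inner ℝ (J - j) (cross (pad v) (pad β)) ≤ P.α * ‖J - j‖ ^ 2
      + K ^ 2 / (2 * P.α) * E := by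
    have h1 := real_inner_le_norm (J - j) (cross (pad v) (pad β))
    have h2 := norm_cross_le (pad v) (pad β)
    rw [norm_pad hd, norm_pad hd] at h2
    have h3 : ‖J - j‖ * ‖cross (pad v) (pad β)‖ ≤ ‖J - j‖ * (K * ‖β‖) := by
      gcongr; exact h2.trans (by gcongr)
    have h4 := mul_le_half_add (δ := 2 * P.α) (by positivity) ‖J - j‖ (K * ‖β‖)
    have h4' : (K * ‖β‖) ^ 2 / (2 * (2 * P.α)) = K ^ 2 / (4 * P.α) * ‖β‖ ^ 2 := by ring
    have h5 : K ^ 2 / (4 * P.α) * ‖β‖ ^ 2 ≤ K ^ 2 / (4 * P.α) * (2 * E) := by gcongr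
    have h6 : K ^ 2 / (4 * P.α) * (2 * E) = K ^ 2 / (2 * P.α) * E := by field_simp; ring
    linarith
  have T4 : -inner ℝ j (cross (pad w) (pad β)) ≤ δ / 2 * ‖w‖ ^ 2 + K ^ 2 / δ * E := by
    have h1 := (abs_le.1 (abs_real_inner_le_norm j (cross (pad w) (pad β)))).1
    have h2 := norm_cross_le (pad w) (pad β)
    rw [norm_pad hd, norm_pad hd] at h2
    have h3 : ‖j‖ * ‖cross (pad w) (pad β)‖ ≤ K * (‖w‖ * ‖β‖) := by gcongr
    have h4 := mul_le_half_add hδ ‖w‖ (K * ‖β‖)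
    have h4' : (K * ‖β‖) ^ 2 / (2 * δ) = K ^ 2 / (2 * δ) * ‖β‖ ^ 2 := by ring
    have h5 : K ^ 2 / (2 * δ) * ‖β‖ ^ 2 ≤ K ^ 2 / (2 * δ) * (2 * E) := by gcongr
    have h6 : K ^ 2 / (2 * δ) * (2 * E) = K ^ 2 / δ * E := by field_simp
    linarith
  have T5 : (ρ - r) / r * (inner ℝ j (cross (pad w) (pad b)) - inner ℝ w dS)
      ≤ δ / 2 * ‖w‖ ^ 2 + (Q ^ 2 / (2 * δ) * CH + Q * CH + Q) * E := by
    have h1 : |inner ℝ j (cross (pad w) (pad b)) - inner ℝ w dS| ≤ (K * K + K) * ‖w‖ := by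
      have a1 := abs_real_inner_le_norm j (cross (pad w) (pad b))
      have a2 := norm_cross_le (pad w) (pad b)
      rw [norm_pad hd, norm_pad hd] at a2
      have a3 := abs_real_inner_le_norm w dS
      have a4 : ‖j‖ * ‖cross (pad w) (pad b)‖ ≤ K * (‖w‖ * K) := by
        gcongr; exact a2.trans (by gcongr)
      have a5 : ‖w‖ * ‖dS‖ ≤ ‖w‖ * K := by gcongr
      have a6 := abs_sub (inner ℝ j (cross (pad w) (pad b))) (inner ℝ w dS)
      linarith
    have h2 : (ρ - r) / r * (inner ℝ j (cross (pad w) (pad b)) - inner ℝ w dS)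
        ≤ Q * (|ρ - r| * ‖w‖) := by
      refine (le_abs_self _).trans ?_
      rw [abs_mul, abs_div, abs_of_pos hr0]
      calc |ρ - r| / r * |inner ℝ j (cross (pad w) (pad b)) - inner ℝ w dS|
          ≤ |ρ - r| / c * ((K * K + K) * ‖w‖) := by
            gcongr
            exact hr.1
        _ = _ := by rw [hQ]; ring
    refine h2.trans ?_
    obtain ⟨b1, b2⟩ := hbd r hr ρ hρ
    have n1 : 0 ≤ Q ^ 2 / (2 * δ) * CH * E := by positivity
    have n2 : 0 ≤ Q * CH * E := by positivity
    have n3 : 0 ≤ Q * E := by positivity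
    have n4 : 0 ≤ δ / 2 * ‖w‖ ^ 2 := by positivity
    -- For moderate densities, Young's inequality leaves (ρ − r)², controlled by the relative
    -- potential. For large ones |ρ − r| ≤ ρ and 2ρ|w| ≤ ρ|w|² + ρ, where both terms are bounded by
    -- the relative energy and no δ is spent.
    rcases le_total ρ (2 * r) with hh | hh
    · have h4 := mul_le_half_add hδ ‖w‖ (Q * |ρ - r|)
      rw [mul_pow, sq_abs, mul_div_right_comm] at h4
      have h5 : Q ^ 2 / (2 * δ) * (ρ - r) ^ 2 ≤ Q ^ 2 / (2 * δ) * (CH * E) := by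
        gcongr
        exact (b1 hh).trans (by gcongr)
      linarith
    · have h3 : |ρ - r| ≤ ρ := by rw [abs_le]; constructor <;> linarith
      have h4 : |ρ - r| * ‖w‖ ≤ ρ * ‖w‖ := by gcongr
      have h5 : ρ * ‖w‖ ≤ CH * E + E := by
        have : ρ ≤ CH * E := (b2 hh).trans (by gcongr)
        have e0 : 0 ≤ ρ * (‖w‖ - 1) ^ 2 := by positivity
        have e1 : ρ * (‖w‖ - 1) ^ 2 = ρ * ‖w‖ ^ 2 - 2 * (ρ * ‖w‖) + ρ := by ring
        linarith
      have h6 := mul_le_mul_of_nonneg_left (h4.trans h5) hQ0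
      linarith
  linarith

end

end MHD

namespace MHD
noncomputable section

/-! ### Time-dependent fields -/

section Joint

variable {d : ℕ} {F : Type*} [NormedAddCommGroup F] [NormedSpace ℝ F] {f : ℝ → Vec d → F}

lemma hasFDerivAt_slice (hf : ContDiff ℝ 1 fun z : ℝ × Vec d => f z.1 z.2) (t : ℝ) (x : Vec d) :
    HasFDerivAt (f t) ((fderiv ℝ (fun z : ℝ × Vec d => f z.1 z.2) (t, x)).comp
      (ContinuousLinearMap.inr ℝ ℝ (Vec d))) x :=
  (hf.differentiable one_ne_zero (t, x)).hasFDerivAt.comp x (hasFDerivAt_prodMk_right t x)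

lemma hasDerivAt_slice (hf : ContDiff ℝ 1 fun z : ℝ × Vec d => f z.1 z.2) (t : ℝ) (x : Vec d) :
    HasDerivAt (fun s => f s x) (fderiv ℝ (fun z : ℝ × Vec d => f z.1 z.2) (t, x) (1, 0)) t := by
  have h := (hf.differentiable one_ne_zero (t, x)).hasFDerivAt.comp t
    (hasFDerivAt_prodMk_left (𝕜 := ℝ) t x)
  exact h.hasDerivAt.congr_deriv (by simp)

lemma timeD_eq (hf : ContDiff ℝ 1 fun z : ℝ × Vec d => f z.1 z.2) (t : ℝ) (x : Vec d) :
    timeD f t x = fderiv ℝ (fun z : ℝ × Vec d => f z.1 z.2) (t, x) (1, 0) :=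
  (hasDerivAt_slice hf t x).deriv

lemma hasDerivAt_timeD (hf : ContDiff ℝ 1 fun z : ℝ × Vec d => f z.1 z.2) (t : ℝ) (x : Vec d) :
    HasDerivAt (fun s => f s x) (timeD f t x) t := by
  rw [timeD_eq hf]; exact hasDerivAt_slice hf t x

lemma contDiff_slice {n : WithTop ℕ∞} (hf : ContDiff ℝ n fun z : ℝ × Vec d => f z.1 z.2) (t : ℝ) :
    ContDiff ℝ n (f t) :=
  hf.comp (contDiff_const.prodMk contDiff_id)

lemma contDiff_timeD {n : ℕ} (hf : ContDiff ℝ (n + 1 : ℕ) fun z : ℝ × Vec d => f z.1 z.2) :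
    ContDiff ℝ n fun z : ℝ × Vec d => timeD f z.1 z.2 := by
  have h1 := hf.of_le (m := 1) (by exact_mod_cast Nat.le_add_left 1 n)
  simp only [timeD_eq h1]
  exact (hf.fderiv_right (m := n) (by norm_cast)).clm_apply contDiff_const

lemma contDiff_fderiv_slice {n : ℕ}
    (hf : ContDiff ℝ (n + 1 : ℕ) fun z : ℝ × Vec d => f z.1 z.2) :
    ContDiff ℝ n fun z : ℝ × Vec d => fderiv ℝ (f z.1) z.2 := by
  have h1 := hf.of_le (m := 1) (by exact_mod_cast Nat.le_add_left 1 n)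
  have h : ∀ z : ℝ × Vec d, fderiv ℝ (f z.1) z.2 = (fderiv ℝ (fun z : ℝ × Vec d => f z.1 z.2) z).comp
      (ContinuousLinearMap.inr ℝ ℝ (Vec d)) := fun z => (hasFDerivAt_slice h1 z.1 z.2).fderiv
  simp only [h]
  exact (hf.fderiv_right (m := n) (by norm_cast)).clm_comp contDiff_const

end Joint

section Joint

variable {d : ℕ}

lemma contDiff_joint_partialD {n : ℕ} {f : ℝ → Vec d → ℝ}
    (hf : ContDiff ℝ (n + 1 : ℕ) fun z : ℝ × Vec d => f z.1 z.2) (j : Fin d) :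
    ContDiff ℝ n fun z : ℝ × Vec d => partialD j (f z.1) z.2 :=
  (contDiff_fderiv_slice hf).clm_apply contDiff_const

lemma contDiff_joint_jacobian {n : ℕ} {v : ℝ → Vec d → Vec d}
    (hv : ContDiff ℝ (n + 1 : ℕ) fun z : ℝ × Vec d => v z.1 z.2) :
    ContDiff ℝ n fun z : ℝ × Vec d => jacobian (v z.1) z.2 :=
  contDiff_euclidean.2 fun p =>
    contDiff_joint_partialD (f := fun t x => v t x p.1) (contDiff_apply_coord hv p.1) p.2

lemma contDiff_joint_divergence {n : ℕ} {v : ℝ → Vec d → Vec d}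
    (hv : ContDiff ℝ (n + 1 : ℕ) fun z : ℝ × Vec d => v z.1 z.2) :
    ContDiff ℝ n fun z : ℝ × Vec d => divergence (v z.1) z.2 :=
  ContDiff.sum fun i _ =>
    contDiff_joint_partialD (f := fun t x => v t x i) (contDiff_apply_coord hv i) i

lemma contDiff_joint_matDivergence {n : ℕ} {A : ℝ → Vec d → Mat d}
    (hA : ContDiff ℝ (n + 1 : ℕ) fun z : ℝ × Vec d => A z.1 z.2) :
    ContDiff ℝ n fun z : ℝ × Vec d => matDivergence (A z.1) z.2 :=
  contDiff_euclidean.2 fun i => by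
    change ContDiff ℝ n fun z : ℝ × Vec d => ∑ j, partialD j (fun y => A z.1 y (i, j)) z.2
    exact ContDiff.sum fun j _ =>
      contDiff_joint_partialD (f := fun t x => A t x (i, j)) (contDiff_apply_coord hA (i, j)) j

lemma contDiff_joint_partialD₃ {n : ℕ} {f : ℝ → Vec d → ℝ}
    (hf : ContDiff ℝ (n + 1 : ℕ) fun z : ℝ × Vec d => f z.1 z.2) (j : Fin 3) :
    ContDiff ℝ n fun z : ℝ × Vec d => partialD₃ j (f z.1) z.2 := by
  unfold partialD₃
  split_ifs
  · exact contDiff_joint_partialD hf _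
  · exact contDiff_const

lemma contDiff_joint_curl {n : ℕ} {F : ℝ → Vec d → Vec 3}
    (hF : ContDiff ℝ (n + 1 : ℕ) fun z : ℝ × Vec d => F z.1 z.2) :
    ContDiff ℝ n fun z : ℝ × Vec d => curl (F z.1) z.2 := by
  have h := fun i j => contDiff_joint_partialD₃ (f := fun t x => F t x i)
    (contDiff_apply_coord hF i) j
  refine contDiff_euclidean.2 fun i => ?_
  fin_cases i
  · exact (h 2 1).sub (h 1 2)
  · exact (h 0 2).sub (h 2 0)
  · exact (h 1 0).sub (h 0 1)

lemma contDiff_stress (P : Params) {n : WithTop ℕ∞} {E : Type*} [NormedAddCommGroup E]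
    [NormedSpace ℝ E] {A : E → Mat d} (hA : ContDiff ℝ n A) :
    ContDiff ℝ n fun x => stress P (A x) := by
  have h := contDiff_apply_coord hA
  have ht : ContDiff ℝ n fun x => tr (A x) := by
    unfold tr; exact ContDiff.sum fun i _ => h _
  have htr : ContDiff ℝ n fun x => transp (A x) := contDiff_euclidean.2 fun p => h (p.2, p.1)
  have hid : ∀ a : ℝ, ContDiff ℝ n fun x => (a * tr (A x)) • idMat d := fun a =>
    (contDiff_const.mul ht).smul contDiff_const
  exact (((hA.add htr).sub (hid (2 / (d : ℝ)))).const_smul P.μ).add (hid P.lam)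

lemma inner_gradient (f : Vec d → ℝ) (x v : Vec d) :
    inner ℝ v (gradient f x) = fderiv ℝ f x v := by
  rw [real_inner_comm, gradient, InnerProductSpace.toDual_symm_apply]

lemma divergence_smul {f : Vec d → ℝ} {v : Vec d → Vec d} {x : Vec d}
    (hf : DifferentiableAt ℝ f x) (hv : DifferentiableAt ℝ v x) :
    divergence (fun y => f y • v y) x = fderiv ℝ f x (v x) + f x * tr (jacobian v x) := by
  have hvi := fun i => differentiableAt_euclidean.1 hv i
  simp only [divergence, PiLp.smul_apply, smul_eq_mul, tr, jacobian_apply,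
    Domain.partialD_mul hf (hvi _), Finset.sum_add_distrib, Finset.mul_sum]
  congr 1
  have hz : v x = ∑ j, v x j • EuclideanSpace.single j (1 : ℝ) := by
    ext i; simp [Finset.sum_apply, Pi.single_apply]
  conv_rhs => rw [hz]
  simp only [map_sum, map_smul, smul_eq_mul, partialD, mul_comm]

lemma matDivergence_smul_outer {f : Vec d → ℝ} {v : Vec d → Vec d} {x : Vec d}
    (hf : DifferentiableAt ℝ f x) (hv : DifferentiableAt ℝ v x) :
    matDivergence (fun y => f y • outer (v y) (v y)) x
      = divergence (fun y => f y • v y) x • v x + f x • mulV (jacobian v x) (v x) := by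
  have hvi := fun i => differentiableAt_euclidean.1 hv i
  ext i
  have e : ∀ j, (fun y => (f y • outer (v y) (v y)) (i, j)) = fun y => v y i * (f y * v y j) :=
    fun j => by ext y; simp [outer]; ring
  have e' : matDivergence (fun y => f y • outer (v y) (v y)) x i
      = ∑ j, (partialD j (fun y => v y i) x * (f x * v x j)
        + v x i * partialD j (fun y => f y * v y j) x) := by
    change ∑ j, partialD j (fun y => (f y • outer (v y) (v y)) (i, j)) x = _
    exact Finset.sum_congr rfl fun j _ => by
      rw [e, Domain.partialD_mul (hvi i) (hf.fun_mul (hvi j))]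
  rw [e']
  simp only [divergence, PiLp.add_apply, PiLp.smul_apply, smul_eq_mul, mulV, jacobian_apply,
    Finset.sum_add_distrib, Finset.sum_mul, Finset.mul_sum]
  rw [add_comm]
  congr 1
  · exact Finset.sum_congr rfl fun j _ => by ring
  · exact Finset.sum_congr rfl fun j _ => by ring

lemma curl_sub_smul {Φ Ψ : Vec d → Vec 3} {x : Vec d} (hΦ : DifferentiableAt ℝ Φ x)
    (hΨ : DifferentiableAt ℝ Ψ x) (a : ℝ) :
    curl (fun y => Φ y - a • Ψ y) x = curl Φ x - a • curl Ψ x := by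
  have h1 := fun i => differentiableAt_euclidean.1 hΦ i
  have h2 := fun i => differentiableAt_euclidean.1 hΨ i
  have h : ∀ j i, partialD₃ j (fun y => (Φ y - a • Ψ y) i) x
      = partialD₃ j (fun y => Φ y i) x - a * partialD₃ j (fun y => Ψ y i) x := fun j i => by
    unfold partialD₃
    split_ifs with hj
    · simp only [PiLp.sub_apply, PiLp.smul_apply, smul_eq_mul, partialD]
      rw [fderiv_fun_sub (h1 i) ((h2 i).const_mul a), fderiv_const_mul (h2 i)]
      rfl
    · ring
  ext i
  fin_cases i
  · change partialD₃ 1 _ x - partialD₃ 2 _ x = (_ - _) - a * (_ - _)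
    rw [h, h]; ring
  · change partialD₃ 2 _ x - partialD₃ 0 _ x = (_ - _) - a * (_ - _)
    rw [h, h]; ring
  · change partialD₃ 0 _ x - partialD₃ 1 _ x = (_ - _) - a * (_ - _)
    rw [h, h]; ring

end Joint

/-! ### Positivity of the density of a classical solution -/

section Positivity

variable {d : ℕ} {D : Domain d}

lemma Domain.forall_closure_cell {p : Vec d → Prop} (hp : ∀ x ∈ D.closedCell, p x)
    (hper : D.Periodic p) : ∀ x ∈ closure D.cell, p x := by
  intro x hx
  cases D with
  | wall Ω => exact hp x hx
  | torus =>
    obtain ⟨y, hy, h⟩ := Domain.exists_mem_cell_eq (F := Prop) x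
    exact (h p hper) ▸ hp y hy

/-- A minimum over the closed domain is either a local minimum in the whole space, hence critical,
or lies on the boundary, where v vanishes. -/
lemma Domain.fderiv_apply_eq_zero_of_isMin (hD : D.Admissible) {f : Vec d → ℝ} {v : Vec d → Vec d}
    (hp : D.Periodic f) (hv : D.ZeroOnBoundary v) {x : Vec d} (hx : x ∈ closure D.cell)
    (hmin : ∀ y ∈ closure D.cell, f x ≤ f y) : fderiv ℝ f x (v x) = 0 := by
  cases D with
  | torus =>
    have : IsLocalMin f x := .of_forall fun z => by
      obtain ⟨y, hy, h⟩ := Domain.exists_mem_cell_eq (F := ℝ) z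
      rw [← h f hp]; exact hmin y (subset_closure hy)
    rw [this.fderiv_eq_zero]; rfl
  | wall Ω =>
    by_cases hxΩ : x ∈ Ω
    · have : IsLocalMin f x := by
        filter_upwards [hD.1.mem_nhds hxΩ] with z hz using hmin z (subset_closure hz)
      rw [this.fderiv_eq_zero]; rfl
    · rw [hv x (by rw [hD.1.frontier_eq]; exact ⟨hx, hxΩ⟩), map_zero]

lemma deriv_nonpos_of_left_ge {f : ℝ → ℝ} {f' t a : ℝ} (hf : HasDerivAt f f' t) (hat : a < t)
    (h : ∀ s ∈ Ico a t, f t ≤ f s) : f' ≤ 0 := by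
  have h1 := (hasDerivAt_iff_tendsto_slope_left_right.1 hf).1
  refine le_of_tendsto h1 ?_
  filter_upwards [Ico_mem_nhdsLT hat] with s hs
  rw [slope_def_field]
  exact div_nonpos_of_nonneg_of_nonpos (sub_nonneg.2 (h s hs)) (by linarith [hs.2])

lemma closure_Ioo_prod_cell {T : ℝ} (hT : 0 < T) :
    closure (Ioo 0 T ×ˢ D.cell) = Icc 0 T ×ˢ closure D.cell := by
  rw [closure_prod_eq, closure_Ioo hT.ne]

/-- An identity between continuous functions on the open cylinder extends to the closed one. -/
lemma eq_on_closed_cylinder {T : ℝ} (hT : 0 < T) {q : ℝ × Vec d → ℝ} (hq : Continuous q)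
    (h : ∀ t ∈ Ioo 0 T, ∀ x ∈ D.cell, q (t, x) = 0) :
    ∀ t ∈ Icc 0 T, ∀ x ∈ closure D.cell, q (t, x) = 0 := fun t ht x hx => by
  have hcl : closure (Ioo 0 T ×ˢ D.cell) ⊆ {z | q z = 0} :=
    closure_minimal (fun z hz => h z.1 hz.1 z.2 hz.2) (isClosed_eq hq continuous_const)
  rw [closure_Ioo_prod_cell hT] at hcl
  exact hcl ⟨ht, hx⟩

variable {P : Params} {T : ℝ} {ρ₀ : Vec d → ℝ} {m₀ B₀ : Vec d → Vec d} {ρ : ℝ → Vec d → ℝ}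
  {u B : ℝ → Vec d → Vec d}

lemma IsClassicalSolution.mass_nonconservative (h : IsClassicalSolution P D T ρ₀ m₀ B₀ ρ u B)
    {t : ℝ} (ht : t ∈ Ioo 0 T) {x : Vec d} (hx : x ∈ D.cell) :
    timeD ρ t x + (fderiv ℝ (ρ t) x (u t x) + ρ t x * tr (jacobian (u t) x)) = 0 := by
  have h1 := (contDiff_slice h.ρ_reg.1 t).differentiable one_ne_zero x
  have h2 := (contDiff_slice h.u_reg.1 t).differentiable two_ne_zero x
  rw [← divergence_smul h1 h2]
  exact h.mass t ht x hx

/-- The density of a classical solution is bounded below by a positive constant. -/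
theorem IsClassicalSolution.exists_pos_lt (hD : D.Admissible) (hT : 0 < T)
    (h : IsClassicalSolution P D T ρ₀ m₀ B₀ ρ u B) (hρ₀ : ∀ x ∈ D.closedCell, 0 < ρ₀ x) :
    ∃ c > 0, ∀ t ∈ Icc 0 T, ∀ x ∈ closure D.cell, c < ρ t x := by
  have hK := Domain.isCompact_closure_cell hD
  have hρc : Continuous fun z : ℝ × Vec d => ρ z.1 z.2 := h.ρ_reg.1.continuous
  have hu1 : ContDiff ℝ 1 fun z : ℝ × Vec d => u z.1 z.2 := h.u_reg.1.of_le one_le_two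
  have hdiv : Continuous fun z : ℝ × Vec d => tr (jacobian (u z.1) z.2) :=
    (contDiff_joint_divergence (n := 0) hu1).continuous
  have hpos0 : ∀ x ∈ closure D.cell, 0 < ρ 0 x :=
    Domain.forall_closure_cell (fun x hx => by rw [h.initial_ρ x hx]; exact hρ₀ x hx)
      ((h.ρ_reg.2 0).comp fun s => 0 < s)
  rcases (closure D.cell).eq_empty_or_nonempty with hne | hne
  · exact ⟨1, one_pos, fun t _ x hx => by simp [hne] at hx⟩
  obtain ⟨xm, hxm, hmin⟩ := hK.exists_isMinOn hne
    (hρc.comp (Continuous.prodMk_right (0 : ℝ))).continuousOn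
  set c := ρ 0 xm with hc
  have hc0 : 0 < c := hpos0 xm hxm
  obtain ⟨Λ, hΛ⟩ := (isCompact_Icc.prod hK).exists_bound_of_continuousOn
    (s := Icc 0 T ×ˢ closure D.cell) hdiv.continuousOn
  set L := |Λ| + 1
  -- The exponential weight, with rate above sup |div u|, makes the time derivative of w strictly
  -- positive at a first zero, where it should be nonpositive. The level c/2 makes w positive at
  -- time 0.
  set w : ℝ × Vec d → ℝ := fun z => Real.exp (L * z.1) * ρ z.1 z.2 - c / 2 with hw
  have hwc : Continuous w := by fun_prop
  have key : ∀ t ∈ Icc 0 T, ∀ x ∈ closure D.cell, 0 < w (t, x) := by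
    by_contra hcon
    push Not at hcon
    obtain ⟨t₁, ht₁, x₁, hx₁, hw₁⟩ := hcon
    -- The points with w ≤ 0 in the closed cylinder form a compact set, so there is an earliest one.
    have hA : IsCompact ((Icc 0 T ×ˢ closure D.cell) ∩ {z | w z ≤ 0}) :=
      (isCompact_Icc.prod hK).inter_right (isClosed_le hwc continuous_const)
    obtain ⟨⟨t, x⟩, ⟨⟨ht, hx⟩, hwt⟩, hfirst⟩ := hA.exists_isMinOn ⟨(t₁, x₁), ⟨ht₁, hx₁⟩, hw₁⟩
      continuous_fst.continuousOn
    simp only [Set.mem_ofPred_eq] at hwt ht hx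
    have hbefore : ∀ s ∈ Ico 0 t, ∀ y ∈ closure D.cell, 0 < w (s, y) := fun s hs y hy => by
      by_contra hle
      have := hfirst (show (s, y) ∈ _ from ⟨⟨⟨hs.1, hs.2.le.trans ht.2⟩, hy⟩, not_lt.1 hle⟩)
      exact absurd hs.2 (not_lt.2 this)
    have ht0 : 0 < t := by
      rcases ht.1.eq_or_lt with h0 | h0
      · exfalso
        have h1 : c ≤ ρ 0 x := hmin hx
        simp only [hw, ← h0, mul_zero, Real.exp_zero, one_mul] at hwt
        linarith
      · exact h0
    have hat : ∀ y ∈ closure D.cell, 0 ≤ w (t, y) := fun y hy => by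
      have h1 : Tendsto (fun s => w (s, y)) (𝓝[<] t) (𝓝 (w (t, y))) :=
        ((hwc.comp (Continuous.prodMk_left y)).tendsto t).mono_left nhdsWithin_le_nhds
      refine ge_of_tendsto h1 ?_
      filter_upwards [Ico_mem_nhdsLT ht0] with s hs using (hbefore s hs y hy).le
    have hwz : w (t, x) = 0 := le_antisymm hwt (hat x hx)
    have hexp : 0 < Real.exp (L * t) := Real.exp_pos _
    -- At the touching time, x minimises the density over the closed domain, which kills the
    -- transport term.
    have hspace : fderiv ℝ (ρ t) x (u t x) = 0 := by
      refine Domain.fderiv_apply_eq_zero_of_isMin hD (h.ρ_reg.2 t) (h.u_bc t ht) hx fun y hy => ?_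
      have h1 := hat y hy
      rw [← hwz] at h1
      simp only [hw] at h1
      exact le_of_mul_le_mul_left (by linarith) hexp
    -- The touching point may lie on the lateral boundary or at t = T, so the equation is used up to
    -- the closed cylinder by continuity.
    have hmass : timeD ρ t x + (fderiv ℝ (ρ t) x (u t x) + ρ t x * tr (jacobian (u t) x)) = 0 := by
      refine eq_on_closed_cylinder hT (D := D) (q := fun z => timeD ρ z.1 z.2
        + (fderiv ℝ (ρ z.1) z.2 (u z.1 z.2) + ρ z.1 z.2 * tr (jacobian (u z.1) z.2))) ?_
        (fun s hs y hy => h.mass_nonconservative hs hy) t ht x hx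
      exact (contDiff_timeD (n := 0) h.ρ_reg.1).continuous.add
        (((contDiff_fderiv_slice (n := 0) h.ρ_reg.1).continuous.clm_apply h.u_reg.1.continuous).add
        (hρc.mul hdiv))
    have hderiv : HasDerivAt (fun s => w (s, x))
        (Real.exp (L * t) * L * ρ t x + Real.exp (L * t) * timeD ρ t x) t := by
      have h1 : HasDerivAt (fun s => Real.exp (L * s)) (Real.exp (L * t) * L) t := by
        simpa using ((hasDerivAt_id t).const_mul L).exp
      exact (h1.fun_mul (hasDerivAt_timeD h.ρ_reg.1 t x)).sub_const _
    have hle := deriv_nonpos_of_left_ge hderiv ht0 fun s hs => by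
      rw [hwz]; exact (hbefore s hs x hx).le
    have hρpos : 0 < ρ t x := by
      have : Real.exp (L * t) * ρ t x = c / 2 := by simp only [hw] at hwz; linarith
      exact pos_of_mul_pos_right (by rw [this]; positivity) hexp.le
    have hdivle := hΛ (t, x) ⟨ht, hx⟩
    rw [Real.norm_eq_abs] at hdivle
    have h2 : tr (jacobian (u t) x) < L :=
      (le_abs_self _).trans_lt (hdivle.trans_lt (by simp only [L]; linarith [le_abs_self Λ]))
    have h3 : timeD ρ t x = -(ρ t x * tr (jacobian (u t) x)) := by linarith
    rw [h3] at hle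
    have h4 : 0 < Real.exp (L * t) * (ρ t x * (L - tr (jacobian (u t) x))) := by
      have : 0 < L - tr (jacobian (u t) x) := by linarith
      positivity
    linarith
  refine ⟨Real.exp (-(L * T)) * (c / 2), by positivity, fun t ht x hx => ?_⟩
  have h1 := key t ht x hx
  simp only [hw] at h1
  have hL : 0 ≤ L := by positivity
  have h2 : Real.exp (L * t) ≤ Real.exp (L * T) := Real.exp_le_exp.2 (by gcongr; exact ht.2)
  rw [Real.exp_neg, inv_mul_lt_iff₀ (Real.exp_pos _)]
  have h3 : 0 < ρ t x := by
    refine pos_of_mul_pos_right (b := ρ t x) (a := Real.exp (L * t)) ?_ (Real.exp_pos _).le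
    linarith
  nlinarith

end Positivity

end

end MHD

namespace MHD
noncomputable section

/-! ### The strong solution with a globally positive density -/

/-- A smooth function with values in `[c / 2, ∞)` that is the identity on `[c, ∞)`. -/
def smoothFloor (c s : ℝ) : ℝ :=
  c / 2 + (s - c / 2) * Real.smoothTransition ((s - c / 2) / (c / 2))

lemma contDiff_smoothFloor (c : ℝ) {n : ℕ∞} : ContDiff ℝ n (smoothFloor c) := by
  unfold smoothFloor
  exact contDiff_const.add ((contDiff_id.sub contDiff_const).mul
    (Real.smoothTransition.contDiff.comp ((contDiff_id.sub contDiff_const).div_const _)))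

lemma smoothFloor_of_le {c s : ℝ} (hc : 0 < c) (hs : c ≤ s) : smoothFloor c s = s := by
  unfold smoothFloor
  rw [Real.smoothTransition.one_of_one_le ((one_le_div (by positivity)).2 (by linarith))]
  ring

lemma le_smoothFloor {c : ℝ} (hc : 0 < c) (s : ℝ) : c / 2 ≤ smoothFloor c s := by
  unfold smoothFloor
  rcases le_total s (c / 2) with h | h
  · rw [Real.smoothTransition.zero_of_nonpos
      (div_nonpos_of_nonpos_of_nonneg (by linarith) (by positivity))]
    linarith
  · have := mul_nonneg (sub_nonneg.2 h) (Real.smoothTransition.nonneg ((s - c / 2) / (c / 2)))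
    linarith

variable {d : ℕ} {D : Domain d}

lemma hasDerivAt_pressure (P : Params) {r : ℝ} (hr : 0 < r) :
    HasDerivAt (pressure P) (dPressure P r) r := by
  have := (Real.hasDerivAt_rpow_const (p := P.γ) (.inl hr.ne')).const_mul P.a
  exact this.congr_deriv (by unfold dPressure; ring)

lemma hasDerivAt_dPotential {P : Params} (hP : P.Valid) {r : ℝ} (hr : 0 < r) :
    HasDerivAt (dPotential P) (ddPotential P r) r := by
  have h1 : P.γ - 1 ≠ 0 := (sub_pos.2 hP.one_lt_γ).ne'
  have := (Real.hasDerivAt_rpow_const (p := P.γ - 1) (.inl hr.ne')).const_mul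
    (P.a * P.γ / (P.γ - 1))
  refine this.congr_deriv ?_
  unfold ddPotential
  rw [show P.γ - 1 - 1 = P.γ - 2 by ring]
  field_simp

lemma ddPotential_mul (P : Params) {r : ℝ} (hr : 0 < r) :
    ddPotential P r * r = dPressure P r := by
  unfold ddPotential dPressure
  rw [show P.γ - 1 = P.γ - 2 + 1 by ring, Real.rpow_add_one hr.ne']
  ring

/-- The equations of a classical solution with positive density in non-conservative form. -/
structure StrongSolution (P : Params) (D : Domain d) (T c : ℝ) (r : ℝ → Vec d → ℝ)
    (u b : ℝ → Vec d → Vec d) : Prop where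
  r_reg : ClosedCk D 1 r
  u_reg : ClosedCk D 2 u
  b_reg : ClosedCk D 2 b
  c_pos : 0 < c
  le_r : ∀ t x, c ≤ r t x
  u_bc : ∀ t ∈ Icc 0 T, D.ZeroOnBoundary (u t)
  b_bc : ∀ t ∈ Icc 0 T, D.NoTangentialPart (b t)
  mass : ∀ t ∈ Ioo 0 T, ∀ x ∈ D.cell, timeD r t x + inner ℝ (u t x) (gradient (r t) x)
    + r t x * tr (jacobian (u t) x) = 0
  momentum : ∀ t ∈ Ioo 0 T, ∀ x ∈ D.cell,
    r t x • (timeD u t x + mulV (jacobian (u t) x) (u t x))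
        + dPressure P (r t x) • gradient (r t) x
      = matDivergence (fun y => stress P (jacobian (u t) y)) x
        + trunc (cross (curl (fun y => pad (b t y)) x) (pad (b t x)))
  induction : ∀ t ∈ Ioo 0 T, ∀ x ∈ D.cell,
    pad (timeD b t x) = curl (fun y => cross (pad (u t y)) (pad (b t y))
      - P.α • curl (fun y => pad (b t y)) y) x

lemma StrongSolution.r_pos {P : Params} {T c : ℝ} {r : ℝ → Vec d → ℝ} {u b : ℝ → Vec d → Vec d}
    (h : StrongSolution P D T c r u b) (t : ℝ) (x : Vec d) : 0 < r t x :=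
  h.c_pos.trans_le (h.le_r t x)

/-- The two terms in which the density is differentiated add up to the continuity equation times u.
-/
lemma matDivergence_smul_outer_add_timeD {ρ : ℝ → Vec d → ℝ} {u : ℝ → Vec d → Vec d}
    (hρ : ContDiff ℝ 1 fun z : ℝ × Vec d => ρ z.1 z.2)
    (hu : ContDiff ℝ 1 fun z : ℝ × Vec d => u z.1 z.2) {t : ℝ} {x : Vec d}
    (hmass : timeD ρ t x + divergence (fun y => ρ t y • u t y) x = 0) :
    timeD (fun s y => ρ s y • u s y) t x + matDivergence (fun y => ρ t y • outer (u t y) (u t y)) x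
      = ρ t x • (timeD u t x + mulV (jacobian (u t) x) (u t x)) := by
  have e1 : timeD (fun s y => ρ s y • u s y) t x = ρ t x • timeD u t x + timeD ρ t x • u t x :=
    ((hasDerivAt_timeD hρ t x).fun_smul (hasDerivAt_timeD hu t x)).deriv
  rw [e1, matDivergence_smul_outer ((contDiff_slice hρ t).differentiable one_ne_zero x)
    ((contDiff_slice hu t).differentiable one_ne_zero x), smul_add]
  rw [eq_neg_of_add_eq_zero_left hmass]
  module

/-- On the closed cylinder the density exceeds some c > 0, but its extension to the whole space may
vanish. Composition with the smooth floor changes nothing there, nor, the inequality being strict,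
near interior points, so the equations survive. Powers of the new density are of class C¹
everywhere. -/
theorem IsClassicalSolution.exists_strongSolution {P : Params} {T : ℝ} {ρ₀ : Vec d → ℝ}
    {m₀ B₀ : Vec d → Vec d} {ρ : ℝ → Vec d → ℝ} {u B : ℝ → Vec d → Vec d} (hD : D.Admissible)
    (hT : 0 < T) (h : IsClassicalSolution P D T ρ₀ m₀ B₀ ρ u B)
    (hρ₀ : ∀ x ∈ D.closedCell, 0 < ρ₀ x) :
    ∃ c r, StrongSolution P D T c r u B ∧ ∀ t ∈ Icc 0 T, ∀ x ∈ closure D.cell, r t x = ρ t x := by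
  obtain ⟨c, hc, hlt⟩ := h.exists_pos_lt hD hT hρ₀
  have hreg : ContDiff ℝ 1 fun z : ℝ × Vec d => smoothFloor c (ρ z.1 z.2) :=
    (contDiff_smoothFloor (n := 1) c).comp h.ρ_reg.1
  have hu1 : ContDiff ℝ 1 fun z : ℝ × Vec d => u z.1 z.2 := h.u_reg.1.of_le one_le_two
  have heq : ∀ t ∈ Icc 0 T, ∀ x ∈ closure D.cell, smoothFloor c (ρ t x) = ρ t x :=
    fun t ht x hx => smoothFloor_of_le hc (hlt t ht x hx).le
  have hnear : ∀ t ∈ Ioo 0 T, ∀ x ∈ D.cell, timeD (fun t x => smoothFloor c (ρ t x)) t x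
      = timeD ρ t x ∧ fderiv ℝ (fun x => smoothFloor c (ρ t x)) x = fderiv ℝ (ρ t) x := by
    intro t ht x hx
    have h1 := hlt t (Ioo_subset_Icc_self ht) x (subset_closure hx)
    have hev : ∀ᶠ s in 𝓝 (ρ t x), smoothFloor c s = s := by
      filter_upwards [lt_mem_nhds h1] with s hs using smoothFloor_of_le hc hs.le
    have c1 : ContinuousAt (fun s => ρ s x) t := (hasDerivAt_timeD h.ρ_reg.1 t x).continuousAt
    have c2 : ContinuousAt (ρ t) x := (contDiff_slice h.ρ_reg.1 t).continuous.continuousAt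
    have e1 : (fun s => smoothFloor c (ρ s x)) =ᶠ[𝓝 t] fun s => ρ s x := c1.eventually hev
    have e2 : (fun y => smoothFloor c (ρ t y)) =ᶠ[𝓝 x] ρ t := c2.eventually hev
    exact ⟨e1.deriv_eq, e2.fderiv_eq⟩
  refine ⟨c / 2, fun t x => smoothFloor c (ρ t x), ⟨⟨hreg, fun t => ?_⟩, h.u_reg, h.B_reg,
    by positivity, fun t x => le_smoothFloor hc _, h.u_bc, h.B_bc, ?_, ?_, ?_⟩, heq⟩
  · exact (h.ρ_reg.2 t).comp (smoothFloor c)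
  · intro t ht x hx
    obtain ⟨e1, e2⟩ := hnear t ht x hx
    rw [e1, inner_gradient, e2, heq t (Ioo_subset_Icc_self ht) x (subset_closure hx), add_assoc]
    exact h.mass_nonconservative ht hx
  · intro t ht x hx
    obtain ⟨-, e2⟩ := hnear t ht x hx
    have hr := heq t (Ioo_subset_Icc_self ht) x (subset_closure hx)
    have hpos := hc.trans (hlt t (Ioo_subset_Icc_self ht) x (subset_closure hx))
    have e3 : gradient (fun x => smoothFloor c (ρ t x)) x = gradient (ρ t) x := by
      unfold gradient; rw [e2]
    have e4 : gradient (fun y => pressure P (ρ t y)) x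
        = dPressure P (ρ t x) • gradient (ρ t) x := by
      have h1 := ((contDiff_slice h.ρ_reg.1 t).differentiable one_ne_zero x).hasFDerivAt
      have h2 : HasFDerivAt (fun y => pressure P (ρ t y)) (dPressure P (ρ t x) • fderiv ℝ (ρ t) x) x :=
        (hasDerivAt_pressure P hpos).comp_hasFDerivAt x h1
      unfold gradient
      rw [h2.fderiv, map_smul]
    rw [hr, e3, ← e4, ← matDivergence_smul_outer_add_timeD h.ρ_reg.1 hu1 (h.mass t ht x hx)]
    exact h.momentum t ht x hx
  · intro t ht x hx
    have hb2 := contDiff_slice h.B_reg.1 t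
    have hu2 := contDiff_slice h.u_reg.1 t
    have hcr := (contDiff_cross (contDiff_pad hu2) (contDiff_pad hb2)).differentiable two_ne_zero x
    have hcu := (contDiff_curl (n := 1) (contDiff_pad hb2)).differentiable one_ne_zero x
    rw [curl_sub_smul hcr hcu]
    exact h.induction t ht x hx

end

end MHD

namespace MHD
noncomputable section

/-! ### Approximation by compactly supported test fields -/

/-- A differentiable function has zero derivative at almost all of its zeros. -/
lemma ae_fderiv_eq_zero_of_eq_zero {E : Type*} [NormedAddCommGroup E] [NormedSpace ℝ E]
    [FiniteDimensional ℝ E] [MeasurableSpace E] [BorelSpace E] [Nontrivial E] (μ : Measure E)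
    [μ.IsAddHaarMeasure] {f : E → ℝ} (hf : Differentiable ℝ f) :
    ∀ᵐ z ∂μ, f z = 0 → fderiv ℝ f z = 0 := by
  obtain ⟨e, he⟩ := exists_ne (0 : E)
  have hs : MeasurableSet {z | f z = 0} :=
    (isClosed_eq hf.continuous continuous_const).measurableSet
  -- On the zero set the map is approximated by the linear map 0 with error constant 0, and almost
  -- everywhere on a set the derivative is as close to such a map as the constant allows. The factor
  -- e turns f into a map of E to itself.
  have ha : ApproximatesLinearOn (fun z => f z • e) (0 : E →L[ℝ] E) {z | f z = 0} 0 := by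
    intro x hx y hy
    rw [Set.mem_ofPred_eq] at hx hy
    simp [hx, hy]
  have := ha.norm_fderiv_sub_le μ hs (fun z => (fderiv ℝ f z).smulRight e)
    fun z _ => ((hf z).hasFDerivAt.smul_const e).hasFDerivWithinAt
  rw [ae_restrict_iff' hs] at this
  filter_upwards [this] with z hz h0
  have h1 : ‖(fderiv ℝ f z).smulRight e‖₊ = 0 := by simpa using hz h0
  rw [nnnorm_eq_zero] at h1
  ext w
  have h2 := DFunLike.congr_fun h1 w
  simpa [he] using h2

/-- A smooth function that vanishes on `[-1, 1]` and is the identity outside a bounded interval. -/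
def flatId (s : ℝ) : ℝ := s * Real.smoothTransition (s ^ 2 - 1)

lemma contDiff_flatId {n : ℕ∞} : ContDiff ℝ n flatId := by
  unfold flatId
  exact contDiff_id.mul (Real.smoothTransition.contDiff.comp ((contDiff_id.pow 2).sub contDiff_const))

lemma flatId_of_le {s : ℝ} (hs : |s| ≤ 1) : flatId s = 0 := by
  unfold flatId
  rw [Real.smoothTransition.zero_of_nonpos, mul_zero]
  have := (sq_le_one_iff_abs_le_one s).2 hs
  linarith

lemma flatId_of_ge {s : ℝ} (hs : 2 ≤ |s|) : flatId s = s := by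
  unfold flatId
  rw [Real.smoothTransition.one_of_one_le, mul_one]
  have : (2 : ℝ) ^ 2 ≤ s ^ 2 := by rw [← sq_abs s]; gcongr
  linarith

lemma abs_flatId_le (s : ℝ) : |flatId s| ≤ |s| := by
  unfold flatId
  rw [abs_mul, abs_of_nonneg (Real.smoothTransition.nonneg _)]
  exact mul_le_of_le_one_right (abs_nonneg s) (Real.smoothTransition.le_one _)

lemma deriv_flatId_of_gt {s : ℝ} (hs : 2 < |s|) : deriv flatId s = 1 := by
  have : flatId =ᶠ[𝓝 s] fun s => s := by
    filter_upwards [(continuous_abs.tendsto s).eventually_const_lt hs] with s hs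
    exact flatId_of_ge hs.le
  rw [this.deriv_eq, deriv_id'']

lemma exists_deriv_flatId_bound : ∃ M, 1 ≤ M ∧ ∀ s, |deriv flatId s| ≤ M := by
  have hc : Continuous (deriv flatId) := (contDiff_flatId (n := 1)).continuous_deriv le_rfl
  obtain ⟨M, hM⟩ := (isCompact_Icc (a := (-2 : ℝ)) (b := 2)).exists_bound_of_continuousOn
    hc.continuousOn
  refine ⟨max M 1, le_max_right _ _, fun s => ?_⟩
  by_cases hs : |s| ≤ 2
  · exact (hM s (abs_le.1 hs)).trans (le_max_left _ _)
  · rw [deriv_flatId_of_gt (not_le.1 hs), abs_one]; exact le_max_right _ _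

/-- Rescalings of `flatId`, which converge to the identity. -/
def flatIdSeq (n : ℕ) (s : ℝ) : ℝ := flatId ((n + 1 : ℝ) * s) / (n + 1 : ℝ)

lemma contDiff_flatIdSeq (n : ℕ) {k : ℕ∞} : ContDiff ℝ k (flatIdSeq n) := by
  unfold flatIdSeq
  exact (contDiff_flatId.comp (contDiff_const.mul contDiff_id)).div_const _

lemma hasDerivAt_flatIdSeq (n : ℕ) (s : ℝ) :
    HasDerivAt (flatIdSeq n) (deriv flatId ((n + 1 : ℝ) * s)) s := by
  have h1 : HasDerivAt flatId (deriv flatId ((n + 1 : ℝ) * s)) ((n + 1 : ℝ) * s) :=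
    ((contDiff_flatId (n := 1)).differentiable one_ne_zero _).hasDerivAt
  have h2 : HasDerivAt (fun s : ℝ => (n + 1 : ℝ) * s) (n + 1 : ℝ) s := by
    simpa using (hasDerivAt_id s).const_mul (n + 1 : ℝ)
  have hn : (n + 1 : ℝ) ≠ 0 := by positivity
  exact ((h1.comp s h2).div_const (n + 1 : ℝ)).congr_deriv (by field_simp)

lemma flatIdSeq_of_lt {n : ℕ} {s : ℝ} (hs : |s| < 1 / (n + 1 : ℝ)) : flatIdSeq n s = 0 := by
  have hn : (0 : ℝ) < n + 1 := by positivity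
  unfold flatIdSeq
  rw [flatId_of_le, zero_div]
  rw [abs_mul, abs_of_pos hn]
  rw [lt_div_iff₀ hn] at hs
  linarith

lemma abs_flatIdSeq_le (n : ℕ) (s : ℝ) : |flatIdSeq n s| ≤ |s| := by
  have hn : (0 : ℝ) < n + 1 := by positivity
  unfold flatIdSeq
  rw [abs_div, abs_of_pos hn, div_le_iff₀ hn]
  refine (abs_flatId_le _).trans ?_
  rw [abs_mul, abs_of_pos hn, mul_comm]

lemma eventually_lt_abs_mul {s : ℝ} (hs : s ≠ 0) : ∀ᶠ n : ℕ in atTop, 2 < |(n + 1 : ℝ) * s| := by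
  have h : Tendsto (fun n : ℕ => |(n + 1 : ℝ) * s|) atTop atTop := by
    simp only [abs_mul]
    refine Tendsto.atTop_mul_const (abs_pos.2 hs) (tendsto_abs_atTop_atTop.comp ?_)
    exact tendsto_atTop_add_const_right _ _ tendsto_natCast_atTop_atTop
  exact h.eventually_gt_atTop 2

lemma tendsto_flatIdSeq (s : ℝ) : Tendsto (fun n => flatIdSeq n s) atTop (𝓝 s) := by
  rcases eq_or_ne s 0 with rfl | hs
  · have : ∀ n, flatIdSeq n 0 = 0 := fun n => by simpa using abs_flatIdSeq_le n 0
    simp [this]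
  · refine tendsto_const_nhds.congr' ?_
    filter_upwards [eventually_lt_abs_mul hs] with n hn
    have : (n + 1 : ℝ) ≠ 0 := by positivity
    unfold flatIdSeq
    rw [flatId_of_ge hn.le]
    field_simp

/-- For s ≠ 0 the factor is eventually 1. Where a component s vanishes, its derivative b must vanish
as well, and `ae_fderiv_eq_zero_of_eq_zero` guarantees this almost everywhere. -/
lemma tendsto_deriv_flatId_mul {s b : ℝ} (h : s = 0 → b = 0) :
    Tendsto (fun n : ℕ => deriv flatId ((n + 1 : ℝ) * s) * b) atTop (𝓝 b) := by
  rcases eq_or_ne s 0 with hs | hs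
  · simp [hs, h hs]
  · refine tendsto_const_nhds.congr' ?_
    filter_upwards [eventually_lt_abs_mul hs] with n hn
    rw [deriv_flatId_of_gt hn, one_mul]

lemma norm_le_mul_of_abs_le {ι : Type*} [Fintype ι] {v w : EuclideanSpace ℝ ι} {M : ℝ}
    (hM : 0 ≤ M) (h : ∀ i, |v i| ≤ M * |w i|) : ‖v‖ ≤ M * ‖w‖ := by
  have e : M * ‖w‖ = ‖M • w‖ := by rw [norm_smul, Real.norm_of_nonneg hM]
  rw [e, EuclideanSpace.norm_eq, EuclideanSpace.norm_eq]
  refine Real.sqrt_le_sqrt (Finset.sum_le_sum fun i _ => ?_)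
  have := h i
  rw [Real.norm_eq_abs, PiLp.smul_apply, smul_eq_mul, Real.norm_eq_abs, abs_mul, abs_of_nonneg hM]
  gcongr

lemma hasDerivAt_coord {ι : Type*} [Fintype ι] {f : ℝ → EuclideanSpace ℝ ι}
    {f' : EuclideanSpace ℝ ι} {t : ℝ} (h : HasDerivAt f f' t) (i : ι) :
    HasDerivAt (fun s => f s i) (f' i) t :=
  (EuclideanSpace.proj (𝕜 := ℝ) i).hasFDerivAt.comp_hasDerivAt t h

variable {d : ℕ} {D : Domain d}

lemma cylMeasure_eq (D : Domain d) (T : ℝ) :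
    cylMeasure D T = volume.restrict (Ioo 0 T ×ˢ D.cell) := by
  rw [cylMeasure, timeMeasure, Domain.spaceMeasure, Measure.prod_restrict, Measure.volume_eq_prod]

lemma exists_cutoff {K U : Set (Vec d)} (hK : IsCompact K) (hU : IsOpen U) (h : K ⊆ U) :
    ∃ (θ : Vec d → ℝ) (L : Set (Vec d)), ContDiff ℝ 2 θ ∧ IsCompact L ∧ L ⊆ U ∧
      (∀ x ∈ K, θ x = 1) ∧ ∀ x ∉ L, θ x = 0 := by
  obtain ⟨L, hL, hKL, hLU⟩ := exists_compact_between hK hU h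
  obtain ⟨f, f0, f1, -⟩ := exists_contMDiffMap_zero_one_of_isClosed (n := 2)
    (modelWithCornersSelf ℝ (Vec d)) (isOpen_interior (s := L)).isClosed_compl hK.isClosed
    (disjoint_compl_left_iff_subset.2 hKL)
  exact ⟨f, L, f.contMDiff.contDiff, hL, hLU, fun x hx => f1 hx,
    fun x hx => f0 fun hx' => hx (interior_subset hx')⟩

/-- The test fields `φ n` approximate `u` together with the first derivatives. -/
structure TestApprox (D : Domain d) (T : ℝ) (u : ℝ → Vec d → Vec d)
    (φ : ℕ → ℝ → Vec d → Vec d) (K : ℝ) : Prop where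
  test : ∀ n, MomentumTest D T (φ n)
  contDiff : ∀ n, ContDiff ℝ 2 fun z : ℝ × Vec d => φ n z.1 z.2
  norm_le : ∀ n, ∀ t ∈ Icc 0 T, ∀ x ∈ closure D.cell, ‖φ n t x‖ ≤ K
  jacobian_le : ∀ n, ∀ t ∈ Icc 0 T, ∀ x ∈ closure D.cell, ‖jacobian (φ n t) x‖ ≤ K
  timeD_le : ∀ n, ∀ t ∈ Ioo 0 T, ∀ x ∈ D.cell, ‖timeD (φ n) t x‖ ≤ K
  tendsto : ∀ t ∈ Icc 0 T, ∀ x ∈ closure D.cell, Tendsto (fun n => φ n t x) atTop (𝓝 (u t x))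
  tendsto_deriv : ∀ᵐ z ∂cylMeasure D T,
    Tendsto (fun n => jacobian (φ n z.1) z.2) atTop (𝓝 (jacobian (u z.1) z.2)) ∧
      Tendsto (fun n => timeD (φ n) z.1 z.2) atTop (𝓝 (timeD u z.1 z.2))

lemma exists_norm_le_closed_cylinder (hD : D.Admissible) (T : ℝ) {F : Type*}
    [NormedAddCommGroup F] {f : ℝ × Vec d → F} (hf : Continuous f) :
    ∃ K, 0 ≤ K ∧ ∀ t ∈ Icc 0 T, ∀ x ∈ closure D.cell, ‖f (t, x)‖ ≤ K := by
  obtain ⟨K, hK⟩ := (isCompact_Icc.prod (Domain.isCompact_closure_cell hD)).exists_bound_of_continuousOn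
    (s := Icc 0 T ×ˢ closure D.cell) hf.continuousOn
  exact ⟨max K 0, le_max_right _ _, fun t ht x hx => (hK (t, x) ⟨ht, hx⟩).trans (le_max_left _ _)⟩

/-- Flattening the components of u near zero removes u near the boundary, and a further cutoff gives
compact support without entering any value on the closed cylinder. The first derivatives stay
bounded, whereas a cutoff in space alone would produce large gradients near the boundary. On the
torus u itself is admissible. -/
theorem exists_testApprox (hD : D.Admissible) {T : ℝ} {u : ℝ → Vec d → Vec d}
    (hu : ClosedCk D 2 u) (hbc : ∀ t ∈ Icc 0 T, D.ZeroOnBoundary (u t)) :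
    ∃ φ K, 0 ≤ K ∧ TestApprox D T u φ K := by
  have hu1 : ContDiff ℝ 1 fun z : ℝ × Vec d => u z.1 z.2 := hu.1.of_le one_le_two
  obtain ⟨K₁, hK₁, h1⟩ := exists_norm_le_closed_cylinder hD T hu.1.continuous
  obtain ⟨K₂, hK₂, h2⟩ := exists_norm_le_closed_cylinder hD T
    (contDiff_joint_jacobian (n := 0) hu1).continuous
  obtain ⟨K₃, hK₃, h3⟩ := exists_norm_le_closed_cylinder hD T
    (contDiff_timeD (n := 0) hu1).continuous
  obtain ⟨M, hM, hM'⟩ := exists_deriv_flatId_bound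
  have hM0 : 0 ≤ M := zero_le_one.trans hM
  cases D with
  | torus =>
    refine ⟨fun _ => u, K₁ + K₂ + K₃, by positivity, fun _ => ⟨⟨hu1, hu.2⟩, trivial⟩,
      fun _ => hu.1, fun _ t ht x hx => ?_, fun _ t ht x hx => ?_, fun _ t ht x hx => ?_,
      fun _ _ _ _ => tendsto_const_nhds,
      .of_forall fun z => ⟨tendsto_const_nhds, tendsto_const_nhds⟩⟩
    · linarith [h1 t ht x hx]
    · linarith [h2 t ht x hx]
    · linarith [h3 t (Ioo_subset_Icc_self ht) x (subset_closure hx)]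
  | wall Ω =>
    have hΩ : IsOpen Ω := hD.1
    have hcl : IsCompact (closure Ω) := Domain.isCompact_closure_cell hD
    have hcut : ∀ n : ℕ, ∃ (θ : Vec d → ℝ) (L : Set (Vec d)), ContDiff ℝ 2 θ ∧ IsCompact L ∧
        L ⊆ Ω ∧ (∀ x ∈ closure Ω, ∀ t ∈ Icc 0 T, 1 / (n + 1 : ℝ) ≤ ‖u t x‖ → θ x = 1) ∧
        (∀ x ∉ L, θ x = 0) := fun n => by
      -- The points where |u| reaches 1/(n + 1) at some time form a projection of a compact set, and
      -- they avoid the boundary because u vanishes there.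
      have hc : IsCompact (Prod.snd '' ((Icc 0 T ×ˢ closure Ω) ∩
          {z : ℝ × Vec d | 1 / (n + 1 : ℝ) ≤ ‖u z.1 z.2‖})) :=
        ((isCompact_Icc.prod hcl).inter_right
          (isClosed_le continuous_const hu.1.continuous.norm)).image continuous_snd
      obtain ⟨θ, L, a1, a2, a3, a4, a5⟩ := exists_cutoff hc hΩ (by
        rintro _ ⟨⟨t, x⟩, ⟨⟨ht, hx⟩, hle⟩, rfl⟩
        by_contra hxΩ
        rw [Set.mem_ofPred_eq, hbc t ht x (by rw [hΩ.frontier_eq]; exact ⟨hx, hxΩ⟩), norm_zero] at hle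
        have : (0 : ℝ) < 1 / (n + 1 : ℝ) := by positivity
        linarith)
      exact ⟨θ, L, a1, a2, a3, fun x hx t ht h => a4 x ⟨(t, x), ⟨⟨ht, hx⟩, h⟩, rfl⟩, a5⟩
    choose θ L hθ hLc hLΩ hθ1 hθ0 using hcut
    set ψ : ℕ → ℝ → Vec d → Vec d := fun n t x => WithLp.toLp 2 fun i => flatIdSeq n (u t x i)
      with hψ
    set φ : ℕ → ℝ → Vec d → Vec d := fun n t x => θ n x • ψ n t x with hφ
    have hψc : ∀ n, ContDiff ℝ 2 fun z : ℝ × Vec d => ψ n z.1 z.2 := fun n =>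
      contDiff_euclidean.2 fun i =>
        (contDiff_flatIdSeq n (k := 2)).comp (contDiff_apply_coord hu.1 i)
    have hφc : ∀ n, ContDiff ℝ 2 fun z : ℝ × Vec d => φ n z.1 z.2 := fun n =>
      ((hθ n).comp contDiff_snd).smul (hψc n)
    -- Where the cutoff may differ from 1, every component of u is below 1/(n + 1) and has been
    -- flattened to zero. Thus derivatives of the cutoff never show up.
    have hφψ : ∀ n, ∀ t ∈ Icc 0 T, ∀ x ∈ closure Ω, φ n t x = ψ n t x := fun n t ht x hx => by
      by_cases h : 1 / (n + 1 : ℝ) ≤ ‖u t x‖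
      · simp only [hφ, hθ1 n x hx t ht h, one_smul]
      · have : ψ n t x = 0 := by
          ext i
          exact flatIdSeq_of_lt ((PiLp.norm_apply_le (u t x) i).trans_lt (not_le.1 h))
        simp only [hφ, this, smul_zero]
    have hjac : ∀ n, ∀ t ∈ Icc 0 T, ∀ x ∈ Ω, ∀ i j, jacobian (φ n t) x (i, j)
        = deriv flatId ((n + 1 : ℝ) * u t x i) * jacobian (u t) x (i, j) := fun n t ht x hx i j => by
      have e : (fun y => φ n t y i) =ᶠ[𝓝 x] fun y => flatIdSeq n (u t y i) := by
        filter_upwards [hΩ.mem_nhds hx] with y hy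
        rw [hφψ n t ht y (subset_closure hy)]
      have hd := ((contDiff_apply_coord (contDiff_slice hu1 t) i).differentiable
        one_ne_zero x).hasFDerivAt
      have hd' : HasFDerivAt (fun y => flatIdSeq n (u t y i))
        (deriv flatId ((n + 1 : ℝ) * u t x i) • fderiv ℝ (fun y => u t y i) x) x :=
        HasDerivAt.comp_hasFDerivAt (h₂ := flatIdSeq n) x (hasDerivAt_flatIdSeq n (u t x i)) hd
      rw [jacobian_apply, jacobian_apply, partialD, e.fderiv_eq, hd'.fderiv]
      rfl
    have htime : ∀ n, ∀ t ∈ Ioo 0 T, ∀ x ∈ Ω, ∀ i, timeD (φ n) t x i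
        = deriv flatId ((n + 1 : ℝ) * u t x i) * timeD u t x i := fun n t ht x hx i => by
      have e : (fun s => φ n s x) =ᶠ[𝓝 t] fun s => ψ n s x := by
        filter_upwards [isOpen_Ioo.mem_nhds ht] with s hs
        exact hφψ n s (Ioo_subset_Icc_self hs) x (subset_closure hx)
      have hψ1 : ContDiff ℝ 1 fun z : ℝ × Vec d => ψ n z.1 z.2 := (hψc n).of_le one_le_two
      have d1 : HasDerivAt (fun s => ψ n s x i) (timeD (ψ n) t x i) t :=
        hasDerivAt_coord (hasDerivAt_timeD hψ1 t x) i
      have d2 : HasDerivAt (fun s => u s x i) (timeD u t x i) t :=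
        hasDerivAt_coord (hasDerivAt_timeD hu1 t x) i
      have d3 : HasDerivAt (fun s => flatIdSeq n (u s x i))
          (deriv flatId ((n + 1 : ℝ) * u t x i) * timeD u t x i) t :=
        HasDerivAt.comp (h₂ := flatIdSeq n) t (hasDerivAt_flatIdSeq n (u t x i)) d2
      have e2 : timeD (φ n) t x = timeD (ψ n) t x := e.deriv_eq
      rw [e2]
      exact d1.unique d3
    refine ⟨φ, M * (K₁ + K₂ + K₃), by positivity, fun n => ⟨⟨(hφc n).of_le one_le_two,
      fun _ => trivial⟩, L n, hLc n, hLΩ n, fun t _ x hx => by simp only [hφ, hθ0 n x hx, zero_smul]⟩,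
      hφc, fun n t ht x hx => ?_, fun n t ht x hx => ?_, fun n t ht x hx => ?_,
      fun t ht x hx => ?_, ?_⟩
    · rw [hφψ n t ht x hx]
      have h4 : ‖ψ n t x‖ ≤ 1 * ‖u t x‖ := norm_le_mul_of_abs_le zero_le_one fun i => by
        rw [one_mul]; exact abs_flatIdSeq_le n _
      have h5 := h1 t ht x hx
      nlinarith
    · by_cases hxΩ : x ∈ Ω
      · have h4 : ‖jacobian (φ n t) x‖ ≤ M * ‖jacobian (u t) x‖ :=
          norm_le_mul_of_abs_le hM0 fun p => by
            rw [show p = (p.1, p.2) from rfl, hjac n t ht x hxΩ, abs_mul]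
            gcongr
            exact hM' _
        have h5 := h2 t ht x hx
        refine h4.trans ?_
        gcongr
        linarith
      -- Boundary points matter because the defect measures may charge them; there the test field
      -- vanishes in a neighbourhood.
      · have e : φ n t =ᶠ[𝓝 x] fun _ => 0 := by
          filter_upwards [(hLc n).isClosed.isOpen_compl.mem_nhds fun h => hxΩ (hLΩ n h)] with y hy
          simp only [hφ, hθ0 n y hy, zero_smul]
        have : jacobian (φ n t) x = 0 := by
          ext p
          have e' : (fun y => φ n t y p.1) =ᶠ[𝓝 x] fun _ => 0 := e.mono fun y hy => by
            simp only [hy, PiLp.zero_apply]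
          change partialD p.2 (fun y => φ n t y p.1) x = 0
          rw [partialD, e'.fderiv_eq]; simp
        rw [this, norm_zero]; positivity
    · have h4 : ‖timeD (φ n) t x‖ ≤ M * ‖timeD u t x‖ :=
        norm_le_mul_of_abs_le hM0 fun i => by
          rw [htime n t ht x hx, abs_mul]
          gcongr
          exact hM' _
      have h5 := h3 t (Ioo_subset_Icc_self ht) x (subset_closure hx)
      refine h4.trans ?_
      gcongr
      linarith
    · simp only [hφψ _ t ht x hx, hψ]
      exact (PiLp.continuous_toLp 2 _).tendsto _ |>.comp
        (tendsto_pi_nhds.2 fun i => tendsto_flatIdSeq (u t x i))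
    · have hz : ∀ i, ∀ᵐ z : ℝ × Vec d ∂cylMeasure (.wall Ω) T, u z.1 z.2 i = 0 →
          fderiv ℝ (fun z : ℝ × Vec d => u z.1 z.2 i) z = 0 := fun i => by
        rw [cylMeasure_eq]
        exact ae_restrict_of_ae (ae_fderiv_eq_zero_of_eq_zero ((volume : Measure ℝ).prod volume)
          ((contDiff_apply_coord hu1 i).differentiable one_ne_zero))
      have hmem : ∀ᵐ z ∂cylMeasure (.wall Ω) T, z ∈ Ioo 0 T ×ˢ Ω := by
        rw [cylMeasure_eq]
        exact ae_restrict_mem (measurableSet_Ioo.prod (Domain.measurableSet_cell hD))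
      filter_upwards [ae_all_iff.2 hz, hmem] with ⟨t, x⟩ hz ⟨ht, hx⟩
      have ht' := Ioo_subset_Icc_self ht
      have hui := fun i => contDiff_apply_coord hu1 i
      constructor
      · have : ∀ n, jacobian (φ n t) x = WithLp.toLp 2 fun p : Fin d × Fin d =>
            deriv flatId ((n + 1 : ℝ) * u t x p.1) * jacobian (u t) x (p.1, p.2) := fun n => by
          ext p; exact hjac n t ht' x hx p.1 p.2
        simp only [this]
        refine (PiLp.continuous_toLp 2 _).tendsto _ |>.comp (tendsto_pi_nhds.2 fun p =>
          tendsto_deriv_flatId_mul fun h0 => ?_)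
        rw [jacobian_apply, partialD, (hasFDerivAt_slice (f := fun t x => u t x p.1) (hui p.1) t x).fderiv,
          hz p.1 h0]
        rfl
      · have : ∀ n, timeD (φ n) t x = WithLp.toLp 2 fun i =>
            deriv flatId ((n + 1 : ℝ) * u t x i) * timeD u t x i := fun n => by
          ext i; exact htime n t ht x hx i
        simp only [this]
        refine (PiLp.continuous_toLp 2 _).tendsto _ |>.comp (tendsto_pi_nhds.2 fun i =>
          tendsto_deriv_flatId_mul fun h0 => ?_)
        have d2 : HasDerivAt (fun s => u s x i) (timeD u t x i) t :=
          hasDerivAt_coord (hasDerivAt_timeD hu1 t x) i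
        rw [d2.unique (hasDerivAt_slice (f := fun t x => u t x i) (hui i) t x), hz i h0]
        rfl

end

end MHD

namespace MHD
noncomputable section

/-! ### Integral inequalities in time -/

/-- Bounded convergence in `L²`. -/
lemma tendsto_eLpNorm_sub_of_bounded {X F : Type*} [MeasurableSpace X] {μ : Measure X}
    [IsFiniteMeasure μ] [NormedAddCommGroup F] {f : ℕ → X → F} {g : X → F} {K : ℝ}
    (hf : ∀ n, AEStronglyMeasurable (f n) μ) (hg : MemLp g 2 μ) (hK : ∀ n, ∀ᵐ x ∂μ, ‖f n x‖ ≤ K)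
    (h : ∀ᵐ x ∂μ, Tendsto (fun n => f n x) atTop (𝓝 (g x))) :
    Tendsto (fun n => eLpNorm (fun x => f n x - g x) 2 μ) atTop (𝓝 0) := by
  refine tendsto_Lp_finite_of_tendsto_ae one_le_two (by norm_num) hf hg ?_ h
  refine unifIntegrable_of one_le_two (by norm_num) hf fun ε _ => ⟨(K + 1).toNNReal, fun n => ?_⟩
  have : {x | (K + 1).toNNReal ≤ ‖f n x‖₊}.indicator (f n) =ᵐ[μ] 0 := by
    filter_upwards [hK n] with x hx
    refine indicator_of_notMem (fun hx' => ?_) _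
    rw [Set.mem_ofPred_eq, Real.toNNReal_le_iff_le_coe, coe_nnnorm] at hx'
    linarith
  rw [eLpNorm_congr_ae this, eLpNorm_zero]
  exact zero_le

/-- A form of Grönwall's lemma for integrable functions. -/
lemma ae_nonpos_of_le_integral {T C : ℝ} (hC : 0 ≤ C) {F : ℝ → ℝ} (hF : IntegrableOn F (Ioo 0 T))
    (h : ∀ᵐ t ∂timeMeasure T, F t ≤ C * ∫ s in (0 : ℝ)..t, F s) :
    ∀ᵐ t ∂timeMeasure T, F t ≤ 0 := by
  have hFT : IntegrableOn F (Icc 0 T) := by rwa [integrableOn_Icc_iff_integrableOn_Ioo]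
  -- The hypothesis holds only almost everywhere and F need not be continuous. Its primitive G is
  -- continuous and satisfies the same inequality at every time, so the primitive H of G is
  -- differentiable and the usual argument with exp(−Ct)H applies.
  set G : ℝ → ℝ := fun t => ∫ s in (0 : ℝ)..t, F s with hG
  have hGc : ContinuousOn G (Icc 0 T) := by
    rcases le_total 0 T with hT | hT
    · have := intervalIntegral.continuousOn_primitive_interval (a := 0) (b := T) (f := F) (μ := volume)
        (by rwa [uIcc_of_le hT])
      rwa [uIcc_of_le hT] at this
    · exact (Set.subsingleton_Icc_of_ge hT).continuousOn G
  have hGG : ∀ t ∈ Icc 0 T, G t ≤ C * ∫ s in (0 : ℝ)..t, G s := fun t ht => by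
    rw [← intervalIntegral.integral_const_mul]
    have hsub : Ioo 0 t ⊆ Ioo 0 T := Ioo_subset_Ioo_right ht.2
    simp only [hG, intervalIntegral.integral_of_le ht.1, integral_Ioc_eq_integral_Ioo]
    refine integral_mono_ae (hF.mono_set hsub) ?_ ?_
    · exact (((hGc.mono (Icc_subset_Icc_right ht.2)).const_smul C).integrableOn_Icc).mono_set
        Ioo_subset_Icc_self
    · have := ae_mono (Measure.restrict_mono_set volume hsub) h
      filter_upwards [this, ae_restrict_mem measurableSet_Ioo] with s hs hs'
      simpa only [intervalIntegral.integral_of_le hs'.1.le, integral_Ioc_eq_integral_Ioo] using hs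
  set H : ℝ → ℝ := fun t => ∫ s in (0 : ℝ)..t, G s with hH
  have hHd : ∀ t ∈ Ioo 0 T, HasDerivAt H (G t) t := fun t ht => by
    refine intervalIntegral.integral_hasDerivAt_right ?_ ?_ (hGc.continuousAt (Icc_mem_nhds ht.1 ht.2))
    · exact (hGc.mono (Icc_subset_Icc_right ht.2.le)).intervalIntegrable_of_Icc ht.1.le
    · exact (hGc.mono Ioo_subset_Icc_self).stronglyMeasurableAtFilter isOpen_Ioo t ht
  have hHc : ContinuousOn H (Icc 0 T) := by
    rcases le_total 0 T with hT | hT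
    · have := intervalIntegral.continuousOn_primitive_interval (a := 0) (b := T) (f := G) (μ := volume)
        (by rw [uIcc_of_le hT]; exact hGc.integrableOn_Icc)
      rwa [uIcc_of_le hT] at this
    · exact (Set.subsingleton_Icc_of_ge hT).continuousOn H
  have hanti : AntitoneOn (fun t => Real.exp (-C * t) * H t) (Icc 0 T) := by
    refine antitoneOn_of_deriv_nonpos (convex_Icc 0 T)
      ((by fun_prop : Continuous fun t : ℝ => Real.exp (-C * t)).continuousOn.mul hHc) ?_ ?_
    all_goals
      intro t ht
      rw [interior_Icc] at ht
      have h1 : HasDerivAt (fun t => Real.exp (-C * t)) (Real.exp (-C * t) * -C) t := by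
        simpa using ((hasDerivAt_id t).const_mul (-C)).exp
      have h2 := h1.fun_mul (hHd t ht)
    · exact h2.differentiableAt.differentiableWithinAt
    · rw [h2.deriv]
      have h3 := hGG t (Ioo_subset_Icc_self ht)
      have h4 := Real.exp_pos (-C * t)
      have h5 : Real.exp (-C * t) * (G t - C * H t) ≤ 0 :=
        mul_nonpos_of_nonneg_of_nonpos h4.le (by simp only [hH]; linarith)
      linarith
  filter_upwards [h, ae_restrict_mem measurableSet_Ioo] with t ht ht'
  have ht0 := Ioo_subset_Icc_self ht'
  have h1 := hanti ⟨le_rfl, ht0.1.trans ht0.2⟩ ht0 ht0.1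
  have h2 : H 0 = 0 := intervalIntegral.integral_same
  simp only [h2, mul_zero] at h1
  have h3 : H t ≤ 0 := nonpos_of_mul_nonpos_right h1 (Real.exp_pos _)
  have h4 : G t ≤ 0 := (hGG t ht0).trans (mul_nonpos_of_nonneg_of_nonpos hC h3)
  exact ht.trans (mul_nonpos_of_nonneg_of_nonpos hC h4)

/-- Continuous functions that decrease to the indicator function of `(-∞, τ]`. -/
def ramp (τ : ℝ) (n : ℕ) (t : ℝ) : ℝ := max 0 (min 1 (1 - n * (t - τ)))

lemma continuous_ramp (τ : ℝ) (n : ℕ) : Continuous (ramp τ n) := by unfold ramp; fun_prop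

lemma ramp_nonneg (τ : ℝ) (n : ℕ) (t : ℝ) : 0 ≤ ramp τ n t := le_max_left _ _

lemma ramp_le_one (τ : ℝ) (n : ℕ) (t : ℝ) : ramp τ n t ≤ 1 := max_le zero_le_one (min_le_left _ _)

lemma tendsto_ramp (τ t : ℝ) : Tendsto (fun n => ramp τ n t) atTop (𝓝 ((Iic τ).indicator 1 t)) := by
  by_cases h : t ≤ τ
  · have : ∀ n, ramp τ n t = 1 := fun n => by
      have : (1 : ℝ) ≤ 1 - n * (t - τ) := by
        have := mul_nonpos_of_nonneg_of_nonpos (Nat.cast_nonneg (α := ℝ) n) (sub_nonpos.2 h)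
        linarith
      simp [ramp, this]
    simp [this, h]
  · rw [indicator_of_notMem (by simpa using h)]
    refine tendsto_const_nhds.congr' ?_
    filter_upwards [(tendsto_natCast_atTop_atTop (R := ℝ)).eventually_ge_atTop (1 / (t - τ))] with n hn
    have h1 : 0 < t - τ := sub_pos.2 (not_le.1 h)
    rw [div_le_iff₀ h1] at hn
    unfold ramp
    rw [max_eq_left ((min_le_right _ _).trans (by linarith))]

lemma tendsto_integral_ramp_mul {X : Type*} [MeasurableSpace X] {μ : Measure X} {f : X → ℝ}
    (hf : Integrable f μ) {p : X → ℝ} (hp : Measurable p) (τ : ℝ) :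
    Tendsto (fun n => ∫ x, ramp τ n (p x) * f x ∂μ) atTop (𝓝 (∫ x in p ⁻¹' Iic τ, f x ∂μ)) := by
  rw [← integral_indicator (hp measurableSet_Iic)]
  refine tendsto_integral_of_dominated_convergence (fun x => ‖f x‖) (fun n => ?_) hf.norm
    (fun n => .of_forall fun x => ?_) (.of_forall fun x => ?_)
  · exact ((continuous_ramp τ n).measurable.comp hp).aestronglyMeasurable.mul hf.1
  · rw [norm_mul, Real.norm_of_nonneg (ramp_nonneg _ _ _)]
    exact mul_le_of_le_one_left (norm_nonneg _) (ramp_le_one _ _ _)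
  · have := (tendsto_ramp τ (p x)).mul_const (f x)
    refine this.trans_eq (congrArg _ ?_)
    by_cases h : p x ≤ τ <;> simp [indicator, h]

lemma tendsto_intervalIntegral_ramp_mul {T τ : ℝ} (hτ : τ ∈ Ioo 0 T) {f : ℝ → ℝ}
    (hf : IntegrableOn f (Ioo 0 T)) :
    Tendsto (fun n => ∫ t in (0 : ℝ)..T, ramp τ n t * f t) atTop (𝓝 (∫ t in (0 : ℝ)..τ, f t)) := by
  have h := tendsto_integral_ramp_mul (by rwa [← IntegrableOn, integrableOn_Ioc_iff_integrableOn_Ioo] :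
    Integrable f (volume.restrict (Ioc 0 T))) measurable_id τ
  simp only [id, preimage_id_eq] at h
  rw [Measure.restrict_restrict measurableSet_Iic,
    show Iic τ ∩ Ioc 0 T = Ioc 0 τ by rw [inter_comm, Ioc_inter_Iic, min_eq_right hτ.2.le]] at h
  simpa only [intervalIntegral.integral_of_le hτ.1.le,
    intervalIntegral.integral_of_le (hτ.1.trans hτ.2).le] using h

/-- An inequality between measures on `[0, T]`, tested with continuous functions, holds on
`[0, τ]`. -/
lemma integral_le_of_forall_test {X : Type*} [MeasurableSpace X] {T C a ε : ℝ} {m g : ℝ → ℝ}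
    (hm : IntegrableOn m (Ioo 0 T)) (hg : IntegrableOn g (Ioo 0 T)) (hg0 : ∀ t, 0 ≤ g t)
    {ν : Measure (ℝ × X)} [IsFiniteMeasure ν] {Z : Set X} (ha : 0 ≤ a) (hε : 0 ≤ ε)
    (h : ∀ ψ : ℝ → ℝ, Continuous ψ → (∀ t ∈ Icc 0 T, 0 ≤ ψ t) →
      ∫ t in (0 : ℝ)..T, ψ t * m t ≤ C * (a * (∫ t in (0 : ℝ)..T, ψ t * g t)
        + ε * ∫ z in Icc 0 T ×ˢ Z, ψ z.1 ∂ν)) {τ : ℝ} (hτ : τ ∈ Ioo 0 T) :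
    ∫ t in (0 : ℝ)..τ, m t
      ≤ |C| * (a * (∫ t in (0 : ℝ)..τ, g t) + ε * ν.real (Icc 0 τ ×ˢ Z)) := by
  have l1 := tendsto_intervalIntegral_ramp_mul hτ hm
  have l2 := tendsto_intervalIntegral_ramp_mul hτ hg
  -- The ramps equal 1 up to and including τ, so a possible mass at time τ is kept in the limit.
  have l3 := tendsto_integral_ramp_mul (μ := ν.restrict (Icc 0 T ×ˢ Z)) (f := fun _ => (1 : ℝ))
    (integrable_const _) measurable_fst τ
  rw [Measure.restrict_restrict (measurable_fst measurableSet_Iic),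
    show (Prod.fst ⁻¹' Iic τ) ∩ (Icc 0 T ×ˢ Z) = Icc 0 τ ×ˢ Z by
      ext ⟨t, x⟩
      simp only [mem_inter_iff, mem_preimage, mem_Iic, mem_prod, mem_Icc]
      exact ⟨fun ⟨h1, h2, h3⟩ => ⟨⟨h2.1, h1⟩, h3⟩,
        fun ⟨h1, h2⟩ => ⟨h1.2, ⟨h1.1, h1.2.trans hτ.2.le⟩, h2⟩⟩] at l3
  simp only [mul_one, setIntegral_const, smul_eq_mul] at l3
  have hle := le_of_tendsto_of_tendsto' l1 (((l2.const_mul a).add (l3.const_mul ε)).const_mul C)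
    fun n => h (ramp τ n) (continuous_ramp τ n) fun t _ => ramp_nonneg τ n t
  refine hle.trans (mul_le_mul_of_nonneg_right (le_abs_self C) ?_)
  have := intervalIntegral.integral_nonneg (μ := volume) hτ.1.le fun t (_ : t ∈ Icc 0 τ) => hg0 t
  positivity

variable {d : ℕ} {D : Domain d}

/-- The time slices of the test fields approximate v in W^{1,2} by bounded convergence. By Fubini
their Jacobians converge almost everywhere in space only at almost every time. -/
lemma TestApprox.ae_w0 (hD : D.Admissible) {T K : ℝ} {u : ℝ → Vec d → Vec d}
    {φ : ℕ → ℝ → Vec d → Vec d} (hφ : TestApprox D T u φ K) (hu : ClosedCk D 2 u) :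
    ∀ᵐ t ∂timeMeasure T, D.W0 (u t) (jacobian (u t)) := by
  have := Domain.isFiniteMeasure_spaceMeasure hD
  have hu1 : ContDiff ℝ 1 fun z : ℝ × Vec d => u z.1 z.2 := hu.1.of_le one_le_two
  have hmem : ∀ᵐ x ∂D.spaceMeasure, x ∈ closure D.cell :=
    (ae_restrict_mem (Domain.measurableSet_cell hD)).mono fun x hx => subset_closure hx
  filter_upwards [Measure.ae_ae_of_ae_prod hφ.tendsto_deriv, ae_restrict_mem measurableSet_Ioo]
    with t hlim ht'
  have ht := Ioo_subset_Icc_self ht'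
  have hc := contDiff_slice hu1 t
  have hj := continuous_jacobian hc
  refine ⟨Domain.memLp_cell hD hc.continuous 2, Domain.memLp_cell hD hj 2, fun n => φ n t,
    fun n => ⟨contDiff_slice (hφ.contDiff n) t, (hφ.test n).1.2 t, ?_⟩, ?_, ?_⟩
  · have := (hφ.test n).2
    cases D with
    | torus => trivial
    | wall Ω =>
      obtain ⟨L, h1, h2, h3⟩ := this
      exact ⟨L, h1, h2, h3 t ht⟩
  · refine tendsto_eLpNorm_sub_of_bounded (K := K) (fun n => ?_)
      (Domain.memLp_cell hD hc.continuous 2) (fun n => ?_) ?_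
    · exact (contDiff_slice (hφ.contDiff n) t).continuous.aestronglyMeasurable
    · filter_upwards [hmem] with x hx using hφ.norm_le n t ht x hx
    · filter_upwards [hmem] with x hx using hφ.tendsto t ht x hx
  · refine tendsto_eLpNorm_sub_of_bounded (K := K) (fun n => ?_)
      (Domain.memLp_cell hD hj 2) (fun n => ?_) ?_
    · exact (continuous_jacobian ((contDiff_slice (hφ.contDiff n) t).of_le
        one_le_two)).aestronglyMeasurable
    · filter_upwards [hmem] with x hx using hφ.jacobian_le n t ht x hx
    · filter_upwards [hlim] with x hx using hx.1

/-! ### Defect measures -/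

lemma norm_innerSL_integral_le {F : Type*} [NormedAddCommGroup F] [InnerProductSpace ℝ F]
    [CompleteSpace F] {μ : VectorMeasure (Vec d) F} {f : Vec d → F} {Z : Set (Vec d)} {K : ℝ}
    (h0 : μ.variation Zᶜ = 0) (hfin : μ.variation Z < ⊤) (hK : 0 ≤ K) (hf : ∀ x ∈ Z, ‖f x‖ ≤ K) :
    ‖VectorMeasure.integral μ f (innerSL ℝ)‖ ≤ K * μ.variation.real Z := by
  have hu : μ.variation univ = μ.variation Z := by
    refine le_antisymm ?_ (measure_mono (subset_univ _))
    rw [← union_compl_self Z]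
    exact (measure_union_le _ _).trans (by rw [h0, add_zero])
  have : IsFiniteMeasure μ.variation := ⟨by rwa [hu]⟩
  have hae : ∀ᵐ x ∂μ.variation, ‖f x‖ ≤ K := by
    have : ∀ᵐ x ∂μ.variation, x ∈ Z := h0
    filter_upwards [this] with x hx using hf x hx
  refine (VectorMeasure.norm_integral_le_of_norm_le_const hae).trans ?_
  rw [measureReal_def, hu, ← measureReal_def]
  refine mul_le_mul_of_nonneg_right ?_ measureReal_nonneg
  exact mul_le_of_le_one_right hK (norm_innerSL_le ℝ)

lemma MemLpMeasure.integrableOn {F : Type*} [NormedAddCommGroup F] [NormedSpace ℝ F] {T : ℝ}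
    {p : ENNReal} (hp : 1 ≤ p) {μ : ℝ → VectorMeasure (Vec d) F} (h : MemLpMeasure D T p μ) :
    IntegrableOn (fun t => (μ t).variation.real D.closedCell) (Ioo 0 T) := by
  have : IsFiniteMeasure (timeMeasure T) := by unfold timeMeasure; infer_instance
  exact h.norm_mem.integrable hp

/-- The estimate needs integrability in time of the total variation only, not of the pairing with f.
-/
lemma MemLpMeasure.abs_integral_le {F : Type*} [NormedAddCommGroup F] [InnerProductSpace ℝ F]
    [CompleteSpace F] {T : ℝ} {p : ENNReal} (hp : 1 ≤ p) {μ : ℝ → VectorMeasure (Vec d) F}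
    (h : MemLpMeasure D T p μ) {f : ℝ → Vec d → F} {K : ℝ} (hK : 0 ≤ K)
    (hf : ∀ t ∈ Icc 0 T, ∀ x ∈ D.closedCell, ‖f t x‖ ≤ K) {τ : ℝ} (hτ : τ ∈ Ioo 0 T) :
    |∫ t in (0 : ℝ)..τ, VectorMeasure.integral (μ t) (f t) (innerSL ℝ)|
      ≤ K * ∫ t in (0 : ℝ)..τ, (μ t).variation.real D.closedCell := by
  rw [← intervalIntegral.integral_const_mul]
  have hsub : Ioc 0 τ ⊆ Ioo 0 T := fun t ht => ⟨ht.1, ht.2.trans_lt hτ.2⟩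
  rw [← Real.norm_eq_abs]
  refine intervalIntegral.norm_integral_le_of_norm_le hτ.1.le ?_ ?_
  · have h1 := h.carried
    have h2 := h.finite
    rw [timeMeasure, ae_restrict_iff' measurableSet_Ioo] at h1 h2
    filter_upwards [h1, h2] with t h1 h2 ht
    have ht' := hsub ht
    exact norm_innerSL_integral_le (h1 ht') (h2 ht') hK (hf t (Ioo_subset_Icc_self ht'))
  · rw [intervalIntegrable_iff_integrableOn_Ioc_of_le hτ.1.le]
    exact ((h.integrableOn hp).mono_set hsub).const_mul K

lemma MemLinftyPosMeasure.integrableOn {T : ℝ} {μ : ℝ → Measure (Vec d)}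
    (h : MemLinftyPosMeasure D T μ) :
    IntegrableOn (fun t => (μ t).real D.closedCell) (Ioo 0 T) := by
  have : IsFiniteMeasure (timeMeasure T) := by unfold timeMeasure; infer_instance
  obtain ⟨C, hC⟩ := h.bounded
  have hper : D.Periodic fun _ : Vec d => (1 : ℝ) := by
    cases D with
    | wall Ω => trivial
    | torus => exact fun _ _ => rfl
  have hmeas : AEStronglyMeasurable (fun t => (μ t).real D.closedCell) (timeMeasure T) := by
    refine (h.weakStar (fun _ => 1) continuous_const hper).congr ?_
    filter_upwards [h.carried] with t ht
    have hu : (μ t) univ = (μ t) D.closedCell := by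
      refine le_antisymm ?_ (measure_mono (subset_univ _))
      rw [← union_compl_self D.closedCell]
      exact (measure_union_le _ _).trans (by rw [ht, add_zero])
    simp [measureReal_def, hu]
  refine Integrable.of_bound hmeas C ?_
  filter_upwards [hC] with t ht
  rw [Real.norm_of_nonneg measureReal_nonneg]
  exact ENNReal.toReal_le_coe_of_le_coe ht

end

end MHD

namespace MHD
noncomputable section

/-! ### Integrability of products -/

section Products

variable {X : Type*} [MeasurableSpace X] {μ : Measure X} {p q : ENNReal}

lemma integrable_of_norm_le_mul {E F G : Type*} [NormedAddCommGroup E] [NormedAddCommGroup F]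
    [NormedAddCommGroup G] [ENNReal.HolderTriple p q 1] {h : X → E} {f : X → F} {g : X → G}
    (hh : AEStronglyMeasurable h μ) (hf : MemLp f p μ) (hg : MemLp g q μ)
    (hle : ∀ x, ‖h x‖ ≤ ‖f x‖ * ‖g x‖) : Integrable h μ :=
  (hf.norm.integrable_mul hg.norm).mono' hh (.of_forall hle)

lemma integrable_inner {F : Type*} [NormedAddCommGroup F] [InnerProductSpace ℝ F]
    [ENNReal.HolderTriple p q 1] {f g : X → F} (hf : MemLp f p μ) (hg : MemLp g q μ) :
    Integrable (fun x => inner ℝ (f x) (g x)) μ :=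
  integrable_of_norm_le_mul (hf.1.inner hg.1) hf hg fun _ => norm_inner_le_norm _ _

lemma integrable_mul [ENNReal.HolderTriple p q 1] {f g : X → ℝ} (hf : MemLp f p μ)
    (hg : MemLp g q μ) : Integrable (fun x => f x * g x) μ :=
  hf.integrable_mul hg

end Products

variable {d : ℕ}

lemma continuous_pad : Continuous (pad : Vec d → Vec 3) :=
  (contDiff_pad (n := 0) contDiff_id).continuous

lemma continuous_cross : Continuous fun z : Vec 3 × Vec 3 => cross z.1 z.2 :=
  (contDiff_cross (n := 0) contDiff_fst contDiff_snd).continuous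

lemma integrable_cross {X : Type*} [MeasurableSpace X] {μ : Measure X} {f g : X → Vec 3}
    (hf : MemLp f 2 μ) (hg : MemLp g 2 μ) : Integrable (fun x => cross (f x) (g x)) μ :=
  integrable_of_norm_le_mul (continuous_cross.comp_aestronglyMeasurable (hf.1.prodMk hg.1)) hf hg
    fun _ => norm_cross_le _ _

lemma continuous_outer : Continuous fun z : Vec d × Vec d => outer z.1 z.2 :=
  (PiLp.continuous_toLp 2 _).comp (by fun_prop)

lemma norm_outer (x y : Vec d) : ‖outer x y‖ = ‖x‖ * ‖y‖ := by
  rw [EuclideanSpace.norm_eq, EuclideanSpace.norm_eq, EuclideanSpace.norm_eq,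
    ← Real.sqrt_mul (by positivity), Finset.sum_mul_sum, Fintype.sum_prod_type]
  simp only [outer, norm_mul, mul_pow]

/-- The integrability properties of the fields of a dissipative weak solution, with respect to the
measure `μ`. -/
structure FlowIntegrable {X : Type*} [MeasurableSpace X] (P : Params) (μ : Measure X) (ρ : X → ℝ)
    (u : X → Vec d) (G : X → Mat d) (B : X → Vec d) (J : X → Vec 3) : Prop where
  nonneg : ∀ᵐ x ∂μ, 0 ≤ ρ x
  density : Integrable ρ μ
  rpow : Integrable (fun x => ρ x ^ P.γ) μ
  momentum : Integrable (fun x => ρ x • u x) μ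
  kinetic : Integrable (fun x => ρ x * ‖u x‖ ^ 2) μ
  vel : MemLp u 2 μ
  grad : MemLp G 2 μ
  field : MemLp B 2 μ
  current : MemLp J 2 μ

namespace FlowIntegrable

variable {X : Type*} [MeasurableSpace X] {P : Params} {μ : Measure X} {ρ : X → ℝ}
  {u : X → Vec d} {G : X → Mat d} {B : X → Vec d} {J : X → Vec 3}

lemma stress (h : FlowIntegrable P μ ρ u G B J) : MemLp (fun x => stress P (G x)) 2 μ :=
  MemLp.of_le_mul h.grad ((Domain.continuous_stress P).comp_aestronglyMeasurable h.grad.1)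
    (.of_forall fun x => norm_stress_le P (G x))

lemma pressure (h : FlowIntegrable P μ ρ u G B J) : Integrable (fun x => pressure P (ρ x)) μ :=
  h.rpow.const_mul P.a

lemma potential (h : FlowIntegrable P μ ρ u G B J) : Integrable (fun x => potential P (ρ x)) μ :=
  h.rpow.const_mul (P.a / (P.γ - 1))

lemma padField (hd : d = 2 ∨ d = 3) (h : FlowIntegrable P μ ρ u G B J) :
    MemLp (fun x => pad (B x)) 2 μ :=
  h.field.of_le (continuous_pad.comp_aestronglyMeasurable h.field.1)
    (.of_forall fun _ => (norm_pad hd _).le)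

lemma padVel (hd : d = 2 ∨ d = 3) (h : FlowIntegrable P μ ρ u G B J) :
    MemLp (fun x => pad (u x)) 2 μ :=
  h.vel.of_le (continuous_pad.comp_aestronglyMeasurable h.vel.1)
    (.of_forall fun _ => (norm_pad hd _).le)

lemma lorentz (hd : d = 2 ∨ d = 3) (h : FlowIntegrable P μ ρ u G B J) :
    Integrable (fun x => cross (J x) (pad (B x))) μ :=
  integrable_cross h.current (h.padField hd)

lemma electric (hd : d = 2 ∨ d = 3) (h : FlowIntegrable P μ ρ u G B J) :
    Integrable (fun x => cross (pad (u x)) (pad (B x))) μ :=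
  integrable_cross (h.padVel hd) (h.padField hd)

lemma convection (h : FlowIntegrable P μ ρ u G B J) :
    Integrable (fun x => ρ x • outer (u x) (u x)) μ := by
  refine h.kinetic.mono ?_ (.of_forall fun x => ?_)
  · exact h.density.1.smul (continuous_outer.comp_aestronglyMeasurable (h.vel.1.prodMk h.vel.1))
  · rw [norm_smul, norm_outer, norm_mul, Real.norm_of_nonneg (sq_nonneg ‖u x‖), sq]

lemma dissipation (h : FlowIntegrable P μ ρ u G B J) :
    Integrable (fun x => inner ℝ (MHD.stress P (G x)) (G x) + P.α * ‖J x‖ ^ 2) μ :=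
  (integrable_inner h.stress h.grad).add (h.current.integrable_norm_pow two_ne_zero |>.const_mul _)

lemma momentumIntegrand (hd : d = 2 ∨ d = 3) (h : FlowIntegrable P μ ρ u G B J)
    {a v : X → Vec d} {g : X → Mat d} {q : X → ℝ} (ha : MemLp a ⊤ μ) (hv : MemLp v ⊤ μ)
    (hg : MemLp g ⊤ μ) (hg2 : MemLp g 2 μ) (hq : MemLp q ⊤ μ) :
    Integrable (fun x => inner ℝ (ρ x • u x) (a x) + inner ℝ (ρ x • outer (u x) (u x)) (g x)
      + MHD.pressure P (ρ x) * q x - inner ℝ (MHD.stress P (G x)) (g x)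
      + inner ℝ (cross (J x) (pad (B x))) (pad (v x))) μ := by
  have hpv : MemLp (fun x => pad (v x)) ⊤ μ :=
    hv.of_le (continuous_pad.comp_aestronglyMeasurable hv.1) (.of_forall fun _ => (norm_pad hd _).le)
  exact ((((integrable_inner (memLp_one_iff_integrable.2 h.momentum) ha).add
    (integrable_inner (memLp_one_iff_integrable.2 h.convection) hg)).add
    (integrable_mul (memLp_one_iff_integrable.2 h.pressure) hq)).sub
    (integrable_inner h.stress hg2)).add
    (integrable_inner (memLp_one_iff_integrable.2 (h.lorentz hd)) hpv)

lemma continuityIntegrand (h : FlowIntegrable P μ ρ u G B J) {a : X → ℝ} {q : X → Vec d}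
    (ha : MemLp a ⊤ μ) (hq : MemLp q ⊤ μ) :
    Integrable (fun x => ρ x * a x + inner ℝ (ρ x • u x) (q x)) μ :=
  (integrable_mul (memLp_one_iff_integrable.2 h.density) ha).add
    (integrable_inner (memLp_one_iff_integrable.2 h.momentum) hq)

lemma maxwellIntegrand (hd : d = 2 ∨ d = 3) (h : FlowIntegrable P μ ρ u G B J)
    {a : X → Vec d} {j : X → Vec 3} (ha : MemLp a 2 μ) (hj : MemLp j ⊤ μ) (hj2 : MemLp j 2 μ) :
    Integrable (fun x => inner ℝ (B x) (a x) + inner ℝ (cross (pad (u x)) (pad (B x))) (j x)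
      - P.α * inner ℝ (J x) (j x)) μ :=
  ((integrable_inner h.field ha).add
    (integrable_inner (memLp_one_iff_integrable.2 (h.electric hd)) hj)).sub
    ((integrable_inner h.current hj2).const_mul _)

lemma relKinetic (h : FlowIntegrable P μ ρ u G B J) {v : X → Vec d} (hv : MemLp v ⊤ μ) :
    Integrable (fun x => ρ x * ‖u x - v x‖ ^ 2) μ := by
  have e : (fun x => ρ x * ‖u x - v x‖ ^ 2) = fun x =>
      ρ x * ‖u x‖ ^ 2 - 2 * inner ℝ (ρ x • u x) (v x) + ρ x * ‖v x‖ ^ 2 := by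
    ext x
    rw [norm_sub_sq_real, real_inner_smul_left]; ring
  rw [e]
  have hv2 : MemLp (fun x => ‖v x‖ ^ 2) ⊤ μ := by
    have := (hv.norm.mul (r := ⊤) hv.norm)
    exact this.congr_norm (hv.norm.1.pow 2) (.of_forall fun x => by simp [sq])
  exact (h.kinetic.sub
    ((integrable_inner (memLp_one_iff_integrable.2 h.momentum) hv).const_mul 2)).add
    (integrable_mul (memLp_one_iff_integrable.2 h.density) hv2)

lemma relEnergy [IsFiniteMeasure μ] (h : FlowIntegrable P μ ρ u G B J) {r : X → ℝ}
    {v b : X → Vec d} (hv : MemLp v ⊤ μ) (hb : MemLp b 2 μ) (hr : MemLp r ⊤ μ)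
    (hr1 : MemLp (fun x => dPotential P (r x)) ⊤ μ)
    (hr2 : MemLp (fun x => MHD.potential P (r x)) ⊤ μ) :
    Integrable (fun x => relEnergy P (ρ x) (r x) (u x) (v x) (B x) (b x)) μ := by
  have hρr : MemLp (fun x => ρ x - r x) 1 μ :=
    (memLp_one_iff_integrable.2 h.density).sub (hr.mono_exponent le_top)
  refine (((h.relKinetic hv).const_mul (1 / 2)).add
    (((h.field.sub hb).integrable_norm_pow two_ne_zero).const_mul (1 / 2))).add ?_
  exact (h.potential.sub (integrable_mul hr1 hρr)).sub (hr2.integrable le_top)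

end FlowIntegrable

end

end MHD

namespace MHD
noncomputable section

/-! ### The production of relative energy -/

variable {d : ℕ} {D : Domain d}

/-- The dissipated energy. -/
def dissipation (P : Params) (S : DWFields d) (t : ℝ) (x : Vec d) : ℝ :=
  inner ℝ (stress P (S.gradU t x)) (S.gradU t x) + P.α * ‖S.curlB t x‖ ^ 2

/-- The integrand of the continuity equation. -/
def continuityIntegrand (S : DWFields d) (φ : ℝ → Vec d → ℝ) (t : ℝ) (x : Vec d) : ℝ :=
  S.ρ t x * timeD φ t x + inner ℝ (S.ρ t x • S.u t x) (gradient (φ t) x)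

/-- The integrand of the momentum equation. -/
def momentumIntegrand (P : Params) (S : DWFields d) (φ : ℝ → Vec d → Vec d) (t : ℝ) (x : Vec d) :
    ℝ :=
  inner ℝ (S.ρ t x • S.u t x) (timeD φ t x)
    + inner ℝ (S.ρ t x • outer (S.u t x) (S.u t x)) (jacobian (φ t) x)
    + pressure P (S.ρ t x) * divergence (φ t) x
    - inner ℝ (stress P (S.gradU t x)) (jacobian (φ t) x)
    + inner ℝ (cross (S.curlB t x) (pad (S.B t x))) (pad (φ t x))

/-- The integrand of the Maxwell equation. -/
def maxwellIntegrand (P : Params) (S : DWFields d) (φ : ℝ → Vec d → Vec d) (t : ℝ) (x : Vec d) :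
    ℝ :=
  inner ℝ (S.B t x) (timeD φ t x)
    + inner ℝ (cross (pad (S.u t x)) (pad (S.B t x))) (curl (fun y => pad (φ t y)) x)
    - P.α * inner ℝ (S.curlB t x) (curl (fun y => pad (φ t y)) x)

/-- The test function of the continuity equation in the relative energy inequality. -/
def relTest (P : Params) (r : ℝ → Vec d → ℝ) (v : ℝ → Vec d → Vec d) (t : ℝ) (x : Vec d) : ℝ :=
  1 / 2 * ‖v t x‖ ^ 2 - dPotential P (r t x)

/-- The rate of change of the relative energy. -/
def production (P : Params) (S : DWFields d) (r : ℝ → Vec d → ℝ) (v b : ℝ → Vec d → Vec d) (t : ℝ)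
    (x : Vec d) : ℝ :=
  -dissipation P S t x - momentumIntegrand P S v t x + continuityIntegrand S (relTest P r v) t x
    - maxwellIntegrand P S b t x + inner ℝ (b t x) (timeD b t x)
    + dPressure P (r t x) * timeD r t x

/-- The part of the production that is controlled by the relative energy. -/
def remainder (P : Params) (S : DWFields d) (r : ℝ → Vec d → ℝ) (v b : ℝ → Vec d → Vec d) (t : ℝ)
    (x : Vec d) : ℝ :=
  - P.α * ‖S.curlB t x - curl (fun y => pad (b t y)) x‖ ^ 2
    - S.ρ t x * inner ℝ (S.u t x - v t x) (mulV (jacobian (v t) x) (S.u t x - v t x))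
    - tr (jacobian (v t) x) * (pressure P (S.ρ t x) - dPressure P (r t x) * (S.ρ t x - r t x)
      - pressure P (r t x))
    + inner ℝ (S.curlB t x - curl (fun y => pad (b t y)) x)
      (cross (pad (v t x)) (pad (S.B t x - b t x)))
    - inner ℝ (curl (fun y => pad (b t y)) x)
      (cross (pad (S.u t x - v t x)) (pad (S.B t x - b t x)))
    + (S.ρ t x - r t x) / r t x * (inner ℝ (curl (fun y => pad (b t y)) x)
        (cross (pad (S.u t x - v t x)) (pad (b t x)))
      - inner ℝ (S.u t x - v t x) (matDivergence (fun y => stress P (jacobian (v t) y)) x))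

/-- The density of the relative energy of a dissipative weak solution. -/
def relEnergyAt (P : Params) (S : DWFields d) (r : ℝ → Vec d → ℝ) (v b : ℝ → Vec d → Vec d) (t : ℝ)
    (x : Vec d) : ℝ :=
  relEnergy P (S.ρ t x) (r t x) (S.u t x) (v t x) (S.B t x) (b t x)

section RelTest

variable {P : Params} {T c : ℝ} {r : ℝ → Vec d → ℝ} {v b : ℝ → Vec d → Vec d}

lemma contDiff_dPotential_comp (P : Params) {E : Type*} [NormedAddCommGroup E] [NormedSpace ℝ E]
    {n : WithTop ℕ∞} {f : E → ℝ} (hf : ContDiff ℝ n f) (hpos : ∀ z, 0 < f z) :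
    ContDiff ℝ n fun z => dPotential P (f z) :=
  contDiff_const.mul (hf.rpow_const_of_ne fun z => (hpos z).ne')

lemma contDiff_dPressure_comp (P : Params) {E : Type*} [NormedAddCommGroup E] [NormedSpace ℝ E]
    {n : WithTop ℕ∞} {f : E → ℝ} (hf : ContDiff ℝ n f) (hpos : ∀ z, 0 < f z) :
    ContDiff ℝ n fun z => dPressure P (f z) :=
  contDiff_const.mul (hf.rpow_const_of_ne fun z => (hpos z).ne')

lemma contDiff_pressure_comp (P : Params) {E : Type*} [NormedAddCommGroup E] [NormedSpace ℝ E]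
    {n : WithTop ℕ∞} {f : E → ℝ} (hf : ContDiff ℝ n f) (hpos : ∀ z, 0 < f z) :
    ContDiff ℝ n fun z => pressure P (f z) :=
  contDiff_const.mul (hf.rpow_const_of_ne fun z => (hpos z).ne')

lemma contDiff_potential_comp (P : Params) {E : Type*} [NormedAddCommGroup E] [NormedSpace ℝ E]
    {n : WithTop ℕ∞} {f : E → ℝ} (hf : ContDiff ℝ n f) (hpos : ∀ z, 0 < f z) :
    ContDiff ℝ n fun z => potential P (f z) :=
  contDiff_const.mul (hf.rpow_const_of_ne fun z => (hpos z).ne')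

lemma StrongSolution.relTest_reg (h : StrongSolution P D T c r v b) :
    ClosedCk D 1 (relTest P r v) :=
  ⟨(contDiff_const.mul ((h.u_reg.1.of_le one_le_two).norm_sq ℝ)).sub
    (contDiff_dPotential_comp P h.r_reg.1 fun z => h.r_pos z.1 z.2),
    fun t => (h.u_reg.2 t).comp₂ (h.r_reg.2 t) fun a s => 1 / 2 * ‖a‖ ^ 2 - dPotential P s⟩

lemma StrongSolution.timeD_relTest (hP : P.Valid) (h : StrongSolution P D T c r v b) (t : ℝ)
    (x : Vec d) : timeD (relTest P r v) t x
      = inner ℝ (v t x) (timeD v t x) - ddPotential P (r t x) * timeD r t x := by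
  have h1 := (hasDerivAt_timeD (h.u_reg.1.of_le one_le_two) t x).norm_sq.const_mul (1 / 2)
  have h2 : HasDerivAt (fun s => dPotential P (r s x)) (ddPotential P (r t x) * timeD r t x) t :=
    HasDerivAt.comp (h₂ := dPotential P) t (hasDerivAt_dPotential hP (h.r_pos t x))
      (hasDerivAt_timeD h.r_reg.1 t x)
  exact (h1.fun_sub h2).deriv.trans (by ring)

lemma StrongSolution.inner_gradient_relTest (hP : P.Valid) (h : StrongSolution P D T c r v b)
    (t : ℝ) (x z : Vec d) : inner ℝ z (gradient (relTest P r v t) x)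
      = inner ℝ (v t x) (mulV (jacobian (v t) x) z)
        - ddPotential P (r t x) * inner ℝ z (gradient (r t) x) := by
  have hv := (contDiff_slice h.u_reg.1 t).differentiable two_ne_zero x
  have h1 := hv.hasFDerivAt.norm_sq.const_mul (1 / 2)
  have h2 : HasFDerivAt (fun y => dPotential P (r t y))
      (ddPotential P (r t x) • fderiv ℝ (r t) x) x :=
    (hasDerivAt_dPotential hP (h.r_pos t x)).comp_hasFDerivAt x
      ((contDiff_slice h.r_reg.1 t).differentiable one_ne_zero x).hasFDerivAt
  have h3 : HasFDerivAt (relTest P r v t) _ x := h1.fun_sub h2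
  rw [inner_gradient, inner_gradient, h3.fderiv, ← fderiv_eq_mulV hv]
  simp

/-- The production of relative energy, up to terms with vanishing integral. -/
lemma StrongSolution.production_eq (hd : d = 2 ∨ d = 3) (hP : P.Valid)
    (h : StrongSolution P D T c r v b) (S : DWFields d) {t : ℝ} (ht : t ∈ Ioo 0 T) {x : Vec d}
    (hx : x ∈ D.cell) :
    production P S r v b t x =
      -inner ℝ (stress P (S.gradU t x - jacobian (v t) x)) (S.gradU t x - jacobian (v t) x)
      + remainder P S r v b t x
      - (inner ℝ (stress P (jacobian (v t) x)) (S.gradU t x - jacobian (v t) x)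
        + inner ℝ (matDivergence (fun y => stress P (jacobian (v t) y)) x) (S.u t x - v t x))
      - (dPressure P (r t x) * inner ℝ (v t x) (gradient (r t) x)
        + pressure P (r t x) * tr (jacobian (v t) x))
      + (inner ℝ (pad (b t x - S.B t x)) (curl (fun y => cross (pad (v t y)) (pad (b t y))
          - P.α • curl (fun y => pad (b t y)) y) x)
        - inner ℝ (curl (fun y => pad (b t y)) x - S.curlB t x) (cross (pad (v t x)) (pad (b t x))
          - P.α • curl (fun y => pad (b t y)) x)) := by
  have key := relative_energy_identity hd P (ρ := S.ρ t x) (pρ := pressure P (S.ρ t x))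
    (pr := pressure P (r t x)) (u := S.u t x) (B := S.B t x) (G := S.gradU t x) (J := S.curlB t x)
    (h.r_pos t x).ne' (ddPotential_mul P (h.r_pos t x)) (h.mass t ht x hx)
    (h.momentum t ht x hx) rfl (h.induction t ht x hx)
  simp only [production, dissipation, momentumIntegrand, continuityIntegrand, maxwellIntegrand,
    h.timeD_relTest hP, real_inner_smul_left (S.u t x), h.inner_gradient_relTest hP, remainder,
    ← tr_jacobian] at key ⊢
  linarith

end RelTest

/-- Seen as the divergence of the matrix field p𝕀, the pressure gradient falls under the integration
by parts for W₀^{1,2}. -/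
lemma matDivergence_smul_idMat (f : Vec d → ℝ) (x : Vec d) :
    matDivergence (fun y => f y • idMat d) x = gradient f x := by
  ext i
  have h1 : gradient f x i = partialD i f x := by
    rw [partialD, ← inner_gradient, EuclideanSpace.inner_single_left]; simp
  have h2 : ∀ j, partialD j (fun y => (f y • idMat d) (i, j)) x
      = if i = j then partialD j f x else 0 := fun j => by
    split_ifs with hij
    · simp [idMat, hij]
    · simp [idMat, hij, partialD]
  change ∑ j, partialD j (fun y => (f y • idMat d) (i, j)) x = _
  simp only [h2, h1, Finset.sum_ite_eq, Finset.mem_univ, if_true]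

lemma Domain.Periodic.jacobian {v : Vec d → Vec d} (hv : D.Periodic v) :
    D.Periodic (MHD.jacobian v) := by
  have := fun i j => (hv.comp fun a => a i).partialD j
  cases D with
  | wall Ω => trivial
  | torus => intro x k; ext p; exact this p.1 p.2 x k

lemma Domain.Periodic.curl {F : Vec d → Vec 3} (hF : D.Periodic F) : D.Periodic (MHD.curl F) := by
  have h1 := fun i j => (hF.comp fun a => a i).partialD j
  cases D with
  | wall Ω => trivial
  | torus =>
    have h : ∀ i j x k, partialD₃ j (fun y => F y i) (x + EuclideanSpace.single k 1)
        = partialD₃ j (fun y => F y i) x := fun i j x k => by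
      unfold partialD₃
      split_ifs
      · exact h1 i _ x k
      · rfl
    intro x k
    simp only [MHD.curl, h]

/-- The integrability and boundary properties of a dissipative weak solution at a fixed time. -/
structure RegularSlice (P : Params) (D : Domain d) (S : DWFields d) (M C : ℝ) (t : ℝ) : Prop where
  flow : FlowIntegrable P D.spaceMeasure (S.ρ t) (S.u t) (S.gradU t) (S.B t) (S.curlB t)
  w0 : D.W0 (S.u t) (S.gradU t)
  curl : D.HasSobolevCurl (S.B t) (S.curlB t)
  mass : ∫ x in D.cell, S.ρ t x = M
  rpow_le : ∫ x in D.cell, S.ρ t x ^ P.γ ≤ C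

/-- The part of s above N is dominated by s (s/N)^(γ−1). A bound in L^γ therefore makes the
truncated mass close to the full one, uniformly in time. -/
lemma le_min_add_rpow {γ : ℝ} (hγ : 1 < γ) {s N : ℝ} (hs : 0 ≤ s) (hN : 0 < N) :
    s ≤ min s N + N ^ (1 - γ) * s ^ γ := by
  rcases le_total s N with h | h
  · rw [min_eq_left h]; exact le_add_of_nonneg_right (by positivity)
  · have hs' : 0 < s := hN.trans_le h
    have h1 : N ^ (1 - γ) * s ^ γ = s * (s / N) ^ (γ - 1) := by
      rw [Real.div_rpow hs hN.le, show 1 - γ = -(γ - 1) by ring, Real.rpow_neg hN.le,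
        Real.rpow_sub_one hs'.ne']
      field_simp
    have h2 : 1 ≤ (s / N) ^ (γ - 1) :=
      Real.one_le_rpow ((one_le_div hN).2 h) (by linarith)
    rw [h1, min_eq_right h]
    nlinarith

/-- A lower bound for the truncated density. -/
lemma exists_le_integral_min {P : Params} (hP : P.Valid) (hD : D.Admissible) {M C : ℝ} (hM : 0 < M) :
    ∃ N, 0 < N ∧ ∀ (S : DWFields d) (t : ℝ), RegularSlice P D S M C t →
      M / 2 ≤ ∫ x in D.cell, min (max (S.ρ t x) 0) N := by
  have := Domain.isFiniteMeasure_spaceMeasure hD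
  have hlim : Tendsto (fun N : ℝ => N ^ (1 - P.γ) * C) atTop (𝓝 0) := by
    have := (tendsto_rpow_neg_atTop (sub_pos.2 hP.one_lt_γ)).mul_const C
    simpa only [neg_sub, zero_mul] using this
  -- The level is chosen so that truncation loses less than half of the mass; Poincaré's inequality
  -- needs a bounded weight.
  obtain ⟨N, hN1, hN⟩ := ((hlim.eventually_lt_const (half_pos hM)).and
    (eventually_gt_atTop (0 : ℝ))).exists
  refine ⟨N, hN, fun S t h => ?_⟩
  have hmin : Integrable (fun x => min (max (S.ρ t x) 0) N) D.spaceMeasure := by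
    refine Integrable.of_bound ((h.flow.density.1.sup aestronglyMeasurable_const).inf
      aestronglyMeasurable_const) N (.of_forall fun x => ?_)
    rw [Real.norm_of_nonneg (le_min (le_max_right _ _) hN.le)]
    exact min_le_right _ _
  have h1 : ∫ x, S.ρ t x ∂D.spaceMeasure
      ≤ ∫ x, (min (max (S.ρ t x) 0) N + N ^ (1 - P.γ) * S.ρ t x ^ P.γ) ∂D.spaceMeasure := by
    refine integral_mono_ae h.flow.density (hmin.add (h.flow.rpow.const_mul _)) ?_
    filter_upwards [h.flow.nonneg] with x hx
    simpa only [max_eq_left hx] using le_min_add_rpow hP.one_lt_γ hx hN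
  rw [integral_add hmin (h.flow.rpow.const_mul _), integral_const_mul] at h1
  have h3 : M = ∫ x, S.ρ t x ∂D.spaceMeasure := h.mass.symm
  have h2 : N ^ (1 - P.γ) * ∫ x, S.ρ t x ^ P.γ ∂D.spaceMeasure ≤ N ^ (1 - P.γ) * C := by
    gcongr; exact h.rpow_le
  have h4 : M / 2 ≤ ∫ x, min (max (S.ρ t x) 0) N ∂D.spaceMeasure := by linarith
  exact h4

/-- The production of relative energy is controlled by the relative energy. -/
theorem StrongSolution.exists_production_le (hd : d = 2 ∨ d = 3) {P : Params} (hP : P.Valid)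
    (hD : D.Admissible) {T c : ℝ} {r : ℝ → Vec d → ℝ} {v b : ℝ → Vec d → Vec d}
    (h : StrongSolution P D T c r v b) {M C₀ : ℝ} (hM : 0 < M) :
    ∃ C, 0 ≤ C ∧ ∀ (S : DWFields d) (t : ℝ), t ∈ Ioo 0 T → D.W0 (v t) (jacobian (v t)) →
      RegularSlice P D S M C₀ t → Integrable (production P S r v b t) D.spaceMeasure →
      Integrable (relEnergyAt P S r v b t) D.spaceMeasure →
      ∫ x in D.cell, production P S r v b t x ≤ C * ∫ x in D.cell, relEnergyAt P S r v b t x := by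
  have := Domain.isFiniteMeasure_spaceMeasure hD
  have hd2 : 2 ≤ d := by omega
  have hu1 : ContDiff ℝ 1 fun z : ℝ × Vec d => v z.1 z.2 := h.u_reg.1.of_le one_le_two
  have hjac : ContDiff ℝ 1 fun z : ℝ × Vec d => jacobian (v z.1) z.2 :=
    contDiff_joint_jacobian h.u_reg.1
  have hstr : ContDiff ℝ 1 fun z : ℝ × Vec d => stress P (jacobian (v z.1) z.2) :=
    contDiff_stress P hjac
  have hcurl : ContDiff ℝ 1 fun z : ℝ × Vec d => curl (fun y => pad (b z.1 y)) z.2 :=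
    contDiff_joint_curl (n := 1) (F := fun t y => pad (b t y)) (contDiff_pad h.b_reg.1)
  obtain ⟨K₁, hK₁, k1⟩ := exists_norm_le_closed_cylinder hD T hu1.continuous
  obtain ⟨K₂, hK₂, k2⟩ := exists_norm_le_closed_cylinder hD T h.b_reg.1.continuous
  obtain ⟨K₃, hK₃, k3⟩ := exists_norm_le_closed_cylinder hD T
    (contDiff_joint_matDivergence (n := 0) (A := fun t x => stress P (jacobian (v t) x))
      hstr).continuous
  obtain ⟨K₄, hK₄, k4⟩ := exists_norm_le_closed_cylinder hD T hjac.continuous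
  obtain ⟨K₅, hK₅, k5⟩ := exists_norm_le_closed_cylinder hD T
    (contDiff_joint_divergence (n := 0) hu1).continuous
  obtain ⟨K₆, hK₆, k6⟩ := exists_norm_le_closed_cylinder hD T hcurl.continuous
  obtain ⟨R, hR, k7⟩ := exists_norm_le_closed_cylinder hD T h.r_reg.1.continuous
  obtain ⟨N, hN, hmin⟩ := exists_le_integral_min (C := C₀) hP hD hM
  obtain ⟨CP, hCP, poin⟩ := Domain.W0.poincare hd2 hD (half_pos hM) hN.le
  -- With this δ, Poincaré's inequality gives δ ∫|u − v|² ≤ μ(∫|∇u − ∇v|² + 2E). Korn's inequality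
  -- absorbs the first term into the viscous dissipation, and 2μE enters the final constant.
  have hδ : 0 < P.μ / (CP + 1) := div_pos hP.μ_pos (by positivity)
  obtain ⟨C₁, hC₁, rem⟩ := exists_remainder_bound hd hP (R := R)
    (K := K₁ + K₂ + K₃ + K₄ + K₅ + K₆) h.c_pos (by positivity) hδ
  refine ⟨C₁ + 2 * P.μ, by have := hP.μ_pos; positivity, fun S t ht hv hS hprod hen => ?_⟩
  have ht' := Ioo_subset_Icc_self ht
  have hvt := contDiff_slice h.u_reg.1 t
  have hbt := contDiff_slice h.b_reg.1 t
  have hrt := contDiff_slice h.r_reg.1 t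
  have hw := hS.w0.sub hD hv
  have hA : ContDiff ℝ 1 fun y => stress P (jacobian (v t) y) := contDiff_slice
    (f := fun t y => stress P (jacobian (v t) y)) hstr t
  have hAp : D.Periodic fun y => stress P (jacobian (v t) y) :=
    (h.u_reg.2 t).jacobian.comp (stress P)
  have hq : ContDiff ℝ 1 fun y => pressure P (r t y) • idMat d :=
    (contDiff_pressure_comp P hrt (h.r_pos t)).smul contDiff_const
  have hqp : D.Periodic fun y => pressure P (r t y) • idMat d :=
    (h.r_reg.2 t).comp fun s => pressure P s • idMat d
  have hF : ContDiff ℝ 1 fun y => cross (pad (v t y)) (pad (b t y))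
      - P.α • curl (fun y => pad (b t y)) y :=
    (contDiff_cross (contDiff_pad (hvt.of_le one_le_two)) (contDiff_pad (hbt.of_le one_le_two))).sub
      ((contDiff_curl (n := 1) (contDiff_pad hbt)).const_smul P.α)
  have hFp : D.Periodic fun y => cross (pad (v t y)) (pad (b t y))
      - P.α • curl (fun y => pad (b t y)) y :=
    ((h.u_reg.2 t).comp₂ (h.b_reg.2 t) fun x y => cross (pad x) (pad y)).comp₂
      ((h.b_reg.2 t).comp pad).curl fun x y => x - P.α • y
  set Dt : Vec d → ℝ := fun x => inner ℝ (stress P (S.gradU t x - jacobian (v t) x))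
    (S.gradU t x - jacobian (v t) x)
  -- The three functions integrate to zero: X₁ by parts for u − v in W₀^{1,2} against the stress of
  -- v, X₂ as the divergence of p(r)v, and X₃ by parts for the curls of b and B, whose tangential
  -- traces vanish.
  set X₁ : Vec d → ℝ := fun x =>
    inner ℝ (stress P (jacobian (v t) x)) (S.gradU t x - jacobian (v t) x)
    + inner ℝ (matDivergence (fun y => stress P (jacobian (v t) y)) x) (S.u t x - v t x) with hX₁
  set X₂ : Vec d → ℝ := fun x => dPressure P (r t x) * inner ℝ (v t x) (gradient (r t) x)
        + pressure P (r t x) * tr (jacobian (v t) x) with hX₂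
  set F : Vec d → Vec 3 := fun y => cross (pad (v t y)) (pad (b t y))
      - P.α • curl (fun y => pad (b t y)) y with hFdef
  set X₃ : Vec d → ℝ := fun x => inner ℝ (pad (b t x - S.B t x)) (curl F x)
    - inner ℝ (curl (fun y => pad (b t y)) x - S.curlB t x) (F x) with hX₃
  have hcb := continuous_curl (contDiff_pad (hbt.of_le one_le_two))
  have hFc := continuous_curl hF
  have hmd := Domain.continuous_matDivergence hA
  have hpbB : MemLp (fun x => pad (b t x - S.B t x)) 2 D.spaceMeasure := by
    simp only [pad_sub]
    exact (Domain.memLp_cell hD (continuous_pad.comp hbt.continuous) 2).sub (hS.flow.padField hd)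
  have hjJ := (Domain.memLp_cell hD hcb 2).sub hS.flow.current
  have c1 : Integrable Dt D.spaceMeasure := integrable_inner
    (MemLp.of_le_mul hw.memLp_grad ((Domain.continuous_stress P).comp_aestronglyMeasurable
      hw.memLp_grad.1) (.of_forall fun x => norm_stress_le P _)) hw.memLp_grad
  have c21 := integrable_inner (Domain.memLp_cell hD hA.continuous 2) hw.memLp_grad
  have c22 := integrable_inner (Domain.memLp_cell hD hmd 2) hw.memLp
  have c2 : Integrable X₁ D.spaceMeasure := c21.add c22
  have c31 : Integrable (fun x => inner ℝ (matDivergence (fun y => pressure P (r t y) • idMat d) x)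
      (v t x)) D.spaceMeasure := integrable_inner
    (Domain.memLp_cell hD (Domain.continuous_matDivergence hq) 2) hv.memLp
  have c32 : Integrable (fun x => inner ℝ (pressure P (r t x) • idMat d) (jacobian (v t) x))
      D.spaceMeasure := integrable_inner (Domain.memLp_cell hD hq.continuous 2) hv.memLp_grad
  have eX₂ : X₂ = fun x => inner ℝ (matDivergence (fun y => pressure P (r t y) • idMat d) x) (v t x)
      + inner ℝ (pressure P (r t x) • idMat d) (jacobian (v t) x) := by
    ext x
    have h2 : HasFDerivAt (fun y => pressure P (r t y)) (dPressure P (r t x) • fderiv ℝ (r t) x) x :=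
      HasDerivAt.comp_hasFDerivAt (h₂ := pressure P) x (hasDerivAt_pressure P (h.r_pos t x))
        (hrt.differentiable one_ne_zero x).hasFDerivAt
    rw [matDivergence_smul_idMat, real_inner_comm, inner_gradient, h2.fderiv, real_inner_smul_left,
      inner_idMat]
    simp only [hX₂, inner_gradient]
    rfl
  have c3 : Integrable X₂ D.spaceMeasure := by rw [eX₂]; exact c31.add c32
  have c41 := integrable_inner hpbB (Domain.memLp_cell hD hFc 2)
  have c42 := integrable_inner hjJ (Domain.memLp_cell hD hF.continuous 2)
  have c4 : Integrable X₃ D.spaceMeasure := c41.sub c42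
  have z2 : ∫ x, X₁ x ∂D.spaceMeasure = 0 := by
    have e1 := hw.integral_inner hD hA hAp
    have e2 : ∫ x, X₁ x ∂D.spaceMeasure = _ := integral_add c21 c22
    rw [e2]
    exact add_eq_zero_iff_eq_neg.2 e1
  have z3 : ∫ x, X₂ x ∂D.spaceMeasure = 0 := by
    have e1 := hv.integral_inner hD hq hqp
    rw [eX₂, integral_add c31 c32, add_comm]
    exact add_eq_zero_iff_eq_neg.2 e1
  have z4 : ∫ x, X₃ x ∂D.spaceMeasure = 0 := by
    have e1 := Domain.integral_inner_curl_of_noTangentialPart hd hD (hbt.of_le one_le_two)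
      (h.b_reg.2 t) (h.b_bc t ht') hF hFp
    have e2 := Domain.HasSobolevCurl.integral_inner hd hD hS.curl hS.flow.field hS.flow.current
      hF hFp
    have d1 := integrable_inner (Domain.memLp_cell hD hcb 2) (Domain.memLp_cell hD hF.continuous 2)
    have d2 := integrable_inner hS.flow.current (Domain.memLp_cell hD hF.continuous 2)
    have d3 := integrable_inner (Domain.memLp_cell hD (continuous_pad.comp hbt.continuous) 2)
      (Domain.memLp_cell hD hFc 2)
    have d4 := integrable_inner (hS.flow.padField hd) (Domain.memLp_cell hD hFc 2)
    have e3 : X₃ = fun x => (inner ℝ (pad (b t x)) (curl F x) - inner ℝ (pad (S.B t x)) (curl F x))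
        - (inner ℝ (curl (fun y => pad (b t y)) x) (F x) - inner ℝ (S.curlB t x) (F x)) := by
      ext x
      simp only [hX₃, pad_sub, inner_sub_left]
    have e4 : ∫ x, X₃ x ∂D.spaceMeasure
        = (∫ x, inner ℝ (pad (b t x)) (curl F x) ∂D.spaceMeasure
          - ∫ x, inner ℝ (pad (S.B t x)) (curl F x) ∂D.spaceMeasure)
        - (∫ x, inner ℝ (curl (fun y => pad (b t y)) x) (F x) ∂D.spaceMeasure
          - ∫ x, inner ℝ (S.curlB t x) (F x) ∂D.spaceMeasure) := by
      rw [e3]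
      exact (integral_sub (d3.sub d4) (d1.sub d2)).trans
        (congrArg₂ _ (integral_sub d3 d4) (integral_sub d1 d2))
    rw [e4]
    have e1' : ∫ x, inner ℝ (curl (fun y => pad (b t y)) x) (F x) ∂D.spaceMeasure
      = ∫ x, inner ℝ (pad (b t x)) (curl F x) ∂D.spaceMeasure := e1
    have e2' : ∫ x, inner ℝ (S.curlB t x) (F x) ∂D.spaceMeasure
      = ∫ x, inner ℝ (pad (S.B t x)) (curl F x) ∂D.spaceMeasure := e2
    rw [e1', e2']; ring
  have hmem : ∀ᵐ x ∂D.spaceMeasure, x ∈ D.cell := ae_restrict_mem (Domain.measurableSet_cell hD)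
  have hsq : Integrable (fun x => ‖S.u t x - v t x‖ ^ 2) D.spaceMeasure :=
    hw.memLp.integrable_norm_pow two_ne_zero
  have hup : Integrable (fun x => (C₁ * relEnergyAt P S r v b t x
      + P.μ / (CP + 1) * ‖S.u t x - v t x‖ ^ 2) - Dt x - X₁ x - X₂ x + X₃ x) D.spaceMeasure :=
    (((((hen.const_mul C₁).add (hsq.const_mul _)).sub c1).sub c2).sub c3).add c4
  have hle : ∫ x, production P S r v b t x ∂D.spaceMeasure ≤
      C₁ * (∫ x, relEnergyAt P S r v b t x ∂D.spaceMeasure)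
        + P.μ / (CP + 1) * (∫ x, ‖S.u t x - v t x‖ ^ 2 ∂D.spaceMeasure)
        - ∫ x, Dt x ∂D.spaceMeasure := by
    have e : ∫ x, ((C₁ * relEnergyAt P S r v b t x
      + P.μ / (CP + 1) * ‖S.u t x - v t x‖ ^ 2) - Dt x - X₁ x - X₂ x + X₃ x) ∂D.spaceMeasure
      = C₁ * (∫ x, relEnergyAt P S r v b t x ∂D.spaceMeasure)
        + P.μ / (CP + 1) * (∫ x, ‖S.u t x - v t x‖ ^ 2 ∂D.spaceMeasure)
        - ∫ x, Dt x ∂D.spaceMeasure := by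
      rw [integral_add, integral_sub, integral_sub, integral_sub, integral_add, integral_const_mul,
        integral_const_mul, z2, z3, z4]
      · ring
      · exact hen.const_mul C₁
      · exact hsq.const_mul _
      · exact (hen.const_mul C₁).add (hsq.const_mul _)
      · exact c1
      · exact ((hen.const_mul C₁).add (hsq.const_mul _)).sub c1
      · exact c2
      · exact (((hen.const_mul C₁).add (hsq.const_mul _)).sub c1).sub c2
      · exact c3
      · exact ((((hen.const_mul C₁).add (hsq.const_mul _)).sub c1).sub c2).sub c3
      · exact c4
    rw [← e]
    refine integral_mono_ae hprod hup ?_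
    filter_upwards [hmem, hS.flow.nonneg] with x hx hρ
    have hx' := subset_closure hx
    have hK1 := k1 t ht' x hx'
    have hK2 := k2 t ht' x hx'
    have hK3 := k3 t ht' x hx'
    have hK4 := k4 t ht' x hx'
    have hK5 := k5 t ht' x hx'
    have hK6 := k6 t ht' x hx'
    have hr := (le_abs_self _).trans (k7 t ht' x hx')
    simp only [] at hK1 hK2 hK3 hK4 hK5 hK6 hr
    have hrem := rem (S.ρ t x) (r t x) (S.u t x) (v t x) (S.B t x) (b t x)
      (matDivergence (fun y => stress P (jacobian (v t) y)) x) (jacobian (v t) x) (S.curlB t x)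
      (curl (fun y => pad (b t y)) x) hρ ⟨h.le_r t x, hr⟩ (by linarith) (by linarith) (by linarith)
      (by linarith) (by rw [tr_jacobian, ← Real.norm_eq_abs]; linarith) (by linarith)
    have heq := h.production_eq hd hP S ht hx
    rw [heq]
    have hrem' : remainder P S r v b t x ≤ C₁ * relEnergyAt P S r v b t x
      + P.μ / (CP + 1) * ‖S.u t x - v t x‖ ^ 2 := hrem
    simp only [Dt, X₁, X₂, X₃, F]
    linarith
  have hkorn := hw.korn hd2 hD hP
  have hpoin := poin (fun x => min (max (S.ρ t x) 0) N)
    ((hS.flow.density.1.sup aestronglyMeasurable_const).inf aestronglyMeasurable_const)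
    (fun x => ⟨le_min (le_max_right _ _) hN.le, min_le_right _ _⟩) (hmin S t hS) _ _ hw
  have hkin : ∫ x, min (max (S.ρ t x) 0) N * ‖S.u t x - v t x‖ ^ 2 ∂D.spaceMeasure
      ≤ 2 * ∫ x, relEnergyAt P S r v b t x ∂D.spaceMeasure := by
    rw [← integral_const_mul]
    refine integral_mono_of_nonneg (.of_forall fun x => ?_) (hen.const_mul 2) ?_
    · exact mul_nonneg (le_min (le_max_right _ _) hN.le) (sq_nonneg _)
    · filter_upwards [hS.flow.nonneg] with x hx
      have h1 : min (max (S.ρ t x) 0) N ≤ S.ρ t x := by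
        rw [max_eq_left hx]; exact min_le_left _ _
      have h2 := mul_le_mul_of_nonneg_right h1 (sq_nonneg ‖S.u t x - v t x‖)
      have h3 := relPotential_nonneg hP hx (h.r_pos t x)
      have h4 := sq_nonneg ‖S.B t x - b t x‖
      simp only [relEnergyAt, relEnergy]
      linarith
  simp only [real_inner_self_eq_norm_sq] at hkorn
  set E := ∫ x, relEnergyAt P S r v b t x ∂D.spaceMeasure
  set A := ∫ x, ‖S.u t x - v t x‖ ^ 2 ∂D.spaceMeasure
  have hkorn' : P.μ * ∫ x, ‖S.gradU t x - jacobian (v t) x‖ ^ 2 ∂D.spaceMeasure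
    ≤ ∫ x, Dt x ∂D.spaceMeasure := hkorn
  have hpoin' : A ≤ CP * ((∫ x, ‖S.gradU t x - jacobian (v t) x‖ ^ 2 ∂D.spaceMeasure)
    + ∫ x, min (max (S.ρ t x) 0) N * ‖S.u t x - v t x‖ ^ 2 ∂D.spaceMeasure) := hpoin
  set g := ∫ x, ‖S.gradU t x - jacobian (v t) x‖ ^ 2 ∂D.spaceMeasure
  have hg0 : 0 ≤ g := integral_nonneg fun x => sq_nonneg _
  have hE0 : 0 ≤ E := by
    have : 0 ≤ ∫ x, min (max (S.ρ t x) 0) N * ‖S.u t x - v t x‖ ^ 2 ∂D.spaceMeasure :=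
      integral_nonneg fun x => mul_nonneg (le_min (le_max_right _ _) hN.le) (sq_nonneg _)
    linarith
  have h1 : A ≤ (CP + 1) * (g + 2 * E) := by nlinarith
  have h2 : P.μ / (CP + 1) * A ≤ P.μ * (g + 2 * E) := by
    calc _ ≤ P.μ / (CP + 1) * ((CP + 1) * (g + 2 * E)) := by gcongr
      _ = _ := by field_simp
  change ∫ x, production P S r v b t x ∂D.spaceMeasure ≤ (C₁ + 2 * P.μ) * E
  linarith

end

end MHD

namespace MHD
noncomputable section

/-! ### Integrability of dissipative weak solutions -/

/-! ### Norms on the cylinder and on its time slices -/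

section Slices

variable {X Y F : Type*} [MeasurableSpace X] [MeasurableSpace Y] {μ : Measure X} {ν : Measure Y}
  [SFinite ν] [NormedAddCommGroup F]

lemma MemLp.ae_slice [SFinite μ] {f : X × Y → F} (hf : MemLp f 2 (μ.prod ν)) :
    ∀ᵐ x ∂μ, MemLp (fun y => f (x, y)) 2 ν := by
  have h1 := (hf.integrable_norm_pow two_ne_zero).prod_right_ae
  filter_upwards [h1, hf.1.prodMk_left] with x h1 h2
  exact (memLp_two_iff_integrable_sq_norm h2).2 h1

lemma memLp_prod_of_forall_eLpNorm_le [IsFiniteMeasure μ] {p : ENNReal} (hp0 : p ≠ 0) (hp : p ≠ ⊤)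
    {f : X × Y → F} (hf : AEStronglyMeasurable f (μ.prod ν)) {C : NNReal}
    (h : ∀ᵐ x ∂μ, eLpNorm (fun y => f (x, y)) p ν ≤ C) : MemLp f p (μ.prod ν) := by
  refine ⟨hf, ?_⟩
  rw [eLpNorm_lt_top_iff_lintegral_rpow_enorm_lt_top hp0 hp, lintegral_prod _ (hf.enorm.pow_const _)]
  have hpos : 0 < p.toReal := ENNReal.toReal_pos hp0 hp
  calc ∫⁻ x, ∫⁻ y, ‖f (x, y)‖ₑ ^ p.toReal ∂ν ∂μ
      ≤ ∫⁻ _, (C : ENNReal) ^ p.toReal ∂μ := by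
        refine lintegral_mono_ae ?_
        filter_upwards [h] with x hx
        rw [eLpNorm_eq_lintegral_rpow_enorm_toReal hp0 hp] at hx
        have := ENNReal.rpow_le_rpow hx hpos.le
        rwa [← ENNReal.rpow_mul, one_div, inv_mul_cancel₀ hpos.ne', ENNReal.rpow_one] at this
    _ < ⊤ := by
        rw [lintegral_const]
        exact ENNReal.mul_lt_top (ENNReal.rpow_lt_top_of_nonneg hpos.le ENNReal.coe_ne_top)
          (measure_lt_top _ _)

end Slices

variable {d : ℕ} {D : Domain d}

lemma isFiniteMeasure_timeMeasure (T : ℝ) : IsFiniteMeasure (timeMeasure T) := by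
  unfold timeMeasure; infer_instance

lemma isFiniteMeasure_cylMeasure (hD : D.Admissible) (T : ℝ) : IsFiniteMeasure (cylMeasure D T) := by
  have := Domain.isFiniteMeasure_spaceMeasure hD
  have := isFiniteMeasure_timeMeasure T
  unfold cylMeasure; infer_instance

lemma ae_mem_cylinder (hD : D.Admissible) (T : ℝ) :
    ∀ᵐ z ∂cylMeasure D T, z ∈ Ioo 0 T ×ˢ D.cell := by
  rw [cylMeasure_eq]
  exact ae_restrict_mem (measurableSet_Ioo.prod (Domain.measurableSet_cell hD))

lemma memLp_cyl (hD : D.Admissible) (T : ℝ) {F : Type*} [NormedAddCommGroup F]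
    {f : ℝ × Vec d → F} (hf : Continuous f) (p : ENNReal) : MemLp f p (cylMeasure D T) := by
  have := isFiniteMeasure_cylMeasure hD T
  obtain ⟨K, -, hK⟩ := exists_norm_le_closed_cylinder hD T hf
  refine MemLp.of_bound hf.aestronglyMeasurable K ?_
  filter_upwards [ae_mem_cylinder hD T] with z hz
  exact hK z.1 (Ioo_subset_Icc_self hz.1) z.2 (subset_closure hz.2)

lemma MemLinftyLp.memLp (hD : D.Admissible) {T : ℝ} {F : Type*} [NormedAddCommGroup F]
    {p : ENNReal} (hp0 : p ≠ 0) (hp : p ≠ ⊤) {f : ℝ → Vec d → F} (h : MemLinftyLp D T p f) :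
    MemLp (fun z : ℝ × Vec d => f z.1 z.2) p (cylMeasure D T) := by
  have := Domain.isFiniteMeasure_spaceMeasure hD
  have := isFiniteMeasure_timeMeasure T
  obtain ⟨hm, C, hC⟩ := h
  exact memLp_prod_of_forall_eLpNorm_le hp0 hp hm hC

section DW

variable {P : Params} {T : ℝ} {ρ₀ : Vec d → ℝ} {m₀ B₀ : Vec d → Vec d} {S : DWFields d}

lemma IsDWSolution.flowIntegrable (hP : P.Valid) (hD : D.Admissible)
    (h : IsDWSolution P D T ρ₀ m₀ B₀ S) :
    FlowIntegrable P (cylMeasure D T) (fun z => S.ρ z.1 z.2) (fun z => S.u z.1 z.2)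
      (fun z => S.gradU z.1 z.2) (fun z => S.B z.1 z.2) (fun z => S.curlB z.1 z.2) := by
  have := isFiniteMeasure_cylMeasure hD T
  have hγ : 0 < P.γ := by linarith [hP.one_lt_γ]
  have hγ0 : ENNReal.ofReal P.γ ≠ 0 := by simpa using hγ
  have hρ : MemLp (fun z : ℝ × Vec d => S.ρ z.1 z.2) (ENNReal.ofReal P.γ) (cylMeasure D T) :=
    h.ρ_mem.memLp hD hγ0 ENNReal.ofReal_ne_top
  have hk := h.sqrtρ_u_mem.memLp hD two_ne_zero ENNReal.ofNat_ne_top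
  have hρ1 : Integrable (fun z : ℝ × Vec d => S.ρ z.1 z.2) (cylMeasure D T) :=
    hρ.integrable (by rw [← ENNReal.ofReal_one]; exact ENNReal.ofReal_le_ofReal hP.one_lt_γ.le)
  have hkin : Integrable (fun z : ℝ × Vec d => S.ρ z.1 z.2 * ‖S.u z.1 z.2‖ ^ 2) (cylMeasure D T) := by
    refine (hk.integrable_norm_pow two_ne_zero).congr ?_
    filter_upwards [h.ρ_nonneg] with z hz
    rw [norm_smul, mul_pow, Real.norm_of_nonneg (Real.sqrt_nonneg _), Real.sq_sqrt hz]
  refine ⟨h.ρ_nonneg, hρ1, ?_, ?_, hkin, h.u_mem, h.gradU_mem,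
    h.B_mem.memLp hD two_ne_zero ENNReal.ofNat_ne_top, h.curlB_mem⟩
  · refine (hρ.integrable_norm_rpow hγ0 ENNReal.ofReal_ne_top).congr ?_
    filter_upwards [h.ρ_nonneg] with z hz
    rw [Real.norm_of_nonneg hz, ENNReal.toReal_ofReal hγ.le]
  -- ρ|u| ≤ ½(ρ + ρ|u|²).
  · refine ((hρ1.add hkin).const_mul (1 / 2)).mono' (hρ1.1.smul h.u_mem.1) ?_
    filter_upwards [h.ρ_nonneg] with z hz
    rw [norm_smul, Real.norm_of_nonneg hz, Pi.add_apply]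
    nlinarith [mul_nonneg hz (sq_nonneg (‖S.u z.1 z.2‖ - 1))]

lemma FlowIntegrable.ae_slice {X Y : Type*} [MeasurableSpace X] [MeasurableSpace Y] {μ : Measure X}
    {ν : Measure Y} [SFinite μ] [SFinite ν] {ρ : X × Y → ℝ} {u : X × Y → Vec d} {G : X × Y → Mat d}
    {B : X × Y → Vec d} {J : X × Y → Vec 3} (h : FlowIntegrable P (μ.prod ν) ρ u G B J) :
    ∀ᵐ x ∂μ, FlowIntegrable P ν (fun y => ρ (x, y)) (fun y => u (x, y)) (fun y => G (x, y))
      (fun y => B (x, y)) (fun y => J (x, y)) := by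
  filter_upwards [Measure.ae_ae_of_ae_prod h.nonneg, h.density.prod_right_ae, h.rpow.prod_right_ae,
    h.momentum.prod_right_ae, h.kinetic.prod_right_ae, MemLp.ae_slice h.vel, MemLp.ae_slice h.grad,
    MemLp.ae_slice h.field, MemLp.ae_slice h.current] with x a1 a2 a3 a4 a5 a6 a7 a8 a9
  exact ⟨a1, a2, a3, a4, a5, a6, a7, a8, a9⟩

lemma gradient_const' (a : ℝ) (x : Vec d) : gradient (fun _ : Vec d => a) x = 0 := by
  simp [gradient]

lemma IsDWSolution.exists_regularSlice (hP : P.Valid) (hD : D.Admissible)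
    (h : IsDWSolution P D T ρ₀ m₀ B₀ S) :
    ∃ C, ∀ᵐ t ∂timeMeasure T, RegularSlice P D S (∫ x in D.cell, ρ₀ x) C t := by
  have := Domain.isFiniteMeasure_spaceMeasure hD
  have := isFiniteMeasure_timeMeasure T
  have hγ : 0 < P.γ := by linarith [hP.one_lt_γ]
  have hγ0 : ENNReal.ofReal P.γ ≠ 0 := by simpa using hγ
  obtain ⟨-, C, hC⟩ := h.ρ_mem
  have hper : D.Periodic fun _ : Vec d => (1 : ℝ) := by
    cases D with
    | wall Ω => trivial
    | torus => exact fun _ _ => rfl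
  -- Testing the continuity equation with the constant 1 gives conservation of mass.
  have hmass := h.continuity (fun _ _ => 1) ⟨contDiff_const, fun _ => hper⟩
  have hmeas : ∀ᵐ t ∂timeMeasure T, AEStronglyMeasurable (S.ρ t) D.spaceMeasure :=
    h.ρ_mem.1.prodMk_left
  refine ⟨(C : ℝ) ^ P.γ, ?_⟩
  filter_upwards [(h.flowIntegrable hP hD).ae_slice, h.u_sobolev, h.B_sobolev, hmass, hC, hmeas]
    with t h1 h2 h3 h4 h5 h6
  refine ⟨h1, h2.w0 h1.vel h1.grad, h3, ?_, ?_⟩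
  · simp only [timeD, gradient_const', deriv_const, mul_zero, inner_zero_right, add_zero,
      integral_zero, intervalIntegral.integral_zero, mul_one] at h4
    linarith
  · have hm : MemLp (S.ρ t) (ENNReal.ofReal P.γ) D.spaceMeasure :=
      ⟨h6, h5.trans_lt ENNReal.coe_lt_top⟩
    have e : ∫ x in D.cell, S.ρ t x ^ P.γ = ∫ x, ‖S.ρ t x‖ ^ P.γ ∂D.spaceMeasure := by
      refine integral_congr_ae ?_
      filter_upwards [h1.nonneg] with x hx
      rw [Real.norm_of_nonneg hx]
    rw [hm.eLpNorm_eq_integral_rpow_norm hγ0 ENNReal.ofReal_ne_top,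
      ENNReal.toReal_ofReal hγ.le] at h5
    have hI : 0 ≤ ∫ x, ‖S.ρ t x‖ ^ P.γ ∂D.spaceMeasure := integral_nonneg fun x => by positivity
    have h7 : (∫ x, ‖S.ρ t x‖ ^ P.γ ∂D.spaceMeasure) ^ P.γ⁻¹ ≤ C := by
      have := ENNReal.toReal_mono ENNReal.coe_ne_top h5
      rwa [ENNReal.toReal_ofReal (by positivity), ENNReal.coe_toReal] at this
    rw [e]
    calc _ = ((∫ x, ‖S.ρ t x‖ ^ P.γ ∂D.spaceMeasure) ^ P.γ⁻¹) ^ P.γ := by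
          rw [← Real.rpow_mul hI, inv_mul_cancel₀ hγ.ne', Real.rpow_one]
      _ ≤ _ := by gcongr

lemma continuous_gradient_slice {f : ℝ → Vec d → ℝ}
    (hf : ContDiff ℝ 1 fun z : ℝ × Vec d => f z.1 z.2) :
    Continuous fun z : ℝ × Vec d => gradient (f z.1) z.2 :=
  (InnerProductSpace.toDual ℝ (Vec d)).symm.continuous.comp
    (contDiff_fderiv_slice (n := 0) hf).continuous

lemma continuous_joint_curl {b : ℝ → Vec d → Vec d}
    (hb : ContDiff ℝ 1 fun z : ℝ × Vec d => b z.1 z.2) :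
    Continuous fun z : ℝ × Vec d => curl (fun y => pad (b z.1 y)) z.2 :=
  (contDiff_joint_curl (n := 0) (F := fun t y => pad (b t y)) (contDiff_pad hb)).continuous

lemma IsDWSolution.integrable_dissipation (hP : P.Valid) (hD : D.Admissible)
    (h : IsDWSolution P D T ρ₀ m₀ B₀ S) :
    Integrable (fun z : ℝ × Vec d => dissipation P S z.1 z.2) (cylMeasure D T) :=
  (h.flowIntegrable hP hD).dissipation

lemma IsDWSolution.integrable_continuity (hP : P.Valid) (hD : D.Admissible)
    (h : IsDWSolution P D T ρ₀ m₀ B₀ S) {φ : ℝ → Vec d → ℝ}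
    (hφ : ContDiff ℝ 1 fun z : ℝ × Vec d => φ z.1 z.2) :
    Integrable (fun z : ℝ × Vec d => continuityIntegrand S φ z.1 z.2) (cylMeasure D T) :=
  (h.flowIntegrable hP hD).continuityIntegrand
    (memLp_cyl hD T (contDiff_timeD (n := 0) hφ).continuous ⊤)
    (memLp_cyl hD T (continuous_gradient_slice hφ) ⊤)

lemma IsDWSolution.integrable_momentum (hd : d = 2 ∨ d = 3) (hP : P.Valid) (hD : D.Admissible)
    (h : IsDWSolution P D T ρ₀ m₀ B₀ S) {φ : ℝ → Vec d → Vec d}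
    (hφ : ContDiff ℝ 1 fun z : ℝ × Vec d => φ z.1 z.2) :
    Integrable (fun z : ℝ × Vec d => momentumIntegrand P S φ z.1 z.2) (cylMeasure D T) :=
  (h.flowIntegrable hP hD).momentumIntegrand hd
    (memLp_cyl hD T (contDiff_timeD (n := 0) hφ).continuous ⊤)
    (memLp_cyl hD T hφ.continuous ⊤)
    (memLp_cyl hD T (contDiff_joint_jacobian (n := 0) hφ).continuous ⊤)
    (memLp_cyl hD T (contDiff_joint_jacobian (n := 0) hφ).continuous 2)
    (memLp_cyl hD T (contDiff_joint_divergence (n := 0) hφ).continuous ⊤)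

lemma IsDWSolution.integrable_maxwell (hd : d = 2 ∨ d = 3) (hP : P.Valid) (hD : D.Admissible)
    (h : IsDWSolution P D T ρ₀ m₀ B₀ S) {φ : ℝ → Vec d → Vec d}
    (hφ : ContDiff ℝ 1 fun z : ℝ × Vec d => φ z.1 z.2) :
    Integrable (fun z : ℝ × Vec d => maxwellIntegrand P S φ z.1 z.2) (cylMeasure D T) :=
  (h.flowIntegrable hP hD).maxwellIntegrand hd
    (memLp_cyl hD T (contDiff_timeD (n := 0) hφ).continuous 2)
    (memLp_cyl hD T (continuous_joint_curl hφ) ⊤) (memLp_cyl hD T (continuous_joint_curl hφ) 2)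

/-- The rate of change of the energy of the magnetic field and of the pressure of the strong
solution. -/
def strongRate (P : Params) (r : ℝ → Vec d → ℝ) (b : ℝ → Vec d → Vec d) (t : ℝ) (x : Vec d) : ℝ :=
  inner ℝ (b t x) (timeD b t x) + dPressure P (r t x) * timeD r t x

variable {c : ℝ} {r : ℝ → Vec d → ℝ} {v b : ℝ → Vec d → Vec d}

lemma StrongSolution.continuous_strongRate (h : StrongSolution P D T c r v b) :
    Continuous fun z : ℝ × Vec d => strongRate P r b z.1 z.2 :=
  (h.b_reg.1.continuous.inner
    (contDiff_timeD (n := 0) (h.b_reg.1.of_le one_le_two)).continuous).add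
    ((contDiff_dPressure_comp P h.r_reg.1 fun z => h.r_pos z.1 z.2).continuous.mul
      (contDiff_timeD (n := 0) h.r_reg.1).continuous)

lemma IsDWSolution.integrable_production (hd : d = 2 ∨ d = 3) (hP : P.Valid) (hD : D.Admissible)
    (h : IsDWSolution P D T ρ₀ m₀ B₀ S) (hs : StrongSolution P D T c r v b) :
    Integrable (fun z : ℝ × Vec d => production P S r v b z.1 z.2) (cylMeasure D T) := by
  have e : ∀ t x, production P S r v b t x = -dissipation P S t x - momentumIntegrand P S v t x
      + continuityIntegrand S (relTest P r v) t x - maxwellIntegrand P S b t x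
      + strongRate P r b t x := fun t x => by
    unfold production strongRate; ring
  simp only [e]
  have := isFiniteMeasure_cylMeasure hD T
  exact ((((h.integrable_dissipation hP hD).neg.sub
    (h.integrable_momentum hd hP hD (hs.u_reg.1.of_le one_le_two))).add
    (h.integrable_continuity hP hD hs.relTest_reg.1)).sub
    (h.integrable_maxwell hd hP hD (hs.b_reg.1.of_le one_le_two))).add
    ((memLp_cyl hD T hs.continuous_strongRate 1).integrable le_rfl)

lemma IsDWSolution.integrable_relEnergy (hP : P.Valid) (hD : D.Admissible)
    (h : IsDWSolution P D T ρ₀ m₀ B₀ S) (hs : StrongSolution P D T c r v b) :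
    Integrable (fun z : ℝ × Vec d => relEnergyAt P S r v b z.1 z.2) (cylMeasure D T) := by
  have := isFiniteMeasure_cylMeasure hD T
  have hpos : ∀ z : ℝ × Vec d, 0 < r z.1 z.2 := fun z => hs.r_pos z.1 z.2
  exact (h.flowIntegrable hP hD).relEnergy (memLp_cyl hD T hs.u_reg.1.continuous ⊤)
    (memLp_cyl hD T hs.b_reg.1.continuous 2) (memLp_cyl hD T hs.r_reg.1.continuous ⊤)
    (memLp_cyl hD T (contDiff_dPotential_comp P hs.r_reg.1 hpos).continuous ⊤)
    (memLp_cyl hD T (contDiff_potential_comp P hs.r_reg.1 hpos).continuous ⊤)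

end DW

end

end MHD

namespace MHD
noncomputable section

/-! ### The relative energy inequality -/

variable {d : ℕ} {D : Domain d}

lemma cylMeasure_mono (D : Domain d) {τ T : ℝ} (h : τ ≤ T) : cylMeasure D τ ≤ cylMeasure D T := by
  rw [cylMeasure_eq, cylMeasure_eq]
  exact Measure.restrict_mono_set _ (prod_mono (Ioo_subset_Ioo_right h) le_rfl)

lemma integral_cyl (hD : D.Admissible) {τ : ℝ} (hτ : 0 ≤ τ) {f : ℝ → Vec d → ℝ}
    (hf : Integrable (fun z : ℝ × Vec d => f z.1 z.2) (cylMeasure D τ)) :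
    ∫ t in (0 : ℝ)..τ, ∫ x in D.cell, f t x = ∫ z, f z.1 z.2 ∂cylMeasure D τ := by
  have := Domain.isFiniteMeasure_spaceMeasure hD
  have := isFiniteMeasure_timeMeasure τ
  rw [intervalIntegral.integral_of_le hτ, integral_Ioc_eq_integral_Ioo]
  exact (integral_prod _ hf).symm

lemma integral_sub_eq_integral_timeD (hD : D.Admissible) {τ : ℝ} (hτ : 0 ≤ τ) {f : ℝ → Vec d → ℝ}
    (hf : ContDiff ℝ 1 fun z : ℝ × Vec d => f z.1 z.2) :
    (∫ x in D.cell, f τ x) - ∫ x in D.cell, f 0 x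
      = ∫ z, timeD f z.1 z.2 ∂cylMeasure D τ := by
  have := Domain.isFiniteMeasure_spaceMeasure hD
  have := isFiniteMeasure_timeMeasure τ
  have := isFiniteMeasure_cylMeasure hD τ
  have hc := (contDiff_timeD (n := 0) hf).continuous
  have hi := (memLp_cyl hD τ hc 1).integrable le_rfl
  rw [← integral_sub (Domain.integrableOn_cell hD (contDiff_slice hf τ).continuous)
    (Domain.integrableOn_cell hD (contDiff_slice hf 0).continuous)]
  refine Eq.trans ?_ (integral_prod_symm _ hi).symm
  refine integral_congr_ae (.of_forall fun x => ?_)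
  have h1 := intervalIntegral.integral_eq_sub_of_hasDerivAt (a := 0) (b := τ)
    (fun t _ => hasDerivAt_timeD hf t x)
    ((hc.comp (Continuous.prodMk_left x)).intervalIntegrable _ _)
  rw [intervalIntegral.integral_of_le hτ, integral_Ioc_eq_integral_Ioo] at h1
  exact h1.symm

section DW

variable {P : Params} {T c : ℝ} {ρ₀ : Vec d → ℝ} {m₀ B₀ : Vec d → Vec d} {S : DWFields d}
  {r : ℝ → Vec d → ℝ} {v b : ℝ → Vec d → Vec d}

lemma norm_momentumIntegrand_le (hd : d = 2 ∨ d = 3) {φ : ℝ → Vec d → Vec d} {t : ℝ} {x : Vec d}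
    {K : ℝ} (h1 : ‖φ t x‖ ≤ K) (h2 : ‖jacobian (φ t) x‖ ≤ K) (h3 : ‖timeD φ t x‖ ≤ K) :
    ‖momentumIntegrand P S φ t x‖ ≤ K * (‖S.ρ t x • S.u t x‖
      + ‖S.ρ t x • outer (S.u t x) (S.u t x)‖ + ‖idMat d‖ * ‖pressure P (S.ρ t x)‖
      + ‖stress P (S.gradU t x)‖ + ‖cross (S.curlB t x) (pad (S.B t x))‖) := by
  have a1 : ‖(inner ℝ (S.ρ t x • S.u t x) (timeD φ t x) : ℝ)‖ ≤ ‖S.ρ t x • S.u t x‖ * K :=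
    (norm_inner_le_norm _ _).trans (by gcongr)
  have a2 : ‖(inner ℝ (S.ρ t x • outer (S.u t x) (S.u t x)) (jacobian (φ t) x) : ℝ)‖
      ≤ ‖S.ρ t x • outer (S.u t x) (S.u t x)‖ * K :=
    (norm_inner_le_norm _ _).trans (by gcongr)
  have a3 : ‖pressure P (S.ρ t x) * divergence (φ t) x‖
      ≤ ‖pressure P (S.ρ t x)‖ * (‖idMat d‖ * K) := by
    rw [norm_mul, ← tr_jacobian]
    gcongr
    exact (abs_tr_le _).trans (by gcongr)
  have a4 : ‖(inner ℝ (stress P (S.gradU t x)) (jacobian (φ t) x) : ℝ)‖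
      ≤ ‖stress P (S.gradU t x)‖ * K := (norm_inner_le_norm _ _).trans (by gcongr)
  have a5 : ‖(inner ℝ (cross (S.curlB t x) (pad (S.B t x))) (pad (φ t x)) : ℝ)‖
      ≤ ‖cross (S.curlB t x) (pad (S.B t x))‖ * K :=
    (norm_inner_le_norm _ _).trans (by rw [norm_pad hd]; gcongr)
  unfold momentumIntegrand
  refine (norm_add_le _ _).trans ?_
  have b1 := norm_sub_le (inner ℝ (S.ρ t x • S.u t x) (timeD φ t x)
    + inner ℝ (S.ρ t x • outer (S.u t x) (S.u t x)) (jacobian (φ t) x)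
    + pressure P (S.ρ t x) * divergence (φ t) x)
    (inner ℝ (stress P (S.gradU t x)) (jacobian (φ t) x))
  have b2 := norm_add_le (inner ℝ (S.ρ t x • S.u t x) (timeD φ t x)
    + inner ℝ (S.ρ t x • outer (S.u t x) (S.u t x)) (jacobian (φ t) x) : ℝ)
    (pressure P (S.ρ t x) * divergence (φ t) x)
  have b3 := norm_add_le (inner ℝ (S.ρ t x • S.u t x) (timeD φ t x) : ℝ)
    (inner ℝ (S.ρ t x • outer (S.u t x) (S.u t x)) (jacobian (φ t) x))
  linarith

/-- The momentum equation tested with a field that vanishes on the boundary, up to the defect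
measures. -/
theorem IsDWSolution.momentum_inequality (hd : d = 2 ∨ d = 3) (hP : P.Valid) (hD : D.Admissible)
    (h : IsDWSolution P D T ρ₀ m₀ B₀ S) (hm₀ : Integrable m₀ D.spaceMeasure)
    (hv : ClosedCk D 2 v) {φ : ℕ → ℝ → Vec d → Vec d} {K : ℝ} (hK : 0 ≤ K)
    (hφ : TestApprox D T v φ K) :
    ∀ᵐ τ ∂timeMeasure T, (∫ x in D.cell, inner ℝ (S.ρ τ x • S.u τ x) (v τ x))
        - (∫ x in D.cell, inner ℝ (m₀ x) (v 0 x))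
        - (∫ t in (0 : ℝ)..τ, ∫ x in D.cell, momentumIntegrand P S v t x)
      ≥ -(K * ((∫ t in (0 : ℝ)..τ, (S.μc t).variation.real D.closedCell)
        + ∫ t in (0 : ℝ)..τ, (S.μB t).variation.real D.closedCell)) := by
  have := Domain.isFiniteMeasure_spaceMeasure hD
  have hfl := h.flowIntegrable hP hD
  have hv1 : ContDiff ℝ 1 fun z : ℝ × Vec d => v z.1 z.2 := hv.1.of_le one_le_two
  have hφ1 : ∀ n, ContDiff ℝ 1 fun z : ℝ × Vec d => φ n z.1 z.2 :=
    fun n => (hφ.contDiff n).of_le one_le_two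
  -- The null set of excluded times depends on the test field; for a sequence of fields it remains
  -- null.
  have heqn := ae_all_iff.2 fun n => h.momentum (φ n) (hφ.test n)
  obtain ⟨C₀, hreg⟩ := h.exists_regularSlice hP hD
  have hspace : ∀ {t : ℝ}, t ∈ Icc 0 T → ∀ {f : Vec d → Vec d}, Integrable f D.spaceMeasure →
      Tendsto (fun n => ∫ x in D.cell, inner ℝ (f x) (φ n t x)) atTop
        (𝓝 (∫ x in D.cell, inner ℝ (f x) (v t x))) := fun {t} ht {f} hf => by
    refine tendsto_integral_of_dominated_convergence (fun x => ‖f x‖ * K) (fun n => ?_)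
      (hf.norm.mul_const K) (fun n => ?_) ?_
    · exact hf.1.inner (contDiff_slice (hφ1 n) t).continuous.aestronglyMeasurable
    · filter_upwards [ae_restrict_mem (Domain.measurableSet_cell hD)] with x hx
      exact (norm_inner_le_norm _ _).trans (mul_le_mul_of_nonneg_left
        (hφ.norm_le n t ht x (subset_closure hx)) (norm_nonneg _))
    · filter_upwards [ae_restrict_mem (Domain.measurableSet_cell hD)] with x hx
      exact tendsto_const_nhds.inner (hφ.tendsto t ht x (subset_closure hx))
  filter_upwards [heqn, hreg, ae_restrict_mem measurableSet_Ioo] with τ heqn hreg hτ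
  have hmono := cylMeasure_mono D hτ.2.le
  have hτ' := Ioo_subset_Icc_self hτ
  have l1 := hspace hτ' hreg.flow.momentum
  have l2 := hspace ⟨le_rfl, hτ'.1.trans hτ'.2⟩ hm₀
  have hmi : ∀ {w : ℝ → Vec d → Vec d}, ContDiff ℝ 1 (fun z : ℝ × Vec d => w z.1 z.2) →
      Integrable (fun z : ℝ × Vec d => momentumIntegrand P S w z.1 z.2) (cylMeasure D τ) :=
    fun hw => (h.integrable_momentum hd hP hD hw).mono_measure hmono
  have l3 : Tendsto (fun n => ∫ t in (0 : ℝ)..τ, ∫ x in D.cell, momentumIntegrand P S (φ n) t x)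
      atTop (𝓝 (∫ t in (0 : ℝ)..τ, ∫ x in D.cell, momentumIntegrand P S v t x)) := by
    simp only [integral_cyl hD hτ'.1 (hmi (hφ1 _)), integral_cyl hD hτ'.1 (hmi hv1)]
    refine tendsto_integral_of_dominated_convergence (fun z => K * (‖S.ρ z.1 z.2 • S.u z.1 z.2‖
      + ‖S.ρ z.1 z.2 • outer (S.u z.1 z.2) (S.u z.1 z.2)‖
      + ‖idMat d‖ * ‖pressure P (S.ρ z.1 z.2)‖ + ‖stress P (S.gradU z.1 z.2)‖
      + ‖cross (S.curlB z.1 z.2) (pad (S.B z.1 z.2))‖)) (fun n => (hmi (hφ1 n)).1) ?_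
      (fun n => ?_) ?_
    · have := isFiniteMeasure_cylMeasure hD T
      exact (((((hfl.momentum.norm.add hfl.convection.norm).add
        (hfl.pressure.norm.const_mul _)).add (hfl.stress.integrable one_le_two).norm).add
        (hfl.lorentz hd).norm).const_mul K).mono_measure hmono
    · filter_upwards [ae_mem_cylinder hD τ] with z hz
      have ht : z.1 ∈ Ioo 0 T := ⟨hz.1.1, hz.1.2.trans hτ.2⟩
      have ht' := Ioo_subset_Icc_self ht
      exact norm_momentumIntegrand_le hd (hφ.norm_le n _ ht' _ (subset_closure hz.2))
        (hφ.jacobian_le n _ ht' _ (subset_closure hz.2)) (hφ.timeD_le n _ ht _ hz.2)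
    · filter_upwards [ae_mem_cylinder hD τ, ae_mono hmono hφ.tendsto_deriv] with z hz hz'
      have ht' : z.1 ∈ Icc 0 T := ⟨hz.1.1.le, (hz.1.2.trans hτ.2).le⟩
      have t1 := hφ.tendsto _ ht' _ (subset_closure hz.2)
      have t2 : Tendsto (fun n => divergence (φ n z.1) z.2) atTop (𝓝 (divergence (v z.1) z.2)) := by
        have htr : Continuous (tr : Mat d → ℝ) := by unfold tr; fun_prop
        exact (htr.tendsto _).comp hz'.1
      exact ((((tendsto_const_nhds.inner hz'.2).add (tendsto_const_nhds.inner hz'.1)).add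
        (t2.const_mul _)).sub (tendsto_const_nhds.inner hz'.1)).add
        (tendsto_const_nhds.inner ((continuous_pad.tendsto _).comp t1))
  -- The defect terms need not converge along the sequence. The uniform bounds on the test fields
  -- and their Jacobians, valid up to the boundary, are enough.
  refine ge_of_tendsto ((l1.sub l2).sub l3) (.of_forall fun n => ?_)
  have e := heqn n
  have m1 := h.μc_mem.abs_integral_le le_top hK (fun t ht x hx =>
    hφ.jacobian_le n t ht x (D.closedCell_subset hx)) hτ
  have m2 := h.μB_mem.abs_integral_le one_le_two hK (fun t ht x hx =>
    hφ.norm_le n t ht x (D.closedCell_subset hx)) hτ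
  have m3 := neg_abs_le
    (∫ t in (0 : ℝ)..τ, VectorMeasure.integral (S.μc t) (jacobian (φ n t)) (innerSL ℝ))
  have m4 := neg_abs_le
    (∫ t in (0 : ℝ)..τ, VectorMeasure.integral (S.μB t) (φ n t) (innerSL ℝ))
  simp only [momentumIntegrand]
  linarith

/-- The energy of the magnetic field and the pressure of the strong solution. -/
def strongEnergy (P : Params) (r : ℝ → Vec d → ℝ) (b : ℝ → Vec d → Vec d) (t : ℝ) (x : Vec d) : ℝ :=
  1 / 2 * ‖b t x‖ ^ 2 + pressure P (r t x)

lemma StrongSolution.contDiff_strongEnergy (hs : StrongSolution P D T c r v b) :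
    ContDiff ℝ 1 fun z : ℝ × Vec d => strongEnergy P r b z.1 z.2 :=
  (contDiff_const.mul ((hs.b_reg.1.of_le one_le_two).norm_sq ℝ)).add
    (contDiff_pressure_comp P hs.r_reg.1 fun z => hs.r_pos z.1 z.2)

lemma StrongSolution.timeD_strongEnergy (hs : StrongSolution P D T c r v b) (t : ℝ) (x : Vec d) :
    timeD (strongEnergy P r b) t x = strongRate P r b t x := by
  have h1 := (hasDerivAt_timeD (hs.b_reg.1.of_le one_le_two) t x).norm_sq.const_mul (1 / 2)
  have h2 : HasDerivAt (fun s => pressure P (r s x)) (dPressure P (r t x) * timeD r t x) t :=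
    HasDerivAt.comp (h₂ := pressure P) t (hasDerivAt_pressure P (hs.r_pos t x))
      (hasDerivAt_timeD hs.r_reg.1 t x)
  exact (h1.fun_add h2).deriv.trans (by unfold strongRate; ring)

/-- Each term of the expansion has its own balance: total energy, momentum tested with v, continuity
tested with `relTest`, Maxwell tested with b. The rest depends on the strong solution alone, by p(r)
= rH'(r) − H(r). -/
lemma relEnergyAt_eq (hP : P.Valid) (S : DWFields d) {t : ℝ} {x : Vec d} (hr : 0 < r t x) :
    relEnergyAt P S r v b t x
      = 1 / 2 * S.ρ t x * ‖S.u t x‖ ^ 2 + 1 / 2 * ‖S.B t x‖ ^ 2 + potential P (S.ρ t x)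
        - inner ℝ (S.ρ t x • S.u t x) (v t x) + S.ρ t x * relTest P r v t x
        - inner ℝ (S.B t x) (b t x) + strongEnergy P r b t x := by
  simp only [relEnergyAt, relEnergy, relPotential, relTest, strongEnergy, pressure_eq hP hr,
    norm_sub_sq_real, real_inner_smul_left]
  ring

lemma StrongSolution.integral_relEnergyAt (hP : P.Valid) (hD : D.Admissible)
    (hs : StrongSolution P D T c r v b) {M C₀ t : ℝ} (h : RegularSlice P D S M C₀ t) :
    ∫ x in D.cell, relEnergyAt P S r v b t x
      = (∫ x in D.cell, (1 / 2 * S.ρ t x * ‖S.u t x‖ ^ 2 + 1 / 2 * ‖S.B t x‖ ^ 2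
          + potential P (S.ρ t x)))
        - (∫ x in D.cell, inner ℝ (S.ρ t x • S.u t x) (v t x))
        + (∫ x in D.cell, S.ρ t x * relTest P r v t x)
        - (∫ x in D.cell, inner ℝ (S.B t x) (b t x)) + ∫ x in D.cell, strongEnergy P r b t x := by
  have := Domain.isFiniteMeasure_spaceMeasure hD
  have i1 : Integrable (fun x => 1 / 2 * S.ρ t x * ‖S.u t x‖ ^ 2 + 1 / 2 * ‖S.B t x‖ ^ 2
      + potential P (S.ρ t x)) D.spaceMeasure := by
    simp only [mul_assoc]
    exact ((h.flow.kinetic.const_mul _).add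
      ((h.flow.field.integrable_norm_pow two_ne_zero).const_mul _)).add h.flow.potential
  have i2 := integrable_inner (memLp_one_iff_integrable.2 h.flow.momentum)
    (Domain.memLp_cell hD (contDiff_slice hs.u_reg.1 t).continuous ⊤)
  have i3 := integrable_mul (memLp_one_iff_integrable.2 h.flow.density)
    (Domain.memLp_cell hD (contDiff_slice hs.relTest_reg.1 t).continuous ⊤)
  have i4 := integrable_inner h.flow.field
    (Domain.memLp_cell hD (contDiff_slice hs.b_reg.1 t).continuous 2)
  have i5 : Integrable (strongEnergy P r b t) D.spaceMeasure :=
    Domain.integrableOn_cell hD (contDiff_slice hs.contDiff_strongEnergy t).continuous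
  have e : (fun x => relEnergyAt P S r v b t x) = fun x =>
      1 / 2 * S.ρ t x * ‖S.u t x‖ ^ 2 + 1 / 2 * ‖S.B t x‖ ^ 2 + potential P (S.ρ t x)
        - inner ℝ (S.ρ t x • S.u t x) (v t x) + S.ρ t x * relTest P r v t x
        - inner ℝ (S.B t x) (b t x) + strongEnergy P r b t x :=
    funext fun x => relEnergyAt_eq hP S (hs.r_pos t x)
  rw [e]
  refine (integral_add (((i1.sub i2).add i3).sub i4) i5).trans (congrArg (· + _) ?_)
  refine (integral_sub ((i1.sub i2).add i3) i4).trans (congrArg (· - _) ?_)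
  refine (integral_add (i1.sub i2) i3).trans (congrArg (· + _) ?_)
  exact integral_sub i1 i2

/-- This is the relative energy at time 0, expanded as above; it vanishes because the data agree. -/
lemma StrongSolution.initial_balance (hP : P.Valid) (hD : D.Admissible)
    (hs : StrongSolution P D T c r v b) (h1 : ∀ x ∈ D.cell, r 0 x = ρ₀ x)
    (h2 : ∀ x ∈ D.cell, r 0 x • v 0 x = m₀ x) (h3 : ∀ x ∈ D.cell, b 0 x = B₀ x) :
    (∫ x in D.cell, (1 / 2 * (‖m₀ x‖ ^ 2 / ρ₀ x) + 1 / 2 * ‖B₀ x‖ ^ 2 + potential P (ρ₀ x)))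
        - (∫ x in D.cell, inner ℝ (m₀ x) (v 0 x)) + (∫ x in D.cell, ρ₀ x * relTest P r v 0 x)
        - (∫ x in D.cell, inner ℝ (B₀ x) (b 0 x)) + ∫ x in D.cell, strongEnergy P r b 0 x = 0 := by
  have hr := (contDiff_slice hs.r_reg.1 0).continuous
  have hv := (contDiff_slice hs.u_reg.1 0).continuous
  have hb := (contDiff_slice hs.b_reg.1 0).continuous
  have hpot := (contDiff_potential_comp P (contDiff_slice hs.r_reg.1 0) (hs.r_pos 0)).continuous
  have hm := Domain.measurableSet_cell hD
  have e1 : ∫ x in D.cell, (1 / 2 * (‖m₀ x‖ ^ 2 / ρ₀ x) + 1 / 2 * ‖B₀ x‖ ^ 2 + potential P (ρ₀ x))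
      = ∫ x in D.cell, (1 / 2 * (r 0 x * ‖v 0 x‖ ^ 2) + 1 / 2 * ‖b 0 x‖ ^ 2
        + potential P (r 0 x)) := by
    refine setIntegral_congr_fun hm fun x hx => ?_
    have h0 := hs.r_pos 0 x
    simp only [← h1 x hx, ← h2 x hx, ← h3 x hx, norm_smul, Real.norm_of_nonneg h0.le]
    field_simp
  have e2 : ∫ x in D.cell, inner ℝ (m₀ x) (v 0 x) = ∫ x in D.cell, r 0 x * ‖v 0 x‖ ^ 2 :=
    setIntegral_congr_fun hm fun x hx => by
      simp only [← h2 x hx, real_inner_smul_left, real_inner_self_eq_norm_sq]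
  have e3 : ∫ x in D.cell, ρ₀ x * relTest P r v 0 x = ∫ x in D.cell, r 0 x * relTest P r v 0 x :=
    setIntegral_congr_fun hm fun x hx => by simp only [← h1 x hx]
  have e4 : ∫ x in D.cell, inner ℝ (B₀ x) (b 0 x) = ∫ x in D.cell, ‖b 0 x‖ ^ 2 :=
    setIntegral_congr_fun hm fun x hx => by
      simp only [← h3 x hx, real_inner_self_eq_norm_sq]
  have hrel := (contDiff_slice hs.relTest_reg.1 0).continuous
  have hse := (contDiff_slice hs.contDiff_strongEnergy 0).continuous
  rw [e1, e2, e3, e4, ← integral_sub, ← integral_add, ← integral_sub, ← integral_add]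
  · refine (integral_congr_ae (.of_forall fun x => ?_)).trans (integral_zero _ _)
    simp only [relTest, strongEnergy, pressure_eq hP (hs.r_pos 0 x)]
    ring
  all_goals exact Domain.integrableOn_cell hD (by fun_prop)

/-- The relative energy inequality. -/
theorem IsDWSolution.exists_relEnergy_le (hd : d = 2 ∨ d = 3) (hP : P.Valid) (hD : D.Admissible)
    (h : IsDWSolution P D T ρ₀ m₀ B₀ S) (hs : StrongSolution P D T c r v b)
    (h1 : ∀ x ∈ D.cell, r 0 x = ρ₀ x) (h2 : ∀ x ∈ D.cell, r 0 x • v 0 x = m₀ x)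
    (h3 : ∀ x ∈ D.cell, b 0 x = B₀ x) :
    ∃ K, 0 ≤ K ∧ ∀ᵐ τ ∂timeMeasure T,
      (∫ x in D.cell, relEnergyAt P S r v b τ x) + (S.𝔇 τ).real D.closedCell
          + S.ℭ.real (Icc 0 τ ×ˢ D.closedCell)
        ≤ (∫ t in (0 : ℝ)..τ, ∫ x in D.cell, production P S r v b t x)
          + K * ((∫ t in (0 : ℝ)..τ, (S.μc t).variation.real D.closedCell)
            + ∫ t in (0 : ℝ)..τ, (S.μB t).variation.real D.closedCell) := by
  obtain ⟨φ, K, hK, hφ⟩ := exists_testApprox hD hs.u_reg hs.u_bc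
  obtain ⟨C₀, hreg⟩ := h.exists_regularSlice hP hD
  have hm := Domain.measurableSet_cell hD
  have hm₀ : Integrable m₀ D.spaceMeasure := by
    have : IntegrableOn (fun x => r 0 x • v 0 x) D.cell := Domain.integrableOn_cell hD
      ((contDiff_slice hs.r_reg.1 0).continuous.smul (contDiff_slice hs.u_reg.1 0).continuous)
    exact this.congr_fun h2 hm
  have hinit := hs.initial_balance hP hD h1 h2 h3
  refine ⟨K, hK, ?_⟩
  filter_upwards [h.momentum_inequality hd hP hD hm₀ hs.u_reg hK hφ, hreg,
    h.continuity _ hs.relTest_reg,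
    h.maxwell b ⟨⟨hs.b_reg.1.of_le one_le_two, hs.b_reg.2⟩, hs.b_bc⟩, h.energy,
    ae_restrict_mem measurableSet_Ioo] with τ e1 e2 e3 e4 e5 hτ
  have hτ0 := hτ.1.le
  have hmono := cylMeasure_mono D hτ.2.le
  have i1 := (h.integrable_dissipation hP hD).mono_measure hmono
  have i2 := (h.integrable_momentum hd hP hD (hs.u_reg.1.of_le one_le_two)).mono_measure hmono
  have i3 := (h.integrable_continuity hP hD hs.relTest_reg.1).mono_measure hmono
  have i4 := (h.integrable_maxwell hd hP hD (hs.b_reg.1.of_le one_le_two)).mono_measure hmono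
  have i5 : Integrable (fun z : ℝ × Vec d => strongRate P r b z.1 z.2) (cylMeasure D τ) := by
    have := isFiniteMeasure_cylMeasure hD τ
    exact (memLp_cyl hD τ hs.continuous_strongRate 1).integrable le_rfl
  have i6 := (h.integrable_production hd hP hD hs).mono_measure hmono
  have e6 := integral_sub_eq_integral_timeD hD hτ0 hs.contDiff_strongEnergy
  simp only [hs.timeD_strongEnergy] at e6
  have e7 : ∫ z, production P S r v b z.1 z.2 ∂cylMeasure D τ
      = -(∫ z, dissipation P S z.1 z.2 ∂cylMeasure D τ)
        - (∫ z, momentumIntegrand P S v z.1 z.2 ∂cylMeasure D τ)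
        + (∫ z, continuityIntegrand S (relTest P r v) z.1 z.2 ∂cylMeasure D τ)
        - (∫ z, maxwellIntegrand P S b z.1 z.2 ∂cylMeasure D τ)
        + ∫ z, strongRate P r b z.1 z.2 ∂cylMeasure D τ := by
    have e : (fun z : ℝ × Vec d => production P S r v b z.1 z.2) = fun z =>
        -dissipation P S z.1 z.2 - momentumIntegrand P S v z.1 z.2
        + continuityIntegrand S (relTest P r v) z.1 z.2 - maxwellIntegrand P S b z.1 z.2
        + strongRate P r b z.1 z.2 := by
      ext z; unfold production strongRate; ring
    rw [e]
    refine (integral_add (((i1.neg.sub i2).add i3).sub i4) i5).trans (congrArg (· + _) ?_)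
    refine (integral_sub ((i1.neg.sub i2).add i3) i4).trans (congrArg (· - _) ?_)
    refine (integral_add (i1.neg.sub i2) i3).trans (congrArg (· + _) ?_)
    exact (integral_sub i1.neg i2).trans (congrArg (· - _) (integral_neg _))
  have f1 := integral_cyl hD hτ0 i1
  have f2 := integral_cyl hD hτ0 i2
  have f3 := integral_cyl hD hτ0 i3
  have f4 := integral_cyl hD hτ0 i4
  have f6 := integral_cyl hD hτ0 i6
  rw [f6, e7, ← e6, ← f1, ← f2, ← f3, ← f4, hs.integral_relEnergyAt hP hD e2]
  simp only [dissipation, continuityIntegrand, maxwellIntegrand]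
  -- Energy inequality, minus momentum, plus continuity, minus Maxwell, plus the fundamental theorem
  -- of calculus for the strong energy; the initial values cancel by `hinit`.
  linarith

end DW

end

end MHD

namespace MHD
noncomputable section

/-! ### Weak-strong uniqueness -/

variable {d : ℕ} {D : Domain d} {P : Params} {T c : ℝ} {ρ₀ : Vec d → ℝ} {m₀ B₀ : Vec d → Vec d}
  {S : DWFields d} {r : ℝ → Vec d → ℝ} {v b : ℝ → Vec d → Vec d}

lemma exists_mem_Ioo_of_ae {T s : ℝ} (hs : s ∈ Ico 0 T) {p : ℝ → Prop}
    (h : ∀ᵐ t ∂timeMeasure T, p t) : ∃ t ∈ Ioo s T, p t := by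
  have h1 : ∀ᵐ t ∂volume.restrict (Ioo s T), p t :=
    ae_mono (Measure.restrict_mono_set volume (Ioo_subset_Ioo_left hs.1)) h
  have h2 : (volume.restrict (Ioo s T)) ≠ 0 := by
    rw [Ne, Measure.restrict_eq_zero, Real.volume_Ioo, ENNReal.ofReal_eq_zero]
    linarith [hs.2]
  have : (ae (volume.restrict (Ioo s T))).NeBot := ae_neBot.2 h2
  obtain ⟨t, ht, hpt⟩ := ((ae_restrict_mem measurableSet_Ioo).and h1).exists
  exact ⟨t, ht, hpt⟩

lemma integral_mono_of_ae_timeMeasure {f g : ℝ → ℝ} (hf : IntegrableOn f (Ioo 0 T))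
    (hg : IntegrableOn g (Ioo 0 T)) (h : ∀ᵐ t ∂timeMeasure T, f t ≤ g t) {τ : ℝ} (hτ : τ ∈ Ioo 0 T) :
    ∫ t in (0 : ℝ)..τ, f t ≤ ∫ t in (0 : ℝ)..τ, g t := by
  have hsub : Ioo 0 τ ⊆ Ioo 0 T := Ioo_subset_Ioo_right hτ.2.le
  simp only [intervalIntegral.integral_of_le hτ.1.le, integral_Ioc_eq_integral_Ioo]
  exact integral_mono_ae (hf.mono_set hsub) (hg.mono_set hsub)
    (ae_mono (Measure.restrict_mono_set volume hsub) h)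

lemma IsDWSolution.exists_production_le (hd : d = 2 ∨ d = 3) (hP : P.Valid) (hD : D.Admissible)
    (h : IsDWSolution P D T ρ₀ m₀ B₀ S) (hs : StrongSolution P D T c r v b)
    (h1 : ∀ x ∈ D.cell, r 0 x = ρ₀ x) :
    ∃ C, 0 ≤ C ∧ ∀ᵐ t ∂timeMeasure T,
      ∫ x in D.cell, production P S r v b t x ≤ C * ∫ x in D.cell, relEnergyAt P S r v b t x := by
  have := Domain.isFiniteMeasure_spaceMeasure hD
  have := isFiniteMeasure_timeMeasure T
  -- An empty domain has no mass with which to run the weighted Poincaré inequality, but then both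
  -- integrals vanish.
  by_cases h0 : D.spaceMeasure = 0
  · refine ⟨0, le_rfl, .of_forall fun t => ?_⟩
    have h0' : volume.restrict D.cell = 0 := h0
    simp [h0']
  · have hM : 0 < ∫ x in D.cell, ρ₀ x := by
      have e : ∫ x in D.cell, ρ₀ x = ∫ x in D.cell, r 0 x :=
        setIntegral_congr_fun (Domain.measurableSet_cell hD) fun x hx => (h1 x hx).symm
      have hle : ∫ _, c ∂D.spaceMeasure ≤ ∫ x, r 0 x ∂D.spaceMeasure :=
        integral_mono (integrable_const c)
          (Domain.integrableOn_cell hD (contDiff_slice hs.r_reg.1 0).continuous) (hs.le_r 0)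
      rw [integral_const, smul_eq_mul] at hle
      have hpos : 0 < D.spaceMeasure.real univ := by
        rw [measureReal_def, ENNReal.toReal_pos_iff]
        exact ⟨pos_iff_ne_zero.2 fun h => h0 (Measure.measure_univ_eq_zero.1 h), measure_lt_top _ _⟩
      rw [e]
      exact (mul_pos hpos hs.c_pos).trans_le hle
    obtain ⟨C₀, hreg⟩ := h.exists_regularSlice hP hD
    obtain ⟨C, hC, hle⟩ := hs.exists_production_le hd hP hD (C₀ := C₀) hM
    obtain ⟨φ, K, -, hφ⟩ := exists_testApprox hD hs.u_reg hs.u_bc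
    refine ⟨C, hC, ?_⟩
    filter_upwards [hreg, hφ.ae_w0 hD hs.u_reg,
      (h.integrable_production hd hP hD hs).prod_right_ae,
      (h.integrable_relEnergy hP hD hs).prod_right_ae, ae_restrict_mem measurableSet_Ioo]
      with t e1 e2 e3 e4 ht
    exact hle S t ht e2 e1 e3 e4

lemma IsDWSolution.relEnergyAt_nonneg (hP : P.Valid) (h : IsDWSolution P D T ρ₀ m₀ B₀ S)
    (hs : StrongSolution P D T c r v b) :
    ∀ᵐ z ∂cylMeasure D T, 0 ≤ relEnergyAt P S r v b z.1 z.2 := by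
  filter_upwards [h.ρ_nonneg] with z hz using relEnergy_nonneg hP hz (hs.r_pos z.1 z.2) _ _ _ _

/-- The relative energy and the energy defects vanish. -/
theorem IsDWSolution.relEnergy_eq_zero (hd : d = 2 ∨ d = 3) (hP : P.Valid) (hD : D.Admissible)
    (h : IsDWSolution P D T ρ₀ m₀ B₀ S) (hs : StrongSolution P D T c r v b)
    (h1 : ∀ x ∈ D.cell, r 0 x = ρ₀ x) (h2 : ∀ x ∈ D.cell, r 0 x • v 0 x = m₀ x)
    (h3 : ∀ x ∈ D.cell, b 0 x = B₀ x) :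
    ∀ᵐ t ∂timeMeasure T, ∫ x in D.cell, relEnergyAt P S r v b t x = 0 ∧
      (S.𝔇 t).real D.closedCell = 0 ∧ S.ℭ (Icc 0 t ×ˢ D.closedCell) = 0 := by
  have := Domain.isFiniteMeasure_spaceMeasure hD
  have := isFiniteMeasure_timeMeasure T
  have := h.ℭ_finite
  obtain ⟨K, hK, hrel⟩ := h.exists_relEnergy_le hd hP hD hs h1 h2 h3
  obtain ⟨C, hC, hprod⟩ := h.exists_production_le hd hP hD hs h1
  obtain ⟨C₁, hc⟩ := h.compat_c
  obtain ⟨C₂, hB⟩ := h.compat_B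
  set E : ℝ → ℝ := fun t => ∫ x in D.cell, relEnergyAt P S r v b t x with hE
  set Df : ℝ → ℝ := fun t => (S.𝔇 t).real D.closedCell with hDf
  have iE : IntegrableOn E (Ioo 0 T) := (h.integrable_relEnergy hP hD hs).integral_prod_left
  have iD : IntegrableOn Df (Ioo 0 T) := h.𝔇_mem.integrableOn
  have iP : IntegrableOn (fun t => ∫ x in D.cell, production P S r v b t x) (Ioo 0 T) :=
    (h.integrable_production hd hP hD hs).integral_prod_left
  have hE0 : ∀ᵐ t ∂timeMeasure T, 0 ≤ E t := by
    filter_upwards [Measure.ae_ae_of_ae_prod (h.relEnergyAt_nonneg hP hs)] with t ht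
    exact integral_nonneg_of_ae ht
  have hD0 : ∀ t, 0 ≤ Df t := fun t => measureReal_nonneg
  -- Small enough that the ℭ part of the bound on μB uses at most half of the ℭ on the left; the
  -- added 1 covers K|C₂| = 0.
  set ε : ℝ := 1 / (2 * (K * |C₂| + 1)) with hε
  have hKC : 0 ≤ K * |C₂| := by positivity
  have hε0 : 0 < ε := by positivity
  have hθ : K * |C₂| * ε ≤ 1 / 2 := by
    rw [hε, mul_one_div, div_le_iff₀ (by positivity)]
    linarith
  -- The condition on μc is the case a = 1, ε = 0 of the general bound.
  have bc : ∀ τ ∈ Ioo 0 T, ∫ t in (0 : ℝ)..τ, (S.μc t).variation.real D.closedCell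
      ≤ |C₁| * ∫ t in (0 : ℝ)..τ, Df t := fun τ hτ => by
    have := integral_le_of_forall_test (a := 1) (ε := 0) (ν := S.ℭ) (Z := D.closedCell)
      (h.μc_mem.integrableOn le_top) iD hD0 zero_le_one le_rfl (C := C₁)
      (fun ψ h1 h2 => (hc ψ h1 h2).trans_eq (by ring)) hτ
    linarith
  have bB : ∀ τ ∈ Ioo 0 T, ∫ t in (0 : ℝ)..τ, (S.μB t).variation.real D.closedCell
      ≤ |C₂| * (1 / ε * (∫ t in (0 : ℝ)..τ, Df t) + ε * S.ℭ.real (Icc 0 τ ×ˢ D.closedCell)) :=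
    fun τ hτ => integral_le_of_forall_test (h.μB_mem.integrableOn one_le_two) iD hD0
      (by positivity) hε0.le (hB ε hε0) hτ
  set L : ℝ := C + K * |C₁| + K * |C₂| * (1 / ε) with hL
  have hL0 : 0 ≤ L := by positivity
  have hmain : ∀ᵐ τ ∂timeMeasure T, E τ + Df τ + 1 / 2 * S.ℭ.real (Icc 0 τ ×ˢ D.closedCell)
      ≤ L * ∫ t in (0 : ℝ)..τ, (E t + Df t) := by
    filter_upwards [hrel, ae_restrict_mem measurableSet_Ioo] with τ hrel hτ
    have hsub : Ioc 0 τ ⊆ Ioo 0 T := fun t ht => ⟨ht.1, ht.2.trans_lt hτ.2⟩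
    have p1 := integral_mono_of_ae_timeMeasure iP (iE.const_mul C) hprod hτ
    rw [intervalIntegral.integral_const_mul] at p1
    have p2 := mul_le_mul_of_nonneg_left (bc τ hτ) hK
    have p3 := mul_le_mul_of_nonneg_left (bB τ hτ) hK
    have jE : IntervalIntegrable E volume 0 τ :=
      (intervalIntegrable_iff_integrableOn_Ioc_of_le hτ.1.le).2 (iE.mono_set hsub)
    have jD : IntervalIntegrable Df volume 0 τ :=
      (intervalIntegrable_iff_integrableOn_Ioc_of_le hτ.1.le).2 (iD.mono_set hsub)
    have p4 : 0 ≤ ∫ t in (0 : ℝ)..τ, E t := by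
      have := integral_mono_of_ae_timeMeasure (integrableOn_zero (μ := volume)) iE hE0 hτ
      simpa using this
    have p5 : 0 ≤ ∫ t in (0 : ℝ)..τ, Df t :=
      intervalIntegral.integral_nonneg hτ.1.le fun t _ => hD0 t
    have p6 : 0 ≤ S.ℭ.real (Icc 0 τ ×ˢ D.closedCell) := measureReal_nonneg
    rw [intervalIntegral.integral_add jE jD]
    have q1 := mul_le_mul_of_nonneg_right hθ p6
    have q2 : 0 ≤ (K * |C₁| + K * |C₂| * (1 / ε)) * ∫ t in (0 : ℝ)..τ, E t := by positivity
    have q3 := mul_nonneg hC p5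
    simp only [hL]
    linarith
  have hgron : ∀ᵐ t ∂timeMeasure T, E t + Df t ≤ 0 := by
    refine ae_nonpos_of_le_integral hL0 (iE.add iD) ?_
    filter_upwards [hmain] with τ hτ
    have : 0 ≤ S.ℭ.real (Icc 0 τ ×ˢ D.closedCell) := measureReal_nonneg
    linarith
  filter_upwards [hmain, hgron, hE0, ae_restrict_mem measurableSet_Ioo] with τ a1 a2 a3 hτ
  have a4 := hD0 τ
  -- Once E + 𝔇 ≤ 0, the right side of `hmain` is nonpositive, so the remaining half of ℭ on [0, τ]
  -- must vanish too.
  have p1 := integral_mono_of_ae_timeMeasure (iE.add iD) (integrableOn_zero (μ := volume)) hgron hτ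
  simp only [Pi.add_apply, intervalIntegral.integral_zero] at p1
  have p2 := mul_nonpos_of_nonneg_of_nonpos hL0 p1
  have p6 : 0 ≤ S.ℭ.real (Icc 0 τ ×ˢ D.closedCell) := measureReal_nonneg
  refine ⟨by linarith, by linarith, ?_⟩
  have p7 : S.ℭ.real (Icc 0 τ ×ˢ D.closedCell) = 0 := by linarith
  rwa [measureReal_eq_zero_iff] at p7

lemma ae_real_eq_zero_of_integral_nonpos {f : ℝ → ℝ} (hT : 0 ≤ T) (hf : IntegrableOn f (Ioo 0 T))
    (h0 : ∀ t, 0 ≤ f t) (h : ∫ t in (0 : ℝ)..T, f t ≤ 0) : ∀ᵐ t ∂timeMeasure T, f t = 0 := by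
  rw [intervalIntegral.integral_of_le hT, integral_Ioc_eq_integral_Ioo] at h
  exact (integral_eq_zero_iff_of_nonneg h0 hf).1 (le_antisymm h (integral_nonneg h0))

lemma MemLpMeasure.ae_eq_zero {F : Type*} [NormedAddCommGroup F] [NormedSpace ℝ F] {p : ENNReal}
    {μ : ℝ → VectorMeasure (Vec d) F} (h : MemLpMeasure D T p μ)
    (h0 : ∀ᵐ t ∂timeMeasure T, (μ t).variation.real D.closedCell = 0) :
    ∀ᵐ t ∂timeMeasure T, μ t = 0 := by
  filter_upwards [h.carried, h.finite, h0] with t h1 h2 h3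
  have h4 : (μ t).variation D.closedCell = 0 := by
    rw [measureReal_def, ENNReal.toReal_eq_zero_iff] at h3
    exact h3.resolve_right h2.ne
  rw [← VectorMeasure.variation_eq_zero, ← Measure.measure_univ_eq_zero,
    ← union_compl_self D.closedCell]
  exact measure_union_null h4 h1

lemma MemLinftyPosMeasure.ae_eq_zero {μ : ℝ → Measure (Vec d)} (h : MemLinftyPosMeasure D T μ)
    (h0 : ∀ᵐ t ∂timeMeasure T, (μ t).real D.closedCell = 0) : ∀ᵐ t ∂timeMeasure T, μ t = 0 := by
  obtain ⟨C, hC⟩ := h.bounded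
  filter_upwards [h.carried, hC, h0] with t h1 h2 h3
  have h4 : μ t D.closedCell = 0 := by
    rw [measureReal_def, ENNReal.toReal_eq_zero_iff] at h3
    exact h3.resolve_right (h2.trans_lt ENNReal.coe_lt_top).ne
  rw [← Measure.measure_univ_eq_zero, ← union_compl_self D.closedCell]
  exact measure_union_null h4 h1

/-- The momentum defects vanish with the energy defect. -/
lemma IsDWSolution.momentum_defects_eq_zero (hT : 0 < T) (h : IsDWSolution P D T ρ₀ m₀ B₀ S)
    (hD0 : ∀ᵐ t ∂timeMeasure T, (S.𝔇 t).real D.closedCell = 0) :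
    ∀ᵐ t ∂timeMeasure T, S.μc t = 0 ∧ S.μB t = 0 := by
  have hint : ∫ t in (0 : ℝ)..T, (S.𝔇 t).real D.closedCell = 0 := by
    rw [intervalIntegral.integral_of_le hT.le, integral_Ioc_eq_integral_Ioo]
    refine (integral_congr_ae (g := fun _ => (0 : ℝ)) ?_).trans (integral_zero _ _)
    exact hD0
  obtain ⟨C₁, hc⟩ := h.compat_c
  obtain ⟨C₂, hB⟩ := h.compat_B
  have h1 := hc (fun _ => 1) continuous_const fun _ _ => zero_le_one
  have h2 := fun ε hε => hB ε hε (fun _ => 1) continuous_const fun _ _ => zero_le_one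
  simp only [one_mul, hint, mul_zero, zero_add] at h1 h2
  -- Without 𝔇 the bound reads C₂ ε I for every ε > 0. As ℭ may still have mass at the final time, I
  -- need not vanish, and ε → 0 is used instead.
  have h3 : ∫ t in (0 : ℝ)..T, (S.μB t).variation.real D.closedCell ≤ 0 := by
    set I := ∫ _ in Icc 0 T ×ˢ D.closedCell, (1 : ℝ) ∂S.ℭ
    refine ge_of_tendsto (x := 𝓝[>] (0 : ℝ)) (f := fun ε => C₂ * (ε * I)) ?_ ?_
    · have : Tendsto (fun ε : ℝ => C₂ * (ε * I)) (𝓝 0) (𝓝 (C₂ * (0 * I))) :=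
        (by fun_prop : Continuous fun ε : ℝ => C₂ * (ε * I)).tendsto 0
      rw [zero_mul, mul_zero] at this
      exact this.mono_left nhdsWithin_le_nhds
    · filter_upwards [self_mem_nhdsWithin] with ε hε using h2 ε hε
  filter_upwards [h.μc_mem.ae_eq_zero (ae_real_eq_zero_of_integral_nonpos hT.le
      (h.μc_mem.integrableOn le_top) (fun _ => measureReal_nonneg) h1),
    h.μB_mem.ae_eq_zero (ae_real_eq_zero_of_integral_nonpos hT.le
      (h.μB_mem.integrableOn one_le_two) (fun _ => measureReal_nonneg) h3)] with t a1 a2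
  exact ⟨a1, a2⟩

end

end MHD

/-- Weak-strong uniqueness for dissipative weak solutions of the compressible isentropic MHD
system. -/
theorem mainTheorem1 (d : ℕ) (hd : d = 2 ∨ d = 3) (P : MHD.Params) (hP : P.Valid)
    (D : MHD.Domain d) (hD : D.Admissible) (T : ℝ) (hT : 0 < T)
    (ρ₀ : MHD.Vec d → ℝ) (u₀ B₀ : MHD.Vec d → MHD.Vec d)
    (hρ₀ : ∀ x ∈ D.closedCell, 0 < ρ₀ x)
    (hB₀ : ∀ x ∈ D.cell, MHD.divergence B₀ x = 0)
    (S : MHD.DWFields d)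
    (hS : MHD.IsDWSolution P D T ρ₀ (fun x => ρ₀ x • u₀ x) B₀ S)
    (ρ' : ℝ → MHD.Vec d → ℝ) (u' B' : ℝ → MHD.Vec d → MHD.Vec d)
    (hcl : MHD.IsClassicalSolution P D T ρ₀ (fun x => ρ₀ x • u₀ x) B₀ ρ' u' B') :
    (∀ᵐ t ∂MHD.timeMeasure T, S.μc t = 0 ∧ S.μB t = 0 ∧ S.𝔇 t = 0) ∧
      S.ℭ (Set.Ico 0 T ×ˢ D.closedCell) = 0 ∧
      ∀ᵐ z ∂MHD.cylMeasure D T,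
        S.ρ z.1 z.2 = ρ' z.1 z.2 ∧ S.u z.1 z.2 = u' z.1 z.2 ∧ S.B z.1 z.2 = B' z.1 z.2 := by
  have := MHD.Domain.isFiniteMeasure_spaceMeasure hD
  have := MHD.isFiniteMeasure_timeMeasure T
  obtain ⟨c, r, hs, hr⟩ := hcl.exists_strongSolution hD hT hρ₀
  have h0 : (0 : ℝ) ∈ Set.Icc 0 T := ⟨le_rfl, hT.le⟩
  have hcc := D.cell_subset_closedCell
  have hzero := hS.relEnergy_eq_zero hd hP hD hs
    (fun x hx => (hr 0 h0 x (subset_closure hx)).trans (hcl.initial_ρ x (hcc hx)))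
    (fun x hx => by rw [hr 0 h0 x (subset_closure hx)]; exact hcl.initial_m x (hcc hx))
    (fun x hx => hcl.initial_B x (hcc hx))
  refine ⟨?_, ?_, ?_⟩
  · have hD0 := hzero.mono fun t ht => ht.2.1
    filter_upwards [hS.momentum_defects_eq_zero hT hD0, hS.𝔇_mem.ae_eq_zero hD0] with t h1 h2
    exact ⟨h1.1, h1.2, h2⟩
  -- The vanishing of ℭ on [0, t] is known for almost every t only, so [0, T) is exhausted by
  -- intervals whose right ends tₙ are such times and tend to T.
  · have hseq : ∀ n : ℕ, ∃ t ∈ Set.Ioo (max 0 (T - 1 / (n + 1 : ℝ))) T,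
        S.ℭ (Set.Icc 0 t ×ˢ D.closedCell) = 0 := fun n =>
      MHD.exists_mem_Ioo_of_ae ⟨le_max_left _ _, max_lt hT (by
        have : (0 : ℝ) < 1 / (n + 1 : ℝ) := by positivity
        linarith)⟩ (hzero.mono fun t ht => ht.2.2)
    choose t ht ht0 using hseq
    refine measure_mono_null ?_ (measure_iUnion_null ht0)
    rintro ⟨s, x⟩ ⟨hs, hx⟩
    obtain ⟨n, hn⟩ := exists_nat_one_div_lt (sub_pos.2 hs.2)
    have h1 : T - 1 / (n + 1 : ℝ) < t n := (le_max_right _ _).trans_lt (ht n).1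
    exact Set.mem_iUnion.2 ⟨n, ⟨hs.1, by linarith⟩, hx⟩
  · have hint := hS.integrable_relEnergy hP hD hs
    have hI : ∫ z, MHD.relEnergyAt P S r u' B' z.1 z.2 ∂MHD.cylMeasure D T = 0 := by
      refine (integral_prod _ hint).trans ((integral_congr_ae (g := fun _ => (0 : ℝ)) ?_).trans
        (integral_zero _ _))
      filter_upwards [hzero] with t ht using ht.1
    have hae := (integral_eq_zero_iff_of_nonneg_ae (hS.relEnergyAt_nonneg hP hs) hint).1 hI
    filter_upwards [hae, hS.ρ_nonneg, MHD.ae_mem_cylinder hD T] with z h1 h2 h3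
    have h4 := MHD.relEnergy_eq_zero hP h2 (hs.r_pos z.1 z.2) h1
    exact ⟨h4.1.trans (hr z.1 (Set.Ioo_subset_Icc_self h3.1) z.2 (subset_closure h3.2)), h4.2⟩
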